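/- **Setting.** Let $\Theta\subset\mathbb R^d$ be convex and compact with $0\in\Theta$ and Euclidean diameter $\Delta$, let $\mathcal Y\subset\mathbb R$, and let $\ell:\mathbb R\times\mathcal Y\to\mathbb R_+$ be a measurable loss which is convex and differentiable in its first argument, with $\ell'(z,y)=\partial\ell(z,y)/\partial z$ satisfying $|\ell'(z,y)-\ell'(z',y)|\le\gamma|z-z'|$, and such that for some $q\in[1,2]$ and positive constants $C_1,C_2,C_1',C_2'$ one has $|\ell(z,y)|\le C_1+C_2|z-y|^q$ and $|\ell'(z,y)|\le C_1'+C_2'|z-y|^{q-1}$ for all $z\in\mathbb R$, $y\in\mathcal Y$. Let $(X_i,Y_i)_{i=1}^n$ be a sample in $\mathbb R^d\times\mathcal Y$ whose indices are divided into disjoint sets, $\{1,\dots,n\}=\mathcal I\cup\mathcal O$ with $|\mathcal I|>|\mathcal O|$, such that the pairs $(X_i,Y_i)_{i\in\mathcal I}$ are i.i.d. with distribution $P$ and the pairs $(X_i,Y_i)_{i\in\mathcal O}$ are arbitrary. Let $\alpha\in(0,1]$ be such that, for $(X,Y)\sim P$, $\mathbb E|X^j|^{\max(2,q(1+\alpha))}<\infty$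 and $\mathbb E\big|Y^{q-1}X^j\big|^{1+\alpha}<\infty$ for every coordinate $j$ (with $|Y|^{q-1}$ for $Y^{q-1}$), and $\mathbb E|Y|^q<\infty$. Put $$R(\theta)=\mathbb E[\ell(X^\top\theta,Y)],\quad g_j(\theta)=\frac{\partial R(\theta)}{\partial\theta_j},\quad g_j^i(\theta)=\ell'(X_i^\top\theta,Y_i)X_i^j,$$ $$M_{\alpha,j}=\sup_{\theta\in\Theta}\mathbb E\Big[\big|\ell'(X^\top\theta,Y)X^j-\mathbb E[\ell'(X^\top\theta,Y)X^j]\big|^{1+\alpha}\Big],\qquad \mathcal R_j(\Theta)=\mathbb E\Big[\sup_{\theta\in\Theta}\sum_{i\in\mathcal I}\varepsilon_i g_j^i(\theta)\Big],$$ where the $\varepsilon_i$ are i.i.d. Rademacher variables independent of the data. For $1\le K\le n$ let $B_1,\dots,B_K$ be a random partition of $\{1,\dots,n\}$ into nonempty blocks whose sizes differ by at most one, independent of the inliers (for instance, sampled uniformly), and let $\widehat g_j^{\mathtt{MOM}}(\theta)$ be the median of the $K$ block means $|B_k|^{-1}\sum_{i\in B_k}g_j^i(\theta)$. **Claim.**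 Suppose that $|\mathcal O|\le K/12$. 1. For every $j$, with $b_j=\max\Big(\big(\tfrac{36M_{\alpha,j}}{(n/K)^\alpha}\big)^{1/(1+\alpha)},\tfrac{64\mathcal R_j(\Theta)}n\Big)$, $$\mathbb P\Big[\sup_{\theta\in\Theta}|\widehat g_j^{\mathtt{MOM}}(\theta)-g_j(\theta)|>b_j\Big]\le e^{-K/18},$$ and the same holds with $\ge b_j$ in place of $>b_j$ if $b_j>0$. 2. Let $\delta\in(0,1)$ with $18\log(d/\delta)\ge1$ (which is automatic for $d\ge2$), let $c_\alpha=2^{(2+\alpha)/(1+\alpha)}3^2$, and consider the inequality $$\sup_{\theta\in\Theta}|\widehat g_j^{\mathtt{MOM}}(\theta)-g_j(\theta)|\le\max\Big(c_\alpha M_{\alpha,j}^{1/(1+\alpha)}\Big(\frac{\log(d/\delta)}n\Big)^{\alpha/(1+\alpha)},\frac{64\mathcal R_j(\Theta)}n\Big).\qquad(*)$$ If $K=\lceil18\log(1/\delta)\rceil$, then for each $j$ the inequality $(*)$ holds with probability at least $1-\delta$. If $K=\lceil18\log(d/\delta)\rceil$, then with probability at least $1-\delta$ the inequality $(*)$ holds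 for all $j\in\{1,\dots,d\}$ simultaneously. 3. (Irrespective of $K$ and of the bound on $|\mathcal O|$.) If $\mathbb E|X^k|^{2(1+\alpha)}<\infty$ for all $k$, put $\mu_{X,k}=\mathbb E[|X^k|^{2(1+\alpha)}]^{1/(2(1+\alpha))}$. Then for every $j$ $$\mathcal R_j(\Theta)\le\gamma\Delta C_\alpha\Big(n\,\mu_{X,j}^{1+\alpha}\sum_{k=1}^d\mu_{X,k}^{1+\alpha}\Big)^{1/(1+\alpha)},$$ where $C_\alpha$ depends only on $\alpha$. In particular $\mathcal R_j(\Theta)=O\big((nd)^{1/(1+\alpha)}\big)$: if $\mu_{X,k}\le m$ for all $k$, then $\mathcal R_j(\Theta)\le\gamma\Delta C_\alpha m^2(nd)^{1/(1+\alpha)}$. -/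

import Mathlib

open MeasureTheory ProbabilityTheory
open scoped ENNReal

noncomputable section

namespace RobustMOM

/-- Assumption on a loss `ℓ : ℝ × 𝒴 → ℝ₊`: for each label it is nonnegative, convex, differentiable
and `γ`-smooth in its first argument, and it has asymptotic polynomial degree `q ∈ [1, 2]`. -/
structure LossAssumption {𝒴 : Set ℝ} (ℓ : ℝ → 𝒴 → ℝ) (γ q : ℝ) : Prop where
  measurable : Measurable (Function.uncurry ℓ)
  nonneg : ∀ z y, 0 ≤ ℓ z y
  convex : ∀ y, ConvexOn ℝ Set.univ (fun z => ℓ z y)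
  differentiable : ∀ y, Differentiable ℝ (fun z => ℓ z y)
  smooth : ∀ z z' y, |deriv (fun t => ℓ t y) z - deriv (fun t => ℓ t y) z'| ≤ γ * |z - z'|
  one_le_degree : 1 ≤ q
  degree_le_two : q ≤ 2
  growth : ∃ C₁ C₂ : ℝ, 0 < C₁ ∧ 0 < C₂ ∧
    ∀ (z : ℝ) (y : 𝒴), |ℓ z y| ≤ C₁ + C₂ * |z - (y : ℝ)| ^ q
  deriv_growth : ∃ C₁ C₂ : ℝ, 0 < C₁ ∧ 0 < C₂ ∧
    ∀ (z : ℝ) (y : 𝒴), |deriv (fun t => ℓ t y) z| ≤ C₁ + C₂ * |z - (y : ℝ)| ^ (q - 1)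

/-- Assumption on the data: the indices `Fin n` are split into the outliers `O` and the inliers
`Oᶜ`; the inliers are more numerous, and they are i.i.d. with distribution `P`; nothing at all
(not even measurability) is required of the outliers. The last three fields are the moment
conditions on `P`. -/
structure DataAssumption {Ω : Type*} [MeasurableSpace Ω] (μ : Measure Ω) {d n : ℕ} {𝒴 : Set ℝ}
    (P : Measure (EuclideanSpace ℝ (Fin d) × 𝒴))
    (X : Fin n → Ω → EuclideanSpace ℝ (Fin d)) (Y : Fin n → Ω → 𝒴)
    (O : Finset (Fin n)) (α q : ℝ) : Prop where
  majority : O.card < Oᶜ.card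
  measurable : ∀ i, i ∉ O → Measurable (fun ω => (X i ω, Y i ω))
  indep : iIndepFun (fun (i : {i : Fin n // i ∉ O}) ω => (X i ω, Y i ω)) μ
  law : ∀ i, i ∉ O → μ.map (fun ω => (X i ω, Y i ω)) = P
  moment_X : ∀ j, Integrable (fun p => |p.1 j| ^ max 2 (q * (α + 1))) P
  moment_XY : ∀ j, Integrable (fun p => (|(p.2 : ℝ)| ^ (q - 1) * |p.1 j|) ^ (1 + α)) P
  moment_Y : Integrable (fun p => |(p.2 : ℝ)| ^ q) P

/-- The `j`-th partial derivative at `θ` of the loss of the sample `(x, y)`, that is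
`ℓ'(xᵀθ, y) xʲ`, where `ℓ'` is the derivative of `ℓ` in its first argument. -/
def samplePartial {d : ℕ} {𝒴 : Set ℝ} (ℓ : ℝ → 𝒴 → ℝ) (j : Fin d)
    (θ : EuclideanSpace ℝ (Fin d)) (x : EuclideanSpace ℝ (Fin d)) (y : 𝒴) : ℝ :=
  deriv (fun z => ℓ z y) (inner ℝ x θ) * x j

/-- The true risk `R(θ) = E[ℓ(Xᵀθ, Y)]`, for `(X, Y)` with distribution `P`. -/
def risk {d : ℕ} {𝒴 : Set ℝ} (ℓ : ℝ → 𝒴 → ℝ) (P : Measure (EuclideanSpace ℝ (Fin d) × 𝒴))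
    (θ : EuclideanSpace ℝ (Fin d)) : ℝ :=
  ∫ p, ℓ (inner ℝ p.1 θ) p.2 ∂P

/-- The partial derivative `g_j(θ) = ∂R(θ)/∂θ_j` of the true risk. -/
def riskPartial {d : ℕ} {𝒴 : Set ℝ} (ℓ : ℝ → 𝒴 → ℝ)
    (P : Measure (EuclideanSpace ℝ (Fin d) × 𝒴)) (j : Fin d)
    (θ : EuclideanSpace ℝ (Fin d)) : ℝ :=
  lineDeriv ℝ (risk ℓ P) θ (EuclideanSpace.single j 1)

/-- The centered moment `m_{α,j}(θ)` of order `1 + α` of the sample partial derivative. -/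
def centeredMoment {d : ℕ} {𝒴 : Set ℝ} (ℓ : ℝ → 𝒴 → ℝ)
    (P : Measure (EuclideanSpace ℝ (Fin d) × 𝒴)) (α : ℝ) (j : Fin d)
    (θ : EuclideanSpace ℝ (Fin d)) : ℝ :=
  ∫ p, |samplePartial ℓ j θ p.1 p.2 - ∫ p', samplePartial ℓ j θ p'.1 p'.2 ∂P| ^ (1 + α) ∂P

/-- `M_{α,j}`, the supremum over `Θ` of the centered moments `m_{α,j}(θ)`. -/
def maxCenteredMoment {d : ℕ} {𝒴 : Set ℝ} (ℓ : ℝ → 𝒴 → ℝ)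
    (P : Measure (EuclideanSpace ℝ (Fin d) × 𝒴)) (Θ : Set (EuclideanSpace ℝ (Fin d)))
    (α : ℝ) (j : Fin d) : ℝ :=
  ⨆ θ : Θ, centeredMoment ℓ P α j θ

/-- The moment `μ_{X,k} = E[|Xᵏ|^{2(1+α)}]^{1/(2(1+α))}` of the `k`-th feature. -/
def featureMoment {d : ℕ} {𝒴 : Set ℝ} (P : Measure (EuclideanSpace ℝ (Fin d) × 𝒴))
    (α : ℝ) (k : Fin d) : ℝ :=
  (∫ p, |p.1 k| ^ (2 * (1 + α)) ∂P) ^ (1 / (2 * (1 + α)))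

/-- The median of `K ≥ 1` real numbers: sort them in nondecreasing order and take the mean of the
entries at the (zero-based) positions `⌊(K - 1) / 2⌋` and `⌊K / 2⌋`, which coincide for odd `K`. -/
def median {K : ℕ} [NeZero K] (v : Fin K → ℝ) : ℝ :=
  (v (Tuple.sort v ⟨(K - 1) / 2, by have := NeZero.pos K; omega⟩) +
    v (Tuple.sort v ⟨K / 2, by have := NeZero.pos K; omega⟩)) / 2

/-- The mean of `v` over the `k`-th block, the block of `i : Fin n` being `b i`. -/
def blockMean {n K : ℕ} (b : Fin n → Fin K) (v : Fin n → ℝ) (k : Fin K) : ℝ :=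
  (∑ i with b i = k, v i) / ((Finset.univ.filter (fun i => b i = k)).card : ℝ)

/-- The random partition `B` of the indices into `K` nonempty blocks whose sizes differ by at most
one, drawn independently of the inliers. The law of the partition is otherwise free: uniform
sampling is a special case. -/
structure RandomBlocks {Ω : Type*} [MeasurableSpace Ω] (μ : Measure Ω) {d n : ℕ} {𝒴 : Set ℝ}
    (X : Fin n → Ω → EuclideanSpace ℝ (Fin d)) (Y : Fin n → Ω → 𝒴)
    (O : Finset (Fin n)) {K : ℕ} (B : Ω → Fin n → Fin K) : Prop where
  le : K ≤ n
  balanced : ∀ ω k k', (Finset.univ.filter (fun i => B ω i = k)).card ≤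
    (Finset.univ.filter (fun i => B ω i = k')).card + 1
  measurable : Measurable B
  indep : IndepFun B (fun ω (i : {i : Fin n // i ∉ O}) => (X i ω, Y i ω)) μ

/-- The median-of-means estimator of `g_j(θ)` on the data `x, y` with blocks `b`. -/
def momEstimator {d n K : ℕ} [NeZero K] {𝒴 : Set ℝ} (ℓ : ℝ → 𝒴 → ℝ) (b : Fin n → Fin K)
    (x : Fin n → EuclideanSpace ℝ (Fin d)) (y : Fin n → 𝒴) (j : Fin d)
    (θ : EuclideanSpace ℝ (Fin d)) : ℝ :=
  median (blockMean b (fun i => samplePartial ℓ j θ (x i) (y i)))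

/-- The uniform deviation over `Θ` of the median-of-means estimator from `g_j`. -/
def momDeviation {d n K : ℕ} [NeZero K] {𝒴 : Set ℝ} (ℓ : ℝ → 𝒴 → ℝ)
    (P : Measure (EuclideanSpace ℝ (Fin d) × 𝒴)) (Θ : Set (EuclideanSpace ℝ (Fin d)))
    (b : Fin n → Fin K) (x : Fin n → EuclideanSpace ℝ (Fin d)) (y : Fin n → 𝒴)
    (j : Fin d) : ℝ :=
  ⨆ θ : Θ, |momEstimator ℓ b x y j θ - riskPartial ℓ P j θ|

/-- The Rademacher distribution: `-1` and `1` with probability `1/2` each. -/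
def rademacher : Measure ℝ :=
  (2⁻¹ : ℝ≥0∞) • Measure.dirac (-1) + (2⁻¹ : ℝ≥0∞) • Measure.dirac 1

instance : IsProbabilityMeasure rademacher :=
  ⟨by simp [rademacher, ENNReal.inv_two_add_inv_two]⟩

/-- The Rademacher complexity `R_j(Θ) = E[sup_{θ ∈ Θ} ∑_{i ∈ I} ε_i g_j^i(θ)]`, where `I = Oᶜ` and
the `ε_i` are i.i.d. Rademacher variables that are independent of the data. -/
def rademacherComplexity {Ω : Type*} [MeasurableSpace Ω] (μ : Measure Ω) {d n : ℕ} {𝒴 : Set ℝ}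
    (ℓ : ℝ → 𝒴 → ℝ) (Θ : Set (EuclideanSpace ℝ (Fin d)))
    (X : Fin n → Ω → EuclideanSpace ℝ (Fin d)) (Y : Fin n → Ω → 𝒴)
    (O : Finset (Fin n)) (j : Fin d) : ℝ :=
  ∫ w : Ω × (Fin n → ℝ), ⨆ θ : Θ, ∑ i ∈ Oᶜ, w.2 i * samplePartial ℓ j θ (X i w.1) (Y i w.1)
    ∂(μ.prod (Measure.pi (fun _ : Fin n => rademacher)))

end RobustMOM

end

open RobustMOM

/-! If the median at `θ` is off by `ε`, at least `K/2` block means are off by `ε`. At most `|O|`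
blocks contain an outlier, so at least `K/2 - |O| ≥ 5K/12` clean blocks are bad at `θ`. It remains
to show that, uniformly in `θ`, the number of bad clean blocks stays below this. The indicator of
`|u| ≥ 1` is replaced by `ramp`, which is `4/3`-Lipschitz and at most `4/3 |u|^p`, with `p = 1 + α`.
The supremum over `θ` of the sum of ramps then has three contributions.

Single mean: the von Bahr–Esseen inequality with constant `2^(2-p)`, for blocks of size at least
`n/(2K)`, gives at most `(8/3) M (K/n)^α / ε^p` per block, which is `8/(3C)` once `C M (K/n)^α ≤
ε^p`. Centered supremum: symmetrization over blocks, contraction to remove the ramp, then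
symmetrization and contraction over samples give at most `(16/3)(2K/n) R / ε ≤ K/6` once `64 R/n ≤
ε`. Fluctuation: the supremum changes by at most one with each block, so it exceeds its mean by
`K/6` with probability at most `exp(-K/18)`. With `C = 36` the sum `1/3 + 2/27` is below `5/12`.

The argument runs for finite classes, passes to a dense sequence of `Θ` by monotone limits, and
reaches all of `Θ` by continuity in `θ`. The random partition is handled one value at a time: the
bad event for a fixed partition involves inliers only, so it is measurable and independent of the
partition, whatever the outliers are.

The Rademacher complexity is bounded by contraction to the linear functions `γ Xʲ ⟨X, θ⟩`,
Cauchy–Schwarz in `θ`, and the von Bahr–Esseen inequality for each coordinate of the vector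
Rademacher sum. The main steps are `signMean_contraction`, `integral_ciSup_sum_sub_le`,
`integral_exp_ciSup_sum_le`, `integral_abs_sum_rpow_le`, `measure_sum_ramp_blockDev_gt_le` and
`exists_lt_sum_ramp_of_le_momDeviation`. -/

namespace RobustMOM

/-! ### Suprema of bounded families. -/

section Sup

variable {T : Type*}

lemma bddAbove_of_abs {v : T → ℝ} (h : ∃ C, ∀ θ, |v θ| ≤ C) : BddAbove (Set.range v) := by
  obtain ⟨C, hC⟩ := h
  exact ⟨C, by rintro _ ⟨θ, rfl⟩; exact (abs_le.1 (hC θ)).2⟩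

lemma abs_add_bounded {v w : T → ℝ} (hv : ∃ C, ∀ θ, |v θ| ≤ C) (hw : ∃ C, ∀ θ, |w θ| ≤ C) :
    ∃ C, ∀ θ, |v θ + w θ| ≤ C := by
  obtain ⟨C, hC⟩ := hv
  obtain ⟨D, hD⟩ := hw
  exact ⟨C + D, fun θ => (abs_add_le _ _).trans (add_le_add (hC θ) (hD θ))⟩

lemma abs_mul_bounded {v : T → ℝ} (hv : ∃ C, ∀ θ, |v θ| ≤ C) (c : ℝ) :
    ∃ C, ∀ θ, |c * v θ| ≤ C := by
  obtain ⟨C, hC⟩ := hv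
  exact ⟨|c| * C, fun θ => by rw [abs_mul]; gcongr; exact hC θ⟩

lemma abs_sum_bounded {ι : Type*} {s : Finset ι} {v : ι → T → ℝ}
    (hv : ∀ i, ∃ C, ∀ θ, |v i θ| ≤ C) : ∃ C, ∀ θ, |∑ i ∈ s, v i θ| ≤ C := by
  choose C hC using hv
  exact ⟨∑ i ∈ s, C i, fun θ =>
    (Finset.abs_sum_le_sum_abs _ _).trans (Finset.sum_le_sum fun i _ => hC i θ)⟩

lemma abs_ciSup_le [Nonempty T] {v : T → ℝ} {C : ℝ} (h : ∀ θ, |v θ| ≤ C) : |⨆ θ, v θ| ≤ C := by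
  have hb := bddAbove_of_abs ⟨C, h⟩
  obtain ⟨θ⟩ := ‹Nonempty T›
  refine abs_le.2 ⟨(abs_le.1 (h θ)).1.trans (le_ciSup hb θ), ?_⟩
  have : Nonempty T := ⟨θ⟩
  exact ciSup_le fun θ => (abs_le.1 (h θ)).2

/-- The two-point case of contraction. For near-maximizers `θ`, `θ'` on the left, the increment of
`u` is at most `|t θ - t θ'|`; according to the sign of `t θ - t θ'`, the pair is used on the right
in the same or in the swapped order. -/
lemma ciSup_add_ciSup_sub_le [Nonempty T] {v u t : T → ℝ} (hv : ∃ C, ∀ θ, |v θ| ≤ C)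
    (ht : ∃ C, ∀ θ, |t θ| ≤ C) (h : ∀ θ θ', |u θ - u θ'| ≤ |t θ - t θ'|) :
    (⨆ θ, (v θ + u θ)) + (⨆ θ, (v θ - u θ)) ≤ (⨆ θ, (v θ + t θ)) + (⨆ θ, (v θ - t θ)) := by
  have h1 : BddAbove (Set.range fun θ => v θ + t θ) := bddAbove_of_abs (abs_add_bounded hv ht)
  have h2 : BddAbove (Set.range fun θ => v θ - t θ) := by
    have := bddAbove_of_abs (abs_add_bounded hv (abs_mul_bounded ht (-1)))
    simpa [sub_eq_add_neg] using this
  refine ciSup_add_ciSup_le fun θ θ' => ?_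
  have h3 := (le_abs_self _).trans (h θ θ')
  rcases abs_cases (t θ - t θ') with ⟨h4, -⟩ | ⟨h4, -⟩
  · have := le_ciSup h1 θ
    have := le_ciSup h2 θ'
    linarith
  · have := le_ciSup h1 θ'
    have := le_ciSup h2 θ
    linarith

end Sup

/-! ### Averages over sign vectors and the contraction principle. -/

section Signs

variable {ι : Type*} [DecidableEq ι]

/-- The sign of a Boolean. -/
noncomputable def boolSign (b : Bool) : ℝ := if b then 1 else -1

lemma boolSign_not (b : Bool) : boolSign (!b) = -boolSign b := by
  cases b <;> simp [boolSign]

lemma abs_boolSign (b : Bool) : |boolSign b| = 1 := by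
  cases b <;> simp [boolSign]

/-- Flip the `i`-th sign. -/
def flipSign (i : ι) (σ : ι → Bool) : ι → Bool := Function.update σ i (!σ i)

lemma flipSign_flipSign (i : ι) (σ : ι → Bool) : flipSign i (flipSign i σ) = σ := by
  simp [flipSign]

lemma flipSign_self (i : ι) (σ : ι → Bool) : flipSign i σ i = !σ i := by simp [flipSign]

lemma flipSign_of_ne {i j : ι} (h : j ≠ i) (σ : ι → Bool) : flipSign i σ j = σ j := by
  simp [flipSign, h]

variable [Fintype ι]

/-- The average over all sign vectors. -/
noncomputable def signMean (h : (ι → Bool) → ℝ) : ℝ := (∑ σ, h σ) / 2 ^ Fintype.card ι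

lemma signMean_mono {Q R : (ι → Bool) → ℝ} (h : ∀ σ, Q σ ≤ R σ) : signMean Q ≤ signMean R :=
  div_le_div_of_nonneg_right (Finset.sum_le_sum fun σ _ => h σ) (by positivity)

lemma signMean_const (c : ℝ) : signMean (fun _ : ι → Bool => c) = c := by
  simp [signMean]

lemma signMean_mul (c : ℝ) (Q : (ι → Bool) → ℝ) :
    signMean (fun σ => c * Q σ) = c * signMean Q := by
  simp [signMean, ← Finset.mul_sum, mul_div_assoc]

/-- Flipping one sign is an involution, so each average is half the average of the sums over pairs.
This reduces statements about all signs to a single free sign. -/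
lemma signMean_le_of_flip {Q R : (ι → Bool) → ℝ} (i : ι)
    (h : ∀ σ, Q σ + Q (flipSign i σ) ≤ R σ + R (flipSign i σ)) : signMean Q ≤ signMean R := by
  have key : ∀ Q : (ι → Bool) → ℝ, ∑ σ, Q (flipSign i σ) = ∑ σ, Q σ := fun Q =>
    Equiv.sum_comp (Function.Involutive.toPerm (flipSign i) (flipSign_flipSign i)) Q
  have := Finset.sum_le_sum fun σ (_ : σ ∈ Finset.univ) => h σ
  simp only [Finset.sum_add_distrib, key] at this
  exact div_le_div_of_nonneg_right (by linarith) (by positivity)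

lemma integral_signMean {Ω : Type*} [MeasurableSpace Ω] {μ : Measure Ω}
    {F : (ι → Bool) → Ω → ℝ} (hF : ∀ σ, Integrable (F σ) μ) :
    ∫ ω, signMean (fun σ => F σ ω) ∂μ = signMean fun σ => ∫ ω, F σ ω ∂μ := by
  simp only [signMean]
  rw [integral_div, integral_finsetSum _ fun σ _ => hF σ]

/-- The contraction principle for Rademacher averages. -/
theorem signMean_contraction {T : Type*} [Nonempty T] {u t : ι → T → ℝ}
    (ht : ∀ i, ∃ C, ∀ θ, |t i θ| ≤ C) (h : ∀ i θ θ', |u i θ - u i θ'| ≤ |t i θ - t i θ'|) :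
    signMean (fun σ => ⨆ θ, ∑ i, boolSign (σ i) * u i θ) ≤
      signMean (fun σ => ⨆ θ, ∑ i, boolSign (σ i) * t i θ) := by
  have hu : ∀ i, ∃ C, ∀ θ, |u i θ| ≤ C := fun i => by
    obtain ⟨C, hC⟩ := ht i
    obtain ⟨θ₀⟩ := ‹Nonempty T›
    refine ⟨|u i θ₀| + (C + C), fun θ => ?_⟩
    calc |u i θ| = |u i θ₀ + (u i θ - u i θ₀)| := by ring_nf
      _ ≤ |u i θ₀| + |u i θ - u i θ₀| := abs_add_le _ _
      _ ≤ |u i θ₀| + (|t i θ| + |t i θ₀|) := by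
          gcongr; exact (h i θ θ₀).trans (abs_sub _ _)
      _ ≤ _ := by gcongr <;> apply hC
  -- Hybrid argument: the functions `u i` replace the `t i` one index at a time. No absolute value
  -- surrounds the sum, so neither `u i` nor `t i` needs to vanish anywhere and no factor two is
  -- lost.
  have key : ∀ s : Finset ι,
      signMean (fun σ => ⨆ θ, ∑ i, boolSign (σ i) * (if i ∈ s then u i θ else t i θ)) ≤
      signMean (fun σ => ⨆ θ, ∑ i, boolSign (σ i) * t i θ) := by
    intro s
    induction s using Finset.induction_on with
    | empty => simp
    | insert i s hi ih =>
      refine le_trans (signMean_le_of_flip i fun σ => ?_) ih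
      set v : T → ℝ := fun θ =>
        ∑ j ∈ Finset.univ.erase i, boolSign (σ j) * (if j ∈ s then u j θ else t j θ) with hv
      have hvb : ∃ C, ∀ θ, |v θ| ≤ C := abs_sum_bounded fun j => by
        by_cases hj : j ∈ s
        · simpa [hj] using abs_mul_bounded (hu j) _
        · simpa [hj] using abs_mul_bounded (ht j) _
      have e1 : ∀ (τ : ι → Bool), (∀ j, j ≠ i → τ j = σ j) → ∀ θ,
          ∑ j, boolSign (τ j) * (if j ∈ insert i s then u j θ else t j θ) =
            v θ + boolSign (τ i) * u i θ := fun τ hτ θ => by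
        rw [← Finset.sum_erase_add _ _ (Finset.mem_univ i)]
        simp only [Finset.mem_insert_self, if_true]
        congr 1
        refine Finset.sum_congr rfl fun j hj => ?_
        have hji := Finset.ne_of_mem_erase hj
        simp [Finset.mem_insert, hji, hτ j hji]
      have e2 : ∀ (τ : ι → Bool), (∀ j, j ≠ i → τ j = σ j) → ∀ θ,
          ∑ j, boolSign (τ j) * (if j ∈ s then u j θ else t j θ) =
            v θ + boolSign (τ i) * t i θ := fun τ hτ θ => by
        rw [← Finset.sum_erase_add _ _ (Finset.mem_univ i)]
        simp only [hi, if_false]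
        congr 1
        refine Finset.sum_congr rfl fun j hj => ?_
        have hji := Finset.ne_of_mem_erase hj
        simp [hτ j hji]
      have hf : ∀ j, j ≠ i → flipSign i σ j = σ j := fun j hj => flipSign_of_ne hj σ
      simp only [e1 σ (fun _ _ => rfl), e2 σ (fun _ _ => rfl), e1 _ hf, e2 _ hf, flipSign_self,
        boolSign_not, neg_mul, ← sub_eq_add_neg]
      refine ciSup_add_ciSup_sub_le hvb (abs_mul_bounded (ht i) _) fun θ θ' => ?_
      rw [← mul_sub, ← mul_sub, abs_mul, abs_mul, abs_boolSign, one_mul, one_mul]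
      exact h i θ θ'
  simpa using key Finset.univ

end Signs

/-! ### Symmetrization and bounded differences for finite classes. -/

section Independence

variable {Ω : Type*} [MeasurableSpace Ω] {μ : Measure Ω} [IsProbabilityMeasure μ]

lemma indepFun_integral_eq {E F : Type*} [MeasurableSpace E] [MeasurableSpace F]
    {V : Ω → E} {W : Ω → F} (h : IndepFun V W μ) (hV : Measurable V) (hW : Measurable W)
    {G : E × F → ℝ} (hG : Measurable G)
    (hi : Integrable (fun p : Ω × Ω => G (V p.1, W p.2)) (μ.prod μ)) :
    ∫ ω, G (V ω, W ω) ∂μ = ∫ ω, ∫ ω', G (V ω, W ω') ∂μ ∂μ := by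
  rw [integral_integral (f := fun ω ω' => G (V ω, W ω')) hi]
  have h1 := h.map_prod_eq_prod_map_map hV.aemeasurable hW.aemeasurable
  rw [Measure.map_prod_map _ _ hV hW] at h1
  have h2 : ∫ ω, G (V ω, W ω) ∂μ = ∫ p, G p ∂(μ.map fun ω => (V ω, W ω)) :=
    (integral_map (hV.prodMk hW).aemeasurable hG.aestronglyMeasurable).symm
  rw [h2, h1, integral_map (hV.prodMap hW).aemeasurable hG.aestronglyMeasurable]
  rfl

variable {κ : Type*} [DecidableEq κ] {T : Type*} [Fintype T] [Nonempty T]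

lemma abs_ciSup_le_sum_abs (v : T → ℝ) : |⨆ θ, v θ| ≤ ∑ θ, |v θ| :=
  abs_ciSup_le fun θ => Finset.single_le_sum (f := fun θ => |v θ|)
    (fun _ _ => abs_nonneg _) (Finset.mem_univ θ)

lemma integrable_ciSup {ν : Measure Ω} {v : Ω → T → ℝ} (hm : ∀ θ, Measurable fun ω => v ω θ)
    (hi : ∀ θ, Integrable (fun ω => v ω θ) ν) : Integrable (fun ω => ⨆ θ, v ω θ) ν :=
  (integrable_finsetSum Finset.univ fun θ _ => (hi θ).abs).mono'
    (Measurable.iSup hm).aestronglyMeasurable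
    (Filter.Eventually.of_forall fun _ => abs_ciSup_le_sum_abs _)

lemma ciSup_integral_le {ν : Measure Ω} {v : Ω → T → ℝ} (hm : ∀ θ, Measurable fun ω => v ω θ)
    (hi : ∀ θ, Integrable (fun ω => v ω θ) ν) :
    ⨆ θ, ∫ ω, v ω θ ∂ν ≤ ∫ ω, ⨆ θ, v ω θ ∂ν :=
  ciSup_le fun θ => integral_mono (hi θ) (integrable_ciSup hm hi) fun ω =>
    le_ciSup (f := fun θ => v ω θ) (Set.finite_range _).bddAbove θ

/-- One step of symmetrization. With `m` the mean of `W`, the vector `R + (W - m)` is the midpoint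
of `R + 2W` and `R - 2m`. In the second, Jensen's inequality for an independent copy replaces `m` by
`W`, and independence of `R` and `W` returns to the original pair. -/
lemma two_mul_integral_ciSup_le {R W : Ω → T → ℝ} (h : IndepFun R W μ) (hR : Measurable R)
    (hW : Measurable W) (hRi : ∀ θ, Integrable (fun ω => R ω θ) μ)
    (hWi : ∀ θ, Integrable (fun ω => W ω θ) μ) :
    2 * ∫ ω, ⨆ θ, (R ω θ + (W ω θ - ∫ ω', W ω' θ ∂μ)) ∂μ ≤
      ∫ ω, ⨆ θ, (R ω θ + 2 * W ω θ) ∂μ + ∫ ω, ⨆ θ, (R ω θ - 2 * W ω θ) ∂μ := by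
  have hRm : ∀ θ, Measurable fun ω => R ω θ := fun θ => (measurable_pi_apply θ).comp hR
  have hWm : ∀ θ, Measurable fun ω => W ω θ := fun θ => (measurable_pi_apply θ).comp hW
  set m : T → ℝ := fun θ => ∫ ω', W ω' θ ∂μ
  have i1 : Integrable (fun ω => ⨆ θ, (R ω θ + (W ω θ - m θ))) μ :=
    integrable_ciSup (fun θ => by have := hRm θ; have := hWm θ; fun_prop)
      fun θ => (hRi θ).add ((hWi θ).sub (integrable_const _))
  have i2 : Integrable (fun ω => ⨆ θ, (R ω θ + 2 * W ω θ)) μ :=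
    integrable_ciSup (fun θ => by have := hRm θ; have := hWm θ; fun_prop)
      fun θ => (hRi θ).add ((hWi θ).const_mul 2)
  have i3 : Integrable (fun ω => ⨆ θ, (R ω θ - 2 * m θ)) μ :=
    integrable_ciSup (fun θ => by have := hRm θ; fun_prop)
      fun θ => (hRi θ).sub (integrable_const _)
  have hG : Measurable fun p : (T → ℝ) × (T → ℝ) => ⨆ θ, (p.1 θ - 2 * p.2 θ) :=
    Measurable.iSup fun θ => by fun_prop
  have i4 : Integrable (fun p : Ω × Ω => ⨆ θ, (R p.1 θ - 2 * W p.2 θ)) (μ.prod μ) :=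
    integrable_ciSup (fun θ => by have := hRm θ; have := hWm θ; fun_prop)
      fun θ => ((hRi θ).comp_fst μ).sub (((hWi θ).comp_snd μ).const_mul 2)
  have e := indepFun_integral_eq h hR hW hG i4
  dsimp only at e
  rw [e]
  calc 2 * ∫ ω, ⨆ θ, (R ω θ + (W ω θ - m θ)) ∂μ
      = ∫ ω, 2 * ⨆ θ, (R ω θ + (W ω θ - m θ)) ∂μ := (integral_const_mul _ _).symm
    _ ≤ ∫ ω, ((⨆ θ, (R ω θ + 2 * W ω θ)) + ⨆ θ, (R ω θ - 2 * m θ)) ∂μ := by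
        refine integral_mono (i1.const_mul 2) (i2.add i3) fun ω => ?_
        rw [← le_div_iff₀' two_pos]
        refine ciSup_le fun θ => ?_
        have h1 := le_ciSup (f := fun θ => R ω θ + 2 * W ω θ) (Set.finite_range _).bddAbove θ
        have h2 := le_ciSup (f := fun θ => R ω θ - 2 * m θ) (Set.finite_range _).bddAbove θ
        linarith
    _ = ∫ ω, ⨆ θ, (R ω θ + 2 * W ω θ) ∂μ + ∫ ω, ⨆ θ, (R ω θ - 2 * m θ) ∂μ := integral_add i2 i3
    _ ≤ _ := by
        refine add_le_add le_rfl (integral_mono i3 i4.integral_prod_left fun ω => ?_)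
        · have := ciSup_integral_le (ν := μ) (v := fun ω' θ => R ω θ - 2 * W ω' θ)
            (fun θ => by have := hWm θ; fun_prop)
            (fun θ => (integrable_const _).sub ((hWi θ).const_mul 2))
          refine le_trans (le_of_eq ?_) this
          congr 1
          ext θ
          rw [integral_sub (integrable_const _) ((hWi θ).const_mul 2), integral_const_mul]
          simp [m]

/-- Symmetrization of the maximum of a sum of independent random vectors. -/
theorem integral_ciSup_sum_sub_le [Fintype κ] {W : κ → Ω → T → ℝ} (h : iIndepFun W μ)
    (hW : ∀ k, Measurable (W k)) (hi : ∀ k θ, Integrable (fun ω => W k ω θ) μ) :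
    ∫ ω, ⨆ θ, ∑ k, (W k ω θ - ∫ ω', W k ω' θ ∂μ) ∂μ ≤
      signMean fun σ : κ → Bool => ∫ ω, ⨆ θ, ∑ k, 2 * (boolSign (σ k) * W k ω θ) ∂μ := by
  -- Hybrid summands: symmetrized with factor two for the indices in `s`, still centered for the
  -- others. The centered summand does not depend on its sign, so pairing over the flip doubles it
  -- and one step of symmetrization applies.
  set c : Finset κ → (κ → Bool) → κ → (T → ℝ) → T → ℝ := fun s σ k w θ =>
    if k ∈ s then 2 * (boolSign (σ k) * w θ) else w θ - ∫ ω', W k ω' θ ∂μ with hc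
  have hcm : ∀ s σ k, Measurable (c s σ k) := fun s σ k => by
    refine measurable_pi_lambda _ fun θ => ?_
    by_cases hk : k ∈ s <;> simp only [hc, hk, if_true, if_false] <;> fun_prop
  have hci : ∀ s σ k θ, Integrable (fun ω => c s σ k (W k ω) θ) μ := fun s σ k θ => by
    by_cases hk : k ∈ s <;> simp only [hc, hk, if_true, if_false]
    · exact ((hi k θ).const_mul _).const_mul _
    · exact (hi k θ).sub (integrable_const _)
  have key : ∀ s : Finset κ, ∫ ω, ⨆ θ, ∑ k, (W k ω θ - ∫ ω', W k ω' θ ∂μ) ∂μ ≤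
      signMean fun σ => ∫ ω, ⨆ θ, ∑ k, c s σ k (W k ω) θ ∂μ := by
    intro s
    induction s using Finset.induction_on with
    | empty => simp [hc, signMean_const]
    | insert i s his ih =>
      refine ih.trans (signMean_le_of_flip i fun σ => ?_)
      set R : Ω → T → ℝ := ∑ k ∈ Finset.univ.erase i, (fun ω => c s σ k (W k ω)) with hRdef
      have hR : Measurable R := by
        convert! Finset.measurable_sum (Finset.univ.erase i) fun k _ => (hcm s σ k).comp (hW k)
          using 1
        ext
        simp [hRdef]
      have hRi : ∀ θ, Integrable (fun ω => R ω θ) μ := fun θ => by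
        simp only [hRdef, Finset.sum_apply]
        exact integrable_finsetSum _ fun k _ => hci s σ k θ
      have hind : IndepFun R (W i) μ := by
        have h1 := h.comp (fun k => if k = i then id else c s σ k) fun k => by
          by_cases hk : k = i <;> simp only [hk, if_true, if_false]
          · exact measurable_id
          · exact hcm s σ k
        have h2 := h1.indepFun_finsetSum_of_notMem (s := Finset.univ.erase i) (i := i)
          (fun k => by
            by_cases hk : k = i <;> simp only [hk, if_true, if_false]
            · exact hW i
            · exact (hcm s σ k).comp (hW k)) (by simp)
        simp only [if_true, Function.id_comp] at h2
        convert h2 using 1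
        refine Finset.sum_congr rfl fun k hk => ?_
        rw [if_neg (Finset.ne_of_mem_erase hk)]
        rfl
      have e1 : ∀ τ : κ → Bool, (∀ j, j ≠ i → τ j = σ j) → ∀ ω θ,
          ∑ k, c s τ k (W k ω) θ = R ω θ + (W i ω θ - ∫ ω', W i ω' θ ∂μ) := fun τ hτ ω θ => by
        rw [← Finset.sum_erase_add _ _ (Finset.mem_univ i), hRdef, Finset.sum_apply,
          Finset.sum_apply]
        congr 1
        · refine Finset.sum_congr rfl fun k hk => ?_
          simp only [hc, hτ k (Finset.ne_of_mem_erase hk)]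
        · simp [hc, his]
      have e2 : ∀ τ : κ → Bool, (∀ j, j ≠ i → τ j = σ j) → ∀ ω θ,
          ∑ k, c (insert i s) τ k (W k ω) θ = R ω θ + 2 * (boolSign (τ i) * W i ω θ) :=
        fun τ hτ ω θ => by
        rw [← Finset.sum_erase_add _ _ (Finset.mem_univ i), hRdef, Finset.sum_apply,
          Finset.sum_apply]
        congr 1
        · refine Finset.sum_congr rfl fun k hk => ?_
          have hki := Finset.ne_of_mem_erase hk
          simp only [hc, hτ k hki, Finset.mem_insert, hki, false_or]
        · simp [hc]
      have hf : ∀ j, j ≠ i → flipSign i σ j = σ j := fun j hj => flipSign_of_ne hj σ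
      simp only [e1 σ (fun _ _ => rfl), e2 σ (fun _ _ => rfl), e1 _ hf, e2 _ hf, flipSign_self]
      have := two_mul_integral_ciSup_le hind hR (hW i) hRi (hi i)
      rw [two_mul] at this
      cases σ i
      · simp only [boolSign, Bool.not_false, if_true, Bool.false_eq_true, if_false, neg_mul,
          one_mul, mul_neg, ← sub_eq_add_neg]
        linarith
      · simp only [boolSign, Bool.not_true, if_true, Bool.false_eq_true, if_false, neg_mul,
          one_mul, mul_neg, ← sub_eq_add_neg]
        linarith
  simpa [hc] using key Finset.univ

lemma integral_exp_hoeffding {X : Ω → ℝ} (hX : Measurable X) {a b : ℝ}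
    (h : ∀ ω, X ω ∈ Set.Icc a b) (t : ℝ) :
    ∫ ω, Real.exp (t * (X ω - ∫ ω', X ω' ∂μ)) ∂μ ≤ Real.exp ((b - a) ^ 2 * t ^ 2 / 8) := by
  have := (hasSubgaussianMGF_of_mem_Icc (μ := μ) hX.aemeasurable
    (Filter.Eventually.of_forall h)).mgf_le t
  refine this.trans (le_of_eq ?_)
  congr 1
  simp only [NNReal.coe_pow, NNReal.coe_div, coe_nnnorm, Real.norm_eq_abs, NNReal.coe_ofNat,
    div_pow, sq_abs]
  ring

/-- The bounded differences bound for the Laplace transform of the maximum of a sum of independent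
random vectors with coordinates in `[0, 1]`. -/
theorem integral_exp_ciSup_sum_le {W : κ → Ω → T → ℝ} (h : iIndepFun W μ)
    (hW : ∀ k, Measurable (W k)) (h0 : ∀ k ω θ, 0 ≤ W k ω θ) (h1 : ∀ k ω θ, W k ω θ ≤ 1)
    (t : ℝ) (s : Finset κ) (a : T → ℝ) :
    ∫ ω, Real.exp (t * ((⨆ θ, (a θ + ∑ k ∈ s, W k ω θ)) -
      ∫ ω', ⨆ θ, (a θ + ∑ k ∈ s, W k ω' θ) ∂μ)) ∂μ ≤ Real.exp (s.card * t ^ 2 / 8) := by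
  have hWm : ∀ k θ, Measurable fun ω => W k ω θ := fun k θ => (measurable_pi_apply θ).comp (hW k)
  induction s using Finset.induction_on generalizing a with
  | empty => simp
  | insert i s his ih =>
    -- The offset `a` is arbitrary in the induction so that, with the value of `W i` frozen, it can
    -- be absorbed into `a`; the induction hypothesis then controls the remaining sum `V`.
    set V : Ω → T → ℝ := ∑ k ∈ s, W k with hV
    have hVm : Measurable V := by
      convert! Finset.measurable_sum s fun k _ => hW k using 1
      ext
      simp [hV]
    have hVmθ : ∀ θ, Measurable fun ω => V ω θ := fun θ => (measurable_pi_apply θ).comp hVm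
    have hVa : ∀ ω θ, V ω θ = ∑ k ∈ s, W k ω θ := fun ω θ => by simp [hV]
    have hVb : ∀ ω θ, |V ω θ| ≤ s.card := fun ω θ => by
      rw [hVa]
      refine (Finset.abs_sum_le_sum_abs _ _).trans ?_
      refine (Finset.sum_le_card_nsmul _ _ 1 fun k _ => ?_).trans (by simp)
      rw [abs_of_nonneg (h0 k ω θ)]
      exact h1 k ω θ
    have hWb : ∀ ω θ, |W i ω θ| ≤ 1 := fun ω θ => by
      rw [abs_of_nonneg (h0 i ω θ)]
      exact h1 i ω θ
    have hind : IndepFun (W i) V μ := (h.indepFun_finsetSum_of_notMem hW his).symm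
    set F : Ω → Ω → ℝ := fun ω ω' => ⨆ θ, (a θ + W i ω θ + V ω' θ) with hF
    obtain ⟨C, hC⟩ : ∃ C, ∀ ω ω', |F ω ω'| ≤ C := by
      refine ⟨(∑ θ, |a θ|) + 1 + s.card, fun ω ω' => abs_ciSup_le fun θ => ?_⟩
      refine (abs_add_le _ _).trans (add_le_add ((abs_add_le _ _).trans
        (add_le_add ?_ (hWb ω θ))) (hVb ω' θ))
      exact Finset.single_le_sum (f := fun θ => |a θ|) (fun _ _ => abs_nonneg _)
        (Finset.mem_univ θ)
    have hFm : Measurable fun p : Ω × Ω => F p.1 p.2 := Measurable.iSup fun θ => by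
      have := hWm i θ
      have := hVmθ θ
      fun_prop
    have hFi : Integrable (fun p : Ω × Ω => F p.1 p.2) (μ.prod μ) :=
      Integrable.of_bound hFm.aestronglyMeasurable C
        (Filter.Eventually.of_forall fun p => hC _ _)
    have hFω : ∀ ω, Integrable (F ω) μ := fun ω =>
      Integrable.of_bound (hFm.comp measurable_prodMk_left).aestronglyMeasurable C
        (Filter.Eventually.of_forall fun p => hC _ _)
    -- The conditional mean given `W i`. It ranges over an interval of length one, so Hoeffding's
    -- lemma contributes the factor `exp (t ^ 2 / 8)` of this step of the martingale.
    set g : Ω → ℝ := fun ω => ∫ ω', F ω ω' ∂μ with hg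
    have hgm : Measurable g := hFm.stronglyMeasurable.integral_prod_right.measurable
    have hsum : ∀ ω, (⨆ θ, (a θ + ∑ k ∈ insert i s, W k ω θ)) = F ω ω := fun ω => by
      simp only [hF, Finset.sum_insert his, hVa, add_assoc]
    simp only [hsum]
    have hG1 : Measurable fun p : (T → ℝ) × (T → ℝ) => ⨆ θ, (a θ + p.1 θ + p.2 θ) :=
      Measurable.iSup fun θ => by fun_prop
    have e1 : ∫ ω, F ω ω ∂μ = ∫ ω, g ω ∂μ :=
      indepFun_integral_eq hind (hW i) hVm hG1 hFi
    set m := ∫ ω, g ω ∂μ with hm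
    have hexpb : ∀ ω ω', |Real.exp (t * (F ω ω' - m))| ≤ Real.exp (|t| * (C + |m|)) :=
      fun ω ω' => by
      rw [Real.abs_exp, Real.exp_le_exp]
      refine (le_abs_self _).trans ?_
      rw [abs_mul]
      gcongr
      exact (abs_sub _ _).trans (add_le_add_left (hC _ _) _)
    have hEm : Measurable fun p : Ω × Ω => Real.exp (t * (F p.1 p.2 - m)) := by fun_prop
    have hEi : Integrable (fun p : Ω × Ω => Real.exp (t * (F p.1 p.2 - m))) (μ.prod μ) :=
      Integrable.of_bound hEm.aestronglyMeasurable _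
        (Filter.Eventually.of_forall fun p => hexpb _ _)
    have hG2 : Measurable fun p : (T → ℝ) × (T → ℝ) =>
        Real.exp (t * ((⨆ θ, (a θ + p.1 θ + p.2 θ)) - m)) := by fun_prop
    have e2 : ∫ ω, Real.exp (t * (F ω ω - m)) ∂μ =
        ∫ ω, ∫ ω', Real.exp (t * (F ω ω' - m)) ∂μ ∂μ :=
      indepFun_integral_eq hind (hW i) hVm hG2 hEi
    rw [e1, e2]
    have hg01 : ∀ ω, g ω ∈ Set.Icc (∫ ω', (⨆ θ, (a θ + V ω' θ)) ∂μ)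
        ((∫ ω', (⨆ θ, (a θ + V ω' θ)) ∂μ) + 1) := fun ω => by
      have hi0 : Integrable (fun ω' => ⨆ θ, (a θ + V ω' θ)) μ :=
        integrable_ciSup (fun θ => by have := hVmθ θ; fun_prop) fun θ =>
          (integrable_const _).add (Integrable.of_bound (hVmθ θ).aestronglyMeasurable _
            (Filter.Eventually.of_forall fun ω => hVb ω θ))
      constructor
      · refine integral_mono hi0 (hFω ω) fun ω' => ?_
        refine ciSup_mono (Set.finite_range _).bddAbove fun θ => ?_
        have := h0 i ω θ
        linarith
      · have : ∫ ω', ((⨆ θ, (a θ + V ω' θ)) + 1) ∂μ = (∫ ω', (⨆ θ, (a θ + V ω' θ)) ∂μ) + 1 := by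
          rw [integral_add hi0 (integrable_const _)]
          simp
        rw [← this]
        refine integral_mono (hFω ω) (hi0.add (integrable_const _)) fun ω' => ?_
        refine ciSup_le fun θ => ?_
        have h2 := le_ciSup (f := fun θ => a θ + V ω' θ) (Set.finite_range _).bddAbove θ
        have := h1 i ω θ
        linarith
    have hoeff := integral_exp_hoeffding (μ := μ) hgm hg01 t
    have hin : ∀ ω, ∫ ω', Real.exp (t * (F ω ω' - m)) ∂μ ≤
        Real.exp (t * (g ω - m)) * Real.exp (s.card * t ^ 2 / 8) := fun ω => by
      have := ih (fun θ => a θ + W i ω θ)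
      simp only [← hVa] at this
      calc ∫ ω', Real.exp (t * (F ω ω' - m)) ∂μ
          = ∫ ω', Real.exp (t * (g ω - m)) * Real.exp (t * (F ω ω' - g ω)) ∂μ := by
            congr 1
            ext ω'
            rw [← Real.exp_add]
            ring_nf
        _ = Real.exp (t * (g ω - m)) * ∫ ω', Real.exp (t * (F ω ω' - g ω)) ∂μ :=
            integral_const_mul _ _
        _ ≤ _ := by gcongr
    have hgi : Integrable (fun ω => Real.exp (t * (g ω - m))) μ := by
      refine Integrable.of_bound (C := Real.exp (|t| * (C + |m|))) (by fun_prop)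
        (Filter.Eventually.of_forall fun ω => ?_)
      rw [Real.norm_eq_abs, Real.abs_exp, Real.exp_le_exp]
      refine (le_abs_self _).trans ?_
      rw [abs_mul]
      gcongr
      refine (abs_sub _ _).trans ?_
      gcongr
      have := norm_integral_le_of_norm_le_const (μ := μ) (f := F ω)
        (Filter.Eventually.of_forall fun ω' => hC ω ω')
      simpa using this
    calc ∫ ω, ∫ ω', Real.exp (t * (F ω ω' - m)) ∂μ ∂μ
        ≤ ∫ ω, Real.exp (t * (g ω - m)) * Real.exp (s.card * t ^ 2 / 8) ∂μ :=
          integral_mono hEi.integral_prod_left (hgi.mul_const _) hin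
      _ = (∫ ω, Real.exp (t * (g ω - m)) ∂μ) * Real.exp (s.card * t ^ 2 / 8) :=
          integral_mul_const _ _
      _ ≤ Real.exp (t ^ 2 / 8) * Real.exp (s.card * t ^ 2 / 8) := by
          gcongr
          refine hoeff.trans (le_of_eq ?_)
          ring_nf
      _ = _ := by
          rw [← Real.exp_add, Finset.card_insert_of_notMem his]
          push_cast
          ring_nf

end Independence

/-! ### A Taylor-type inequality for powers between one and two. -/

section SignedPower

lemma abs_rpow_sub_mul_self_of_pos {t : ℝ} (ht : 0 < t) (p : ℝ) :
    |t| ^ (p - 2) * t = t ^ (p - 1) := by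
  rw [abs_of_pos ht]
  nth_rewrite 2 [← Real.rpow_one t]
  rw [← Real.rpow_add ht]
  ring_nf

lemma abs_rpow_sub_mul_self_of_nonneg {t p : ℝ} (ht : 0 ≤ t) (hp : 1 < p) :
    |t| ^ (p - 2) * t = t ^ (p - 1) := by
  rcases ht.eq_or_lt with rfl | ht
  · rw [mul_zero, Real.zero_rpow (by linarith)]
  · exact abs_rpow_sub_mul_self_of_pos ht p

lemma abs_rpow_sub_mul_self_of_nonpos {t p : ℝ} (ht : t ≤ 0) (hp : 1 < p) :
    |t| ^ (p - 2) * t = -(-t) ^ (p - 1) := by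
  rw [← abs_rpow_sub_mul_self_of_nonneg (neg_nonneg.2 ht) hp, abs_neg]
  ring

/-- Concavity of `t ↦ t ^ r` at the midpoint of `a` and `b`. -/
lemma rpow_add_rpow_le {a b r : ℝ} (ha : 0 ≤ a) (hb : 0 ≤ b) (hr : 0 ≤ r) (hr1 : r ≤ 1) :
    a ^ r + b ^ r ≤ 2 ^ (1 - r) * (a + b) ^ r := by
  have h := (Real.concaveOn_rpow hr hr1).2 (Set.mem_Ici.2 ha) (Set.mem_Ici.2 hb)
    (by norm_num : (0 : ℝ) ≤ 1 / 2) (by norm_num : (0 : ℝ) ≤ 1 / 2) (by norm_num)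
  simp only [smul_eq_mul] at h
  rw [← mul_add, ← mul_add, Real.mul_rpow (by norm_num) (by positivity)] at h
  have h2 : (2 : ℝ) ^ (1 - r) = 2 * (1 / 2) ^ r := by
    rw [Real.rpow_sub two_pos, Real.rpow_one, one_div, Real.inv_rpow two_pos.le]
    rfl
  rw [h2]
  linarith

/-- The signed power of exponent `p - 1` is Hölder continuous with constant `2 ^ (2 - p)`. -/
lemma signed_rpow_sub_le {p : ℝ} (hp : 1 < p) (hp2 : p ≤ 2) (x : ℝ) {y : ℝ} (hy : 0 ≤ y) :
    |x + y| ^ (p - 2) * (x + y) - |x| ^ (p - 2) * x ≤ 2 ^ (2 - p) * (|y| ^ (p - 2) * y) := by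
  have h1 : (1 : ℝ) ≤ 2 ^ (2 - p) := Real.one_le_rpow (by norm_num) (by linarith)
  have h2 : y ^ (p - 1) ≤ 2 ^ (2 - p) * y ^ (p - 1) :=
    le_mul_of_one_le_left (Real.rpow_nonneg hy _) h1
  have hr : 0 ≤ p - 1 := by linarith
  have hr1 : p - 1 ≤ 1 := by linarith
  rw [abs_rpow_sub_mul_self_of_nonneg hy hp]
  rcases le_total 0 x with hx | hx
  · rw [abs_rpow_sub_mul_self_of_nonneg hx hp, abs_rpow_sub_mul_self_of_nonneg (by linarith) hp]
    have := Real.rpow_add_le_add_rpow hx hy hr hr1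
    linarith
  · rw [abs_rpow_sub_mul_self_of_nonpos hx hp]
    -- Only when `x` and `x + y` have opposite signs is the constant needed: then `y` splits into
    -- the two lengths `x + y` and `-x`. Otherwise subadditivity of the power suffices.
    rcases le_total 0 (x + y) with hxy | hxy
    · rw [abs_rpow_sub_mul_self_of_nonneg hxy hp]
      have := rpow_add_rpow_le hxy (neg_nonneg.2 hx) hr hr1
      rw [show x + y + -x = y by ring, show 1 - (p - 1) = 2 - p by ring] at this
      linarith
    · rw [abs_rpow_sub_mul_self_of_nonpos hxy hp]
      have := Real.rpow_add_le_add_rpow (neg_nonneg.2 hxy) hy hr hr1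
      rw [show -(x + y) + y = -x by ring] at this
      linarith

/-- The difference `F` of the two sides vanishes at `y = 0`, and its derivative is nonnegative for
`y > 0` by the Hölder bound for the signed power. -/
lemma abs_add_rpow_le_of_nonneg {p : ℝ} (hp : 1 < p) (hp2 : p ≤ 2) (x : ℝ) {y : ℝ} (hy : 0 ≤ y) :
    |x + y| ^ p ≤ |x| ^ p + p * (|x| ^ (p - 2) * x) * y + 2 ^ (2 - p) * |y| ^ p := by
  set F : ℝ → ℝ := fun y =>
    |x| ^ p + p * (|x| ^ (p - 2) * x) * y + 2 ^ (2 - p) * |y| ^ p - |x + y| ^ p with hF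
  have hd : ∀ y, HasDerivAt F (p * (|x| ^ (p - 2) * x) * 1 + 2 ^ (2 - p) * (p * |y| ^ (p - 2) * y)
      - p * |x + y| ^ (p - 2) * (x + y)) y := fun y => by
    have h1 := (hasDerivAt_id y).const_mul (p * (|x| ^ (p - 2) * x))
    have h2 := (hasDerivAt_abs_rpow y hp).const_mul ((2 : ℝ) ^ (2 - p))
    have h3 := (hasDerivAt_abs_rpow (x + y) hp).comp_const_add x y
    exact ((h1.const_add (|x| ^ p)).add h2).sub h3
  have hm : MonotoneOn F (Set.Ici 0) := by
    refine monotoneOn_of_deriv_nonneg (convex_Ici 0)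
      (fun z _ => (hd z).continuousAt.continuousWithinAt)
      (fun z _ => (hd z).differentiableAt.differentiableWithinAt) fun z hz => ?_
    rw [interior_Ici] at hz
    rw [(hd z).deriv]
    have := mul_le_mul_of_nonneg_left (signed_rpow_sub_le hp hp2 x (Set.mem_Ioi.1 hz).le)
      (by linarith : 0 ≤ p)
    linarith
  have h0 := hm (Set.mem_Ici.2 le_rfl) (Set.mem_Ici.2 hy) hy
  have hF0 : F 0 = 0 := by simp [hF, Real.zero_rpow (by linarith : p ≠ 0)]
  rw [hF0] at h0
  linarith

/-- A second order expansion of `|x + y| ^ p` for `1 < p ≤ 2`. -/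
lemma abs_add_rpow_le {p : ℝ} (hp : 1 < p) (hp2 : p ≤ 2) (x y : ℝ) :
    |x + y| ^ p ≤ |x| ^ p + p * (|x| ^ (p - 2) * x) * y + 2 ^ (2 - p) * |y| ^ p := by
  rcases le_total 0 y with hy | hy
  · exact abs_add_rpow_le_of_nonneg hp hp2 x hy
  · have := abs_add_rpow_le_of_nonneg hp hp2 (-x) (neg_nonneg.2 hy)
    rw [abs_neg, abs_neg, show -x + -y = -(x + y) by ring, abs_neg] at this
    linarith

end SignedPower

/-! ### The von Bahr–Esseen inequality. -/

section VonBahrEsseen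

variable {Ω : Type*} [MeasurableSpace Ω] {μ : Measure Ω}

lemma integrable_abs_rpow {X : Ω → ℝ} {p : ℝ} (hp : 1 < p) (hX : MemLp X (ENNReal.ofReal p) μ) :
    Integrable (fun ω => |X ω| ^ p) μ := by
  have := hX.integrable_norm_rpow (by simp; linarith) (by simp)
  rwa [ENNReal.toReal_ofReal (by linarith)] at this

lemma memLp_of_integrable_abs_rpow {X : Ω → ℝ} {p : ℝ} (hp : 1 < p)
    (hm : AEStronglyMeasurable X μ) (hX : Integrable (fun ω => |X ω| ^ p) μ) :
    MemLp X (ENNReal.ofReal p) μ := by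
  rw [← integrable_norm_rpow_iff hm (by simp; linarith) (by simp),
    ENNReal.toReal_ofReal (by linarith)]
  exact hX

variable [IsProbabilityMeasure μ]

lemma integrable_of_memLp {X : Ω → ℝ} {p : ℝ} (hp : 1 < p)
    (hX : MemLp X (ENNReal.ofReal p) μ) : Integrable X μ :=
  MemLp.integrable (by simpa using hp.le) hX

/-- The von Bahr–Esseen inequality with constant `2 ^ (2 - p)`. -/
theorem integral_abs_sum_rpow_le {κ : Type*} [DecidableEq κ] {X : κ → Ω → ℝ} (h : iIndepFun X μ) (hm : ∀ k, Measurable (X k))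
    {p : ℝ} (hp : 1 < p) (hp2 : p ≤ 2) (hX : ∀ k, MemLp (X k) (ENNReal.ofReal p) μ)
    (h0 : ∀ k, ∫ ω, X k ω ∂μ = 0) (s : Finset κ) :
    ∫ ω, |∑ k ∈ s, X k ω| ^ p ∂μ ≤ 2 ^ (2 - p) * ∑ k ∈ s, ∫ ω, |X k ω| ^ p ∂μ := by
  induction s using Finset.induction_on with
  | empty => simp [Real.zero_rpow (by linarith : p ≠ 0)]
  | insert i s his ih =>
    set V : Ω → ℝ := fun ω => ∑ k ∈ s, X k ω with hV
    have hVm : Measurable V := Finset.measurable_sum _ fun k _ => hm k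
    have hVp : MemLp V (ENNReal.ofReal p) μ := memLp_finsetSum _ fun k _ => hX k
    have hind : IndepFun V (X i) μ := by
      convert h.indepFun_finsetSum_of_notMem hm his using 1
      ext ω
      simp [hV]
    -- The derivative of `|t| ^ p`. The first-order term `ψ(V) X i` of the expansion has mean zero
    -- because `X i` is centered and independent of `V`.
    set ψ : ℝ → ℝ := fun t => p * (|t| ^ (p - 2) * t) with hψ
    have hψm : Measurable ψ := by fun_prop
    have hψb : ∀ t, |ψ t| ≤ p * (1 + |t| ^ p) := fun t => by
      rw [hψ, abs_mul, abs_of_pos (by linarith : 0 < p)]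
      gcongr
      rw [abs_mul, abs_of_nonneg (Real.rpow_nonneg (abs_nonneg t) _)]
      have h1 := abs_rpow_sub_mul_self_of_nonneg (abs_nonneg t) hp
      rw [abs_abs] at h1
      rw [h1]
      rcases le_total |t| 1 with ht | ht
      · have := Real.rpow_le_one (abs_nonneg t) ht (by linarith : 0 ≤ p - 1)
        have := Real.rpow_nonneg (abs_nonneg t) p
        linarith
      · have := Real.rpow_le_rpow_of_exponent_le ht (by linarith : p - 1 ≤ p)
        linarith
    have hψi : Integrable (fun ω => ψ (V ω)) μ :=
      (((integrable_const 1).add (integrable_abs_rpow hp hVp)).const_mul p).mono'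
        (hψm.comp hVm).aestronglyMeasurable (Filter.Eventually.of_forall fun ω => hψb _)
    have hXi := integrable_of_memLp hp (hX i)
    have hind2 : IndepFun (fun ω => ψ (V ω)) (X i) μ := hind.comp hψm measurable_id
    have hprod : Integrable (fun ω => ψ (V ω) * X i ω) μ := hind2.integrable_mul hψi hXi
    have hprod0 : ∫ ω, ψ (V ω) * X i ω ∂μ = 0 := by
      have := hind2.integral_mul_eq_mul_integral hψi.aestronglyMeasurable hXi.aestronglyMeasurable
      rw [h0 i, mul_zero] at this
      exact this
    have hVpi := integrable_abs_rpow hp hVp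
    have hXpi := integrable_abs_rpow hp (hX i)
    calc ∫ ω, |∑ k ∈ insert i s, X k ω| ^ p ∂μ
        ≤ ∫ ω, (|V ω| ^ p + ψ (V ω) * X i ω + 2 ^ (2 - p) * |X i ω| ^ p) ∂μ := by
          refine integral_mono_of_nonneg (Filter.Eventually.of_forall fun ω => by positivity)
            ((hVpi.add hprod).add (hXpi.const_mul _)) (Filter.Eventually.of_forall fun ω => ?_)
          dsimp only
          rw [Finset.sum_insert his, add_comm]
          exact abs_add_rpow_le hp hp2 _ _
      _ = ∫ ω, |V ω| ^ p ∂μ + 2 ^ (2 - p) * ∫ ω, |X i ω| ^ p ∂μ := by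
          have e1 := integral_add (hVpi.add hprod) (hXpi.const_mul (2 ^ (2 - p)))
          simp only [Pi.add_apply] at e1
          rw [e1, integral_add hVpi hprod, hprod0, integral_const_mul, add_zero]
      _ ≤ _ := by
          rw [Finset.sum_insert his, mul_add]
          linarith

end VonBahrEsseen

/-! ### Independence of functions of disjoint blocks. -/

section Blocks

variable {Ω : Type*} [MeasurableSpace Ω] {μ : Measure Ω} [IsProbabilityMeasure μ]
  {ι κ S E : Type*} [DecidableEq ι] [DecidableEq κ] [MeasurableSpace S] [MeasurableSpace E]

/-- Functions of disjoint blocks of independent random variables are independent. -/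
theorem iIndepFun_blocks {ξ : ι → Ω → S} (h : iIndepFun ξ μ) (hm : ∀ i, Measurable (ξ i))
    {blk : κ → Finset ι} (hd : ∀ k l, k ≠ l → Disjoint (blk k) (blk l))
    {F : ∀ k, (blk k → S) → E} (hF : ∀ k, Measurable (F k)) :
    iIndepFun (fun k ω => F k fun i => ξ i ω) μ := by
  rw [iIndepFun_iff_measure_inter_preimage_eq_mul]
  intro s A hA
  induction s using Finset.induction_on with
  | empty => simp
  | insert k s hks ih =>
    have hA' : ∀ i ∈ s, MeasurableSet (A i) := fun i hi => hA i (Finset.mem_insert_of_mem hi)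
    rw [Finset.prod_insert hks, ← ih hA', Finset.set_biInter_insert]
    have hdis : Disjoint (blk k) (s.biUnion blk) := by
      rw [Finset.disjoint_biUnion_right]
      exact fun l hl => hd k l (fun h => hks (h ▸ hl))
    have hind := h.indepFun_finset (blk k) (s.biUnion blk) hdis hm
    set B : Set (s.biUnion blk → S) := ⋂ l : s,
      {x | F l (fun i => x ⟨i, Finset.mem_biUnion.2 ⟨l, l.2, i.2⟩⟩) ∈ A l} with hB
    have hBm : MeasurableSet B := by
      refine MeasurableSet.iInter fun l => ?_
      refine ((hF l).comp (measurable_pi_lambda _ fun i => measurable_pi_apply _)) (hA' l l.2)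
    have e : (⋂ l ∈ s, (fun ω => F l fun i => ξ i ω) ⁻¹' A l) =
        (fun ω (i : s.biUnion blk) => ξ i ω) ⁻¹' B := by
      ext ω
      simp [hB]
    have := hind.measure_inter_preimage_eq_mul (F k ⁻¹' A k) B
      (hF k (hA k (Finset.mem_insert_self _ _))) hBm
    rw [e]
    exact this

end Blocks

/-! ### A Lipschitz substitute for the indicator of a bad block. -/

section Ramp

/-- The ramp that vanishes for `|u| ≤ 1 / 4` and equals `1` for `1 ≤ |u|`. -/
noncomputable def ramp (u : ℝ) : ℝ := max 0 (min 1 ((4 * |u| - 1) / 3))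

lemma ramp_nonneg (u : ℝ) : 0 ≤ ramp u := le_max_left _ _

lemma ramp_le_one (u : ℝ) : ramp u ≤ 1 := max_le zero_le_one (min_le_left _ _)

lemma ramp_continuous : Continuous ramp := by unfold ramp; fun_prop

lemma abs_ramp_sub_le (u v : ℝ) : |ramp u - ramp v| ≤ |4 / 3 * u - 4 / 3 * v| := by
  have h1 : |ramp u - ramp v| ≤ |(4 * |u| - 1) / 3 - (4 * |v| - 1) / 3| := by
    unfold ramp
    refine (abs_max_sub_max_le_max _ _ _ _).trans (max_le (by simp) ?_)
    exact (abs_min_sub_min_le_max _ _ _ _).trans (max_le (by simp) le_rfl)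
  refine h1.trans ?_
  rw [← mul_sub, abs_mul, show (4 * |u| - 1) / 3 - (4 * |v| - 1) / 3 = 4 / 3 * (|u| - |v|) by ring,
    abs_mul]
  exact mul_le_mul_of_nonneg_left (abs_abs_sub_abs_le u v) (abs_nonneg _)

/-- For `|u| ≤ 1`, `4|u| - 1 ≤ 4|u| ^ 2` is the square `(2|u| - 1) ^ 2 ≥ 0`, and `|u| ^ 2 ≤ |u| ^
p`. Starting the ramp at `1 / 4` makes the parabola tangent to it, hence the constant `4 / 3`. -/
lemma ramp_le_rpow {p : ℝ} (hp0 : 0 ≤ p) (hp2 : p ≤ 2) (u : ℝ) : ramp u ≤ 4 / 3 * |u| ^ p := by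
  refine max_le (by positivity) ?_
  rcases le_total 1 |u| with hu | hu
  · have := Real.one_le_rpow hu hp0
    exact (min_le_left _ _).trans (by linarith)
  · refine (min_le_right _ _).trans ?_
    have h1 : |u| ^ (2 : ℝ) ≤ |u| ^ p := by
      rcases (abs_nonneg u).eq_or_lt with h | h
      · rw [← h, Real.zero_rpow two_ne_zero]
        exact Real.rpow_nonneg le_rfl _
      · exact Real.rpow_le_rpow_of_exponent_ge h hu hp2
    rw [Real.rpow_two] at h1
    nlinarith [sq_nonneg (2 * |u| - 1)]

lemma le_ramp {η u : ℝ} (hη : η ≤ 1) (hu : η ≤ |u|) : (4 * η - 1) / 3 ≤ ramp u :=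
  (le_min (by linarith) (by linarith)).trans (le_max_right _ _)

end Ramp

/-! ### Bad blocks, uniformly over a finite class. -/

section Core

variable {Ω : Type*} [MeasurableSpace Ω] {μ : Measure Ω}
  {S : Type*} [MeasurableSpace S] {P : Measure S} {ι κ T : Type*}
  {ξ : ι → Ω → S} {f : T → S → ℝ} {blk : κ → Finset ι}

/-- The deviation of the mean of `f θ` over the `k`-th block from its expectation. -/
noncomputable def blockDev (P : Measure S) (f : T → S → ℝ) (blk : κ → Finset ι) (z : ι → S)
    (k : κ) (θ : T) : ℝ :=
  (∑ i ∈ blk k, f θ (z i)) / (blk k).card - ∫ s, f θ s ∂P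

lemma measurable_blockDev (hf : ∀ θ, Measurable (f θ)) (k : κ) (θ : T) :
    Measurable fun z : ι → S => blockDev P f blk z k θ := by
  have := hf θ
  unfold blockDev
  fun_prop

lemma measurePreserving_of_map_eq (hm : ∀ i, Measurable (ξ i)) (hP : ∀ i, μ.map (ξ i) = P) (i : ι) :
    MeasurePreserving (ξ i) μ P := ⟨hm i, hP i⟩

lemma integral_comp_of_map_eq (hm : ∀ i, Measurable (ξ i)) (hP : ∀ i, μ.map (ξ i) = P) (i : ι)
    {g : S → ℝ} (hg : Measurable g) : ∫ ω, g (ξ i ω) ∂μ = ∫ s, g s ∂P := by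
  rw [← hP i, integral_map (hm i).aemeasurable hg.aestronglyMeasurable]

variable [IsProbabilityMeasure μ] [DecidableEq ι]

/-- The von Bahr–Esseen inequality bounds the sum of `N` centered terms by `2^(2-p) N M`; division
by `N ^ p` leaves `N ^ (1-p)`, which is at most `w ^ (p-1)`. Here `1 / w` is a common lower bound on
the block sizes. -/
lemma integral_abs_blockDev_rpow_le [IsProbabilityMeasure P] (h : iIndepFun ξ μ) (hm : ∀ i, Measurable (ξ i))
    (hP : ∀ i, μ.map (ξ i) = P) (hf : ∀ θ, Measurable (f θ)) {p : ℝ} (hp : 1 < p) (hp2 : p ≤ 2)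
    (hfp : ∀ θ, MemLp (f θ) (ENNReal.ofReal p) P) {w : ℝ} (hw : ∀ k, 1 ≤ w * (blk k).card)
    {M : ℝ} {θ : T} (hM : ∫ s, |f θ s - ∫ s', f θ s' ∂P| ^ p ∂P ≤ M) (k : κ) :
    ∫ ω, |blockDev P f blk (fun i => ξ i ω) k θ| ^ p ∂μ ≤ 2 ^ (2 - p) * w ^ (p - 1) * M := by
  set m := ∫ s, f θ s ∂P with hmdef
  have hN : (0 : ℝ) < (blk k).card := by
    rcases Nat.eq_zero_or_pos (blk k).card with h0 | h0
    · have := hw k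
      rw [h0] at this
      norm_num at this
    · exact_mod_cast h0
  set N : ℝ := ((blk k).card : ℝ) with hNdef
  have hfm := hf θ
  have hgm : Measurable fun s => f θ s - m := by fun_prop
  have hgp : MemLp (fun s => f θ s - m) (ENNReal.ofReal p) P := (hfp θ).sub (memLp_const m)
  have h1 := integral_abs_sum_rpow_le (X := fun i ω => f θ (ξ i ω) - m)
    (h.comp (fun _ s => f θ s - m) fun _ => hgm) (fun i => hgm.comp (hm i)) hp hp2
    (fun i => hgp.comp_measurePreserving (measurePreserving_of_map_eq hm hP i))
    (fun i => by
      rw [integral_comp_of_map_eq hm hP i hgm,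
        integral_sub (integrable_of_memLp hp (hfp θ)) (integrable_const _)]
      simp [hmdef]) (blk k)
  have h2 : ∀ i, ∫ ω, |f θ (ξ i ω) - m| ^ p ∂μ ≤ M := fun i => by
    rw [integral_comp_of_map_eq hm hP i (g := fun s => |f θ s - m| ^ p) (by fun_prop)]
    exact hM
  have hM0 : 0 ≤ M := (integral_nonneg fun s => by positivity).trans hM
  have h3 : ∫ ω, |∑ i ∈ blk k, (f θ (ξ i ω) - m)| ^ p ∂μ ≤ 2 ^ (2 - p) * (N * M) := by
    refine h1.trans ?_
    gcongr
    refine (Finset.sum_le_sum fun i _ => h2 i).trans ?_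
    simp [hNdef]
  have h4 : ∀ ω, |blockDev P f blk (fun i => ξ i ω) k θ| ^ p =
      |∑ i ∈ blk k, (f θ (ξ i ω) - m)| ^ p / N ^ p := fun ω => by
    rw [← Real.div_rpow (abs_nonneg _) hN.le]
    congr 1
    rw [← abs_of_pos hN, ← abs_div]
    congr 1
    rw [Finset.sum_sub_distrib, blockDev, Finset.sum_const, nsmul_eq_mul, sub_div,
      mul_div_cancel_left₀ _ hN.ne']
  simp only [h4]
  rw [integral_div, div_le_iff₀ (by positivity)]
  refine h3.trans ?_
  have h5 : 1 ≤ w ^ (p - 1) * N ^ (p - 1) := by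
    have hw0 : 0 ≤ w := by
      by_contra! hc
      have := hw k
      nlinarith
    rw [← Real.mul_rpow hw0 hN.le]
    exact Real.one_le_rpow (hw k) (by linarith)
  have h6 : N ^ p = N ^ (p - 1) * N := by
    rw [← Real.rpow_add_one hN.ne']
    ring_nf
  rw [h6]
  calc (2 : ℝ) ^ (2 - p) * (N * M) = 1 * (2 ^ (2 - p) * (N * M)) := (one_mul _).symm
    _ ≤ (w ^ (p - 1) * N ^ (p - 1)) * (2 ^ (2 - p) * (N * M)) := by gcongr
    _ = _ := by ring

variable [Fintype ι] [Fintype κ] [Fintype T] [Nonempty T]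

/-- For fixed block signs, the signed sum of block deviations is a centered sum over samples.
Symmetrizing again at the level of samples replaces the block signs by sample signs and brings in
the Rademacher complexity. -/
lemma integral_ciSup_signed_blockDev_le (h : iIndepFun ξ μ) (hm : ∀ i, Measurable (ξ i))
    (hP : ∀ i, μ.map (ξ i) = P) (hf : ∀ θ, Measurable (f θ)) (hfi : ∀ θ, Integrable (f θ) P)
    (hd : ∀ k l, k ≠ l → Disjoint (blk k) (blk l)) {w : ℝ} (hw : ∀ k, 1 ≤ w * (blk k).card)
    (hw0 : 0 ≤ w) {b : ℝ} (hb : 0 ≤ b) (σ : κ → Bool) :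
    ∫ ω, ⨆ θ, ∑ k, boolSign (σ k) * (b * blockDev P f blk (fun i => ξ i ω) k θ) ∂μ ≤
      2 * b * w *
        ∫ ω, signMean (fun τ => ⨆ θ, ∑ i, boolSign (τ i) * f θ (ξ i ω)) ∂μ := by
  have hfξ : ∀ i θ, Integrable (fun ω => f θ (ξ i ω)) μ := fun i θ =>
    (measurePreserving_of_map_eq hm hP i).integrable_comp_of_integrable (hfi θ)
  -- The coefficient of the `i`-th sample. The blocks are disjoint, so at most one term survives,
  -- and `|c i| ≤ b w`. Contraction thus allows every `c i` to be replaced by `b w`.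
  set c : ι → ℝ := fun i => ∑ k, if i ∈ blk k then boolSign (σ k) * (b / (blk k).card) else 0
    with hc
  have hcard : ∀ k, (0 : ℝ) < (blk k).card := fun k => by
    rcases Nat.eq_zero_or_pos (blk k).card with h0 | h0
    · have := hw k
      rw [h0] at this
      norm_num at this
    · exact_mod_cast h0
  have hcb : ∀ i, |c i| ≤ b * w := fun i => by
    by_cases hi : ∃ k, i ∈ blk k
    · obtain ⟨k, hk⟩ := hi
      rw [hc]
      dsimp only
      rw [Finset.sum_eq_single k (fun l _ hl => if_neg fun hil =>
        (Finset.disjoint_left.1 (hd l k hl) hil hk)) (by simp), if_pos hk, abs_mul, abs_boolSign,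
        one_mul, abs_of_nonneg (by positivity), div_eq_mul_inv]
      gcongr
      rw [inv_le_iff_one_le_mul₀ (hcard k)]
      exact hw k
    · push Not at hi
      simp only [hc, hi, if_false, Finset.sum_const_zero, abs_zero]
      positivity
  have e1 : ∀ ω θ, ∑ k, boolSign (σ k) * (b * blockDev P f blk (fun i => ξ i ω) k θ) =
      ∑ i, (c i * f θ (ξ i ω) - ∫ ω', c i * f θ (ξ i ω') ∂μ) := fun ω θ => by
    have hint : ∀ i, ∫ ω', c i * f θ (ξ i ω') ∂μ = c i * ∫ s, f θ s ∂P := fun i => by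
      rw [integral_const_mul, integral_comp_of_map_eq hm hP i (hf θ)]
    simp only [hint, ← mul_sub]
    simp only [hc, Finset.sum_mul]
    rw [Finset.sum_comm]
    refine Finset.sum_congr rfl fun k _ => ?_
    simp only [ite_mul, zero_mul]
    rw [Finset.sum_ite_mem, Finset.univ_inter, ← Finset.mul_sum, Finset.sum_sub_distrib, blockDev,
      Finset.sum_const, nsmul_eq_mul]
    have := (hcard k).ne'
    field_simp
  simp only [e1]
  have hWm : ∀ i θ, Measurable fun ω => f θ (ξ i ω) := fun i θ => (hf θ).comp (hm i)
  have h1 := integral_ciSup_sum_sub_le (μ := μ) (W := fun i ω θ => c i * f θ (ξ i ω))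
    (h.comp (fun i s θ => c i * f θ s) fun i => measurable_pi_lambda _ fun θ => by
      have := hf θ
      fun_prop)
    (fun i => measurable_pi_lambda _ fun θ => by
      have := hWm i θ
      fun_prop) (fun i θ => (hfξ i θ).const_mul _)
  refine h1.trans ?_
  rw [← integral_signMean, ← integral_const_mul]
  · refine integral_mono ?_ ?_ fun ω => ?_
    · simp only [signMean]
      refine (integrable_finsetSum _ fun τ _ => ?_).div_const _
      exact integrable_ciSup
        (fun θ => Finset.measurable_sum _ fun i _ => by have := hWm i θ; fun_prop)
        fun θ => integrable_finsetSum _ fun i _ => (((hfξ i θ).const_mul _).const_mul _).const_mul _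
    · simp only [signMean]
      refine ((integrable_finsetSum _ fun τ _ => ?_).div_const _).const_mul _
      exact integrable_ciSup
        (fun θ => Finset.measurable_sum _ fun i _ => by have := hWm i θ; fun_prop)
        fun θ => integrable_finsetSum _ fun i _ => (hfξ i θ).const_mul _
    · have h2 := signMean_contraction (u := fun i θ => 2 * (c i * f θ (ξ i ω)))
        (t := fun i θ => 2 * b * w * f θ (ξ i ω))
        (fun i => ⟨∑ θ, |2 * b * w * f θ (ξ i ω)|, fun θ => Finset.single_le_sum
          (f := fun θ => |2 * b * w * f θ (ξ i ω)|) (fun _ _ => abs_nonneg _)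
          (Finset.mem_univ θ)⟩) fun i θ θ' => by
          rw [← mul_sub, ← mul_sub, ← mul_sub, ← mul_assoc, abs_mul, abs_mul _ (_ - _)]
          refine mul_le_mul_of_nonneg_right ?_ (abs_nonneg _)
          rw [abs_of_nonneg (show 0 ≤ 2 * b * w by positivity), abs_mul, abs_two, mul_assoc]
          exact mul_le_mul_of_nonneg_left (hcb i) two_pos.le
      dsimp only
      rw [← signMean_mul]
      refine Eq.trans_le ?_ (h2.trans_eq ?_)
      · simp only [mul_left_comm (2 : ℝ)]
      · congr 1
        ext τ
        rw [Real.mul_iSup_of_nonneg (by positivity)]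
        simp only [Finset.mul_sum, mul_left_comm (boolSign _)]
  · intro τ
    exact integrable_ciSup
      (fun θ => Finset.measurable_sum _ fun i _ => by have := hWm i θ; fun_prop)
      fun θ => integrable_finsetSum _ fun i _ => (((hfξ i θ).const_mul _).const_mul _).const_mul _

/-- Concentration of the number of bad blocks, uniformly over a finite class. -/
theorem measure_sum_ramp_blockDev_gt_le [IsProbabilityMeasure P] [DecidableEq κ] (h : iIndepFun ξ μ) (hm : ∀ i, Measurable (ξ i))
    (hP : ∀ i, μ.map (ξ i) = P) (hf : ∀ θ, Measurable (f θ)) {p : ℝ} (hp : 1 < p) (hp2 : p ≤ 2)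
    (hfp : ∀ θ, MemLp (f θ) (ENNReal.ofReal p) P)
    (hd : ∀ k l, k ≠ l → Disjoint (blk k) (blk l)) {w : ℝ} (hw : ∀ k, 1 ≤ w * (blk k).card)
    (hw0 : 0 ≤ w) {M : ℝ} (hM : ∀ θ, ∫ s, |f θ s - ∫ s', f θ s' ∂P| ^ p ∂P ≤ M)
    {R : ℝ} (hR : ∫ ω, signMean (fun τ => ⨆ θ, ∑ i, boolSign (τ i) * f θ (ξ i ω)) ∂μ ≤ R)
    {ε L A : ℝ} (hε : 0 < ε) (hL : (Fintype.card κ : ℝ) ≤ L)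
    (hA : 16 / 3 * w * R / ε + L * (4 / 3 * (2 ^ (2 - p) * w ^ (p - 1) * M) / ε ^ p) + L / 6 ≤ A) :
    μ.real {ω | ∃ θ, A < ∑ k, ramp (blockDev P f blk (fun i => ξ i ω) k θ / ε)} ≤
      Real.exp (-L / 18) := by
  have hfi : ∀ θ, Integrable (f θ) P := fun θ => integrable_of_memLp hp (hfp θ)
  have hξm : Measurable fun ω i => ξ i ω := measurable_pi_lambda _ hm
  have hUm : ∀ k θ, Measurable fun ω => blockDev P f blk (fun i => ξ i ω) k θ := fun k θ =>
    (measurable_blockDev hf k θ).comp hξm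
  set W : κ → Ω → T → ℝ := fun k ω θ => ramp (blockDev P f blk (fun i => ξ i ω) k θ / ε) with hW
  have hWmθ : ∀ k θ, Measurable fun ω => W k ω θ := fun k θ =>
    ramp_continuous.measurable.comp ((hUm k θ).div_const _)
  have hWm : ∀ k, Measurable (W k) := fun k => measurable_pi_lambda _ fun θ => hWmθ k θ
  have hW0 : ∀ k ω θ, 0 ≤ W k ω θ := fun k ω θ => ramp_nonneg _
  have hW1 : ∀ k ω θ, W k ω θ ≤ 1 := fun k ω θ => ramp_le_one _
  have hWi : ∀ k θ, Integrable (fun ω => W k ω θ) μ := fun k θ =>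
    Integrable.of_bound (hWmθ k θ).aestronglyMeasurable 1 (Filter.Eventually.of_forall fun ω => by
      rw [Real.norm_eq_abs, abs_of_nonneg (hW0 k ω θ)]
      exact hW1 k ω θ)
  have hind : iIndepFun W μ := by
    have := iIndepFun_blocks (μ := μ) h hm hd (E := T → ℝ)
      (F := fun k x θ => ramp (((∑ i : blk k, f θ (x i)) / (blk k).card - ∫ s, f θ s ∂P) / ε))
      fun k => measurable_pi_lambda _ fun θ => ramp_continuous.measurable.comp (by
        have := hf θ
        fun_prop)
    convert this using 5 with k ω θ
    rw [blockDev, ← Finset.sum_coe_sort]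
  set Z : Ω → ℝ := fun ω => ⨆ θ, ∑ k, W k ω θ with hZ
  have hZm : Measurable Z := Measurable.iSup fun θ => Finset.measurable_sum _ fun k _ => hWmθ k θ
  have hZi : Integrable Z μ := integrable_ciSup
    (fun θ => Finset.measurable_sum _ fun k _ => hWmθ k θ)
    fun θ => integrable_finsetSum _ fun k _ => hWi k θ
  set D := 4 / 3 * (2 ^ (2 - p) * w ^ (p - 1) * M) / ε ^ p with hD
  have hM0 : 0 ≤ M := by
    obtain ⟨θ⟩ := ‹Nonempty T›
    exact (integral_nonneg fun s => by positivity).trans (hM θ)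
  have hD0 : 0 ≤ D := by positivity
  have hmean : ∀ k θ, ∫ ω, W k ω θ ∂μ ≤ D := fun k θ => by
    have h1 : MemLp (fun ω => blockDev P f blk (fun i => ξ i ω) k θ) (ENNReal.ofReal p) μ := by
      have h2 : MemLp (fun ω => ∑ i ∈ blk k, f θ (ξ i ω)) (ENNReal.ofReal p) μ :=
        memLp_finsetSum _ fun i _ =>
          (hfp θ).comp_measurePreserving (measurePreserving_of_map_eq hm hP i)
      have h3 := (h2.mul_const ((blk k).card : ℝ)⁻¹).sub (memLp_const (∫ s, f θ s ∂P))
      exact h3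
    have h4 := integrable_abs_rpow hp h1
    calc ∫ ω, W k ω θ ∂μ
        ≤ ∫ ω, 4 / 3 / ε ^ p * |blockDev P f blk (fun i => ξ i ω) k θ| ^ p ∂μ := by
          refine integral_mono (hWi k θ) (h4.const_mul _) fun ω => ?_
          refine (ramp_le_rpow (by linarith) hp2 _).trans (le_of_eq ?_)
          rw [abs_div, abs_of_pos hε, Real.div_rpow (abs_nonneg _) hε.le]
          ring
      _ = 4 / 3 / ε ^ p * ∫ ω, |blockDev P f blk (fun i => ξ i ω) k θ| ^ p ∂μ :=
          integral_const_mul _ _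
      _ ≤ 4 / 3 / ε ^ p * (2 ^ (2 - p) * w ^ (p - 1) * M) := by
          gcongr
          exact integral_abs_blockDev_rpow_le h hm hP hf hp hp2 hfp hw (hM θ) k
      _ = D := by rw [hD]; ring
  have hcent : ∫ ω, ⨆ θ, ∑ k, (W k ω θ - ∫ ω', W k ω' θ ∂μ) ∂μ ≤ 16 / 3 * w * R / ε := by
    refine (integral_ciSup_sum_sub_le hind hWm hWi).trans ?_
    -- Factor two from symmetrization times the Lipschitz constant `4 / 3` of the ramp at scale `ε`;
    -- the symmetrization over samples doubles it again, giving `16 / 3`.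
    set b : ℝ := 8 / 3 / ε with hb
    have hb0 : 0 ≤ b := by positivity
    have hUi : ∀ k θ, Integrable (fun ω => blockDev P f blk (fun i => ξ i ω) k θ) μ := fun k θ =>
      ((integrable_finsetSum _ fun i _ =>
        (measurePreserving_of_map_eq hm hP i).integrable_comp_of_integrable (hfi θ)).div_const
          _).sub (integrable_const _)
    have h1 : signMean (fun σ : κ → Bool =>
        ∫ ω, ⨆ θ, ∑ k, 2 * (boolSign (σ k) * W k ω θ) ∂μ) ≤
        signMean fun σ : κ → Bool => ∫ ω, ⨆ θ, ∑ k,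
          boolSign (σ k) * (b * blockDev P f blk (fun i => ξ i ω) k θ) ∂μ := by
      have i1 : ∀ σ : κ → Bool, Integrable
          (fun ω => ⨆ θ, ∑ k, 2 * (boolSign (σ k) * W k ω θ)) μ := fun σ =>
        integrable_ciSup (fun θ => Finset.measurable_sum _ fun k _ => by
          have := hWmθ k θ; fun_prop)
          fun θ => integrable_finsetSum _ fun k _ => ((hWi k θ).const_mul _).const_mul _
      have i2 : ∀ σ : κ → Bool, Integrable
          (fun ω => ⨆ θ, ∑ k, boolSign (σ k) * (b * blockDev P f blk (fun i => ξ i ω) k θ)) μ :=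
        fun σ => integrable_ciSup (fun θ => Finset.measurable_sum _ fun k _ => by
          have := hUm k θ; fun_prop)
          fun θ => integrable_finsetSum _ fun k _ => ((hUi k θ).const_mul _).const_mul _
      rw [← integral_signMean i1, ← integral_signMean i2]
      refine integral_mono ?_ ?_ fun ω => ?_
      · exact (integrable_finsetSum _ fun σ _ => i1 σ).div_const _
      · exact (integrable_finsetSum _ fun σ _ => i2 σ).div_const _
      · have h2 := signMean_contraction (u := fun k θ => 2 * W k ω θ)
          (t := fun k θ => b * blockDev P f blk (fun i => ξ i ω) k θ)
          (fun k => ⟨∑ θ, |b * blockDev P f blk (fun i => ξ i ω) k θ|, fun θ =>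
            Finset.single_le_sum (f := fun θ => |b * blockDev P f blk (fun i => ξ i ω) k θ|)
            (fun _ _ => abs_nonneg _) (Finset.mem_univ θ)⟩) fun k θ θ' => by
            rw [← mul_sub, abs_mul, abs_two]
            refine (mul_le_mul_of_nonneg_left (abs_ramp_sub_le _ _) two_pos.le).trans
              (le_of_eq ?_)
            nth_rewrite 1 [← abs_two (α := ℝ)]
            rw [← abs_mul]
            congr 1
            rw [hb]
            ring
        simp only [mul_left_comm (2 : ℝ)]
        exact h2
    refine h1.trans ((signMean_mono fun σ =>
      integral_ciSup_signed_blockDev_le h hm hP hf hfi hd hw hw0 hb0 σ).trans ?_)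
    rw [signMean_const]
    calc _ ≤ 2 * b * w * R := by gcongr
      _ = 16 / 3 * w * R / ε := by rw [hb]; ring
  have hEZ : ∫ ω, Z ω ∂μ ≤ 16 / 3 * w * R / ε + L * D := by
    have i1 : Integrable (fun ω => ⨆ θ, ∑ k, (W k ω θ - ∫ ω', W k ω' θ ∂μ)) μ :=
      integrable_ciSup (fun θ => Finset.measurable_sum _ fun k _ => (hWmθ k θ).sub_const _)
        fun θ => integrable_finsetSum _ fun k _ => (hWi k θ).sub (integrable_const _)
    calc ∫ ω, Z ω ∂μ ≤ ∫ ω, ((⨆ θ, ∑ k, (W k ω θ - ∫ ω', W k ω' θ ∂μ)) + L * D) ∂μ := by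
          refine integral_mono hZi (i1.add (integrable_const _)) fun ω => ciSup_le fun θ => ?_
          have h2 := le_ciSup (f := fun θ => ∑ k, (W k ω θ - ∫ ω', W k ω' θ ∂μ))
            (Set.finite_range _).bddAbove θ
          have h3 : ∑ k, ∫ ω', W k ω' θ ∂μ ≤ L * D := by
            refine (Finset.sum_le_sum fun k _ => hmean k θ).trans ?_
            simp only [Finset.sum_const, nsmul_eq_mul, Finset.card_univ]
            gcongr
          simp only [Finset.sum_sub_distrib] at h2 ⊢
          linarith
      _ = ∫ ω, ⨆ θ, ∑ k, (W k ω θ - ∫ ω', W k ω' θ ∂μ) ∂μ + L * D := by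
          rw [integral_add i1 (integrable_const _)]
          simp
      _ ≤ _ := by gcongr
  -- The exponent `-t L / 6 + L t ^ 2 / 8` is smallest at `t = 2 / 3`, with value `-L / 18`. The
  -- bound `L` may exceed the number of blocks, since only the clean blocks are summed.
  have hmgf := integral_exp_ciSup_sum_le hind hWm hW0 hW1 (2 / 3) Finset.univ (fun _ : T => 0)
  simp only [zero_add] at hmgf
  have hZb : ∀ ω, |Z ω| ≤ Fintype.card κ := fun ω => abs_ciSup_le fun θ => by
    refine (Finset.abs_sum_le_sum_abs _ _).trans ?_
    refine (Finset.sum_le_card_nsmul _ _ 1 fun k _ => ?_).trans (by simp)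
    rw [abs_of_nonneg (hW0 k ω θ)]
    exact hW1 k ω θ
  have hexp : Integrable (fun ω => Real.exp (2 / 3 * (Z ω - ∫ ω', Z ω' ∂μ))) μ := by
    refine Integrable.of_bound (C := Real.exp (2 / 3 * (Fintype.card κ - ∫ ω', Z ω' ∂μ)))
      (by fun_prop) (Filter.Eventually.of_forall fun ω => ?_)
    rw [Real.norm_eq_abs, Real.abs_exp, Real.exp_le_exp]
    have := (abs_le.1 (hZb ω)).2
    linarith
  have hcher := measure_ge_le_exp_mul_mgf (μ := μ) (X := fun ω => Z ω - ∫ ω', Z ω' ∂μ)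
    (t := 2 / 3) (L / 6) (by norm_num) hexp
  have hsub : {ω | ∃ θ, A < ∑ k, ramp (blockDev P f blk (fun i => ξ i ω) k θ / ε)} ⊆
      {ω | L / 6 ≤ Z ω - ∫ ω', Z ω' ∂μ} := by
    rintro ω ⟨θ, hθ⟩
    have h2 := le_ciSup (f := fun θ => ∑ k, W k ω θ) (Set.finite_range _).bddAbove θ
    have h3 : A < Z ω := lt_of_lt_of_le hθ h2
    change L / 6 ≤ Z ω - ∫ ω', Z ω' ∂μ
    linarith
  refine (measureReal_mono hsub).trans (hcher.trans ?_)
  calc Real.exp (-(2 / 3) * (L / 6)) * mgf (fun ω => Z ω - ∫ ω', Z ω' ∂μ) μ (2 / 3)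
      ≤ Real.exp (-(2 / 3) * (L / 6)) * Real.exp (L * (2 / 3) ^ 2 / 8) := by
        gcongr
        refine hmgf.trans ?_
        gcongr
        simpa using hL
    _ = Real.exp (-L / 18) := by
        rw [← Real.exp_add]
        ring_nf

end Core

/-! ### Elementary inequalities for powers and norms. -/

section Powers

lemma sum_rpow_le {ι : Type*} (s : Finset ι) {a : ι → ℝ} (ha : ∀ i, 0 ≤ a i) {r : ℝ} (hr : 0 < r)
    (hr1 : r ≤ 1) : (∑ i ∈ s, a i) ^ r ≤ ∑ i ∈ s, a i ^ r := by
  classical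
  induction s using Finset.induction_on with
  | empty => simp [Real.zero_rpow hr.ne']
  | insert i s his ih =>
    rw [Finset.sum_insert his, Finset.sum_insert his]
    have := Real.rpow_add_le_add_rpow (ha i) (Finset.sum_nonneg fun j _ => ha j : 0 ≤ ∑ j ∈ s, a j)
      hr.le hr1
    linarith

/-- Subadditivity of `t ↦ t ^ (p / 2)` applied to the squared coordinates; this is where `p ≤ 2`
enters. -/
lemma norm_rpow_le_sum {d : ℕ} (x : EuclideanSpace ℝ (Fin d)) {p : ℝ} (hp : 0 < p) (hp2 : p ≤ 2) :
    ‖x‖ ^ p ≤ ∑ k, |x k| ^ p := by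
  have h := sum_rpow_le Finset.univ (a := fun k => |x k| ^ 2) (fun k => by positivity)
    (r := p / 2) (by positivity) (by linarith)
  have e1 : ∀ t : ℝ, 0 ≤ t → (t ^ 2) ^ (p / 2) = t ^ p := fun t ht => by
    rw [← Real.rpow_two, ← Real.rpow_mul ht]
    ring_nf
  simp only [e1 _ (abs_nonneg _)] at h
  refine le_trans (le_of_eq ?_) h
  rw [← e1 _ (norm_nonneg _), EuclideanSpace.norm_sq_eq]
  simp only [Real.norm_eq_abs]

lemma norm_le_sum_abs {d : ℕ} (x : EuclideanSpace ℝ (Fin d)) : ‖x‖ ≤ ∑ k, |x k| := by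
  simpa using norm_rpow_le_sum x one_pos one_le_two

lemma add_rpow_le_two_rpow_mul {a b q : ℝ} (ha : 0 ≤ a) (hb : 0 ≤ b) (hq : 0 ≤ q) :
    (a + b) ^ q ≤ 2 ^ q * (a ^ q + b ^ q) := by
  have h1 : a + b ≤ 2 * max a b := by linarith [le_max_left a b, le_max_right a b]
  calc (a + b) ^ q ≤ (2 * max a b) ^ q := by gcongr
    _ = 2 ^ q * (max a b) ^ q := Real.mul_rpow two_pos.le (le_max_of_le_left ha)
    _ ≤ _ := by
      gcongr
      rcases max_cases a b with ⟨h, -⟩ | ⟨h, -⟩ <;> rw [h]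
      · linarith [Real.rpow_nonneg hb q]
      · linarith [Real.rpow_nonneg ha q]

end Powers

/-! ### Regularity of the loss. -/

section Loss

variable {d : ℕ} {𝒴 : Set ℝ} {ℓ : ℝ → 𝒴 → ℝ} {γ q : ℝ}

lemma LossAssumption.smoothness_nonneg (h : LossAssumption ℓ γ q) (y : 𝒴) : 0 ≤ γ := by
  have := (abs_nonneg _).trans (h.smooth 1 0 y)
  simpa using this

lemma LossAssumption.continuous_deriv (h : LossAssumption ℓ γ q) (y : 𝒴) :
    Continuous fun z => deriv (fun t => ℓ t y) z :=
  (LipschitzWith.of_dist_le' (K := γ) fun z z' => by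
    simpa [Real.dist_eq] using h.smooth z z' y).continuous

/-- Joint measurability passes to the limit of the difference quotients with steps `1 / (n + 1)`. -/
lemma LossAssumption.measurable_deriv (h : LossAssumption ℓ γ q) :
    Measurable fun p : ℝ × 𝒴 => deriv (fun t => ℓ t p.2) p.1 := by
  have hu : Filter.Tendsto (fun n : ℕ => (1 : ℝ) / ((n : ℝ) + 1)) Filter.atTop
      (nhdsWithin 0 {0}ᶜ) :=
    tendsto_nhdsWithin_iff.2 ⟨tendsto_one_div_add_atTop_nhds_zero_nat,
      Filter.Eventually.of_forall fun n => by
        simp only [Set.mem_compl_iff, Set.mem_singleton_iff]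
        positivity⟩
  refine measurable_of_tendsto_metrizable (f := fun (n : ℕ) (p : ℝ × 𝒴) =>
    ((1 : ℝ) / ((n : ℝ) + 1))⁻¹ • (ℓ (p.1 + 1 / ((n : ℝ) + 1)) p.2 - ℓ p.1 p.2)) (fun n => ?_)
    (tendsto_pi_nhds.2 fun p => ?_)
  · have h1 : Measurable fun p : ℝ × 𝒴 => ℓ (p.1 + 1 / ((n : ℝ) + 1)) p.2 :=
      h.measurable.comp ((measurable_fst.add_const _).prodMk measurable_snd)
    exact (h1.sub h.measurable).const_mul _
  · exact (hasDerivAt_iff_tendsto_slope_zero.1 (h.differentiable p.2 p.1).hasDerivAt).comp hu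

lemma LossAssumption.measurable_samplePartial (h : LossAssumption ℓ γ q) (j : Fin d)
    (θ : EuclideanSpace ℝ (Fin d)) :
    Measurable fun p : EuclideanSpace ℝ (Fin d) × 𝒴 => samplePartial ℓ j θ p.1 p.2 := by
  have h1 : Measurable fun p : EuclideanSpace ℝ (Fin d) × 𝒴 => ((inner ℝ p.1 θ : ℝ), p.2) := by
    fun_prop
  have h2 : Measurable fun p : EuclideanSpace ℝ (Fin d) × 𝒴 => p.1 j := by fun_prop
  exact (h.measurable_deriv.comp h1).mul h2

lemma LossAssumption.continuous_samplePartial (h : LossAssumption ℓ γ q) (j : Fin d)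
    (x : EuclideanSpace ℝ (Fin d)) (y : 𝒴) : Continuous fun θ => samplePartial ℓ j θ x y :=
  ((h.continuous_deriv y).comp (continuous_const.inner continuous_id)).mul continuous_const

lemma hasDerivAt_loss_line (h : LossAssumption ℓ γ q) (j : Fin d)
    (θ x : EuclideanSpace ℝ (Fin d)) (y : 𝒴) (t : ℝ) :
    HasDerivAt (fun t : ℝ => ℓ (inner ℝ x (θ + t • EuclideanSpace.single j 1)) y)
      (samplePartial ℓ j (θ + t • EuclideanSpace.single j 1) x y) t := by
  have e : ∀ t : ℝ, inner ℝ x (θ + t • EuclideanSpace.single j (1 : ℝ)) =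
      inner ℝ x θ + t * x j := fun t => by
    rw [inner_add_right, inner_smul_right, EuclideanSpace.inner_single_right]
    simp
  have h1 : HasDerivAt (fun t : ℝ => (inner ℝ x (θ + t • EuclideanSpace.single j (1 : ℝ)) : ℝ))
      (x j) t := by
    simp only [e]
    simpa using ((hasDerivAt_id t).mul_const (x j)).const_add (inner ℝ x θ)
  have h2 := (h.differentiable y
    (inner ℝ x (θ + t • EuclideanSpace.single j (1 : ℝ)))).hasDerivAt
  exact h2.comp t h1

end Loss

/-! ### Envelopes, integrability and the gradient of the risk. -/

section Moments

variable {Ω : Type*} [MeasurableSpace Ω] {μ : Measure Ω} {d n : ℕ} {𝒴 : Set ℝ}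
  {ℓ : ℝ → 𝒴 → ℝ} {γ q α : ℝ} {P : Measure (EuclideanSpace ℝ (Fin d) × 𝒴)}
  {X : Fin n → Ω → EuclideanSpace ℝ (Fin d)} {Y : Fin n → Ω → 𝒴} {O : Finset (Fin n)}

lemma DataAssumption.memLp_norm (hD : DataAssumption μ P X Y O α q) :
    MemLp (fun p => ‖p.1‖) (ENNReal.ofReal (max 2 (q * (α + 1)))) P := by
  have hr : 1 < max 2 (q * (α + 1)) := lt_of_lt_of_le one_lt_two (le_max_left _ _)
  have h1 : ∀ j, MemLp (fun p : EuclideanSpace ℝ (Fin d) × 𝒴 => |p.1 j|)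
      (ENNReal.ofReal (max 2 (q * (α + 1)))) P := fun j =>
    memLp_of_integrable_abs_rpow hr (by fun_prop) (by simpa using hD.moment_X j)
  refine (memLp_finsetSum Finset.univ fun j _ => h1 j).mono' (by fun_prop)
    (Filter.Eventually.of_forall fun p => ?_)
  rw [norm_norm]
  exact norm_le_sum_abs p.1

lemma maxCenteredMoment_nonneg {Θ : Set (EuclideanSpace ℝ (Fin d))} (j : Fin d) :
    0 ≤ maxCenteredMoment ℓ P Θ α j :=
  Real.iSup_nonneg fun _ => integral_nonneg fun _ => by positivity

variable [IsProbabilityMeasure P]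

lemma DataAssumption.integrable_norm_rpow (hD : DataAssumption μ P X Y O α q) {s : ℝ}
    (hs : 0 < s) (hs2 : s ≤ max 2 (q * (α + 1))) : Integrable (fun p => ‖p.1‖ ^ s) P := by
  have h1 := hD.memLp_norm.mono_exponent (ENNReal.ofReal_le_ofReal hs2)
  have h2 := h1.integrable_norm_rpow (by simpa using hs) (by simp)
  simpa [ENNReal.toReal_ofReal hs.le] using h2

/-- An envelope of the partial derivatives over a ball, with a moment of order `1 + α`. -/
lemma exists_envelope (hα : 0 < α) (hα1 : α ≤ 1) (hℓ : LossAssumption ℓ γ q)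
    (hD : DataAssumption μ P X Y O α q) (j : Fin d) (D : ℝ) :
    ∃ G : EuclideanSpace ℝ (Fin d) × 𝒴 → ℝ, Measurable G ∧
      MemLp G (ENNReal.ofReal (1 + α)) P ∧
      ∀ θ p, ‖θ‖ ≤ D → |samplePartial ℓ j θ p.1 p.2| ≤ G p := by
  have hq1 := hℓ.one_le_degree
  have hq2 := hℓ.degree_le_two
  have hp : 1 < 1 + α := by linarith
  obtain ⟨C₁, C₂, h1, h2, hg⟩ := hℓ.deriv_growth
  refine ⟨fun p => C₁ * |p.1 j| + C₂ * (|D| ^ (q - 1) * (‖p.1‖ ^ (q - 1) * |p.1 j|) +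
    |(p.2 : ℝ)| ^ (q - 1) * |p.1 j|), by fun_prop, ?_, ?_⟩
  · have m1 : MemLp (fun p : EuclideanSpace ℝ (Fin d) × 𝒴 => |p.1 j|)
        (ENNReal.ofReal (1 + α)) P := by
      refine (hD.memLp_norm.mono_exponent (ENNReal.ofReal_le_ofReal (le_max_of_le_left
        (by linarith)))).mono' (by fun_prop) (Filter.Eventually.of_forall fun p => ?_)
      simpa using PiLp.norm_apply_le p.1 j
    have m2 : MemLp (fun p : EuclideanSpace ℝ (Fin d) × 𝒴 => ‖p.1‖ ^ (q - 1) * |p.1 j|)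
        (ENNReal.ofReal (1 + α)) P := by
      refine memLp_of_integrable_abs_rpow hp (by fun_prop) ?_
      refine (hD.integrable_norm_rpow (s := q * (1 + α)) (by positivity)
        (by rw [add_comm]; exact le_max_right _ _)).mono'
        (Measurable.aestronglyMeasurable (by fun_prop))
        (Filter.Eventually.of_forall fun p => ?_)
      rw [Real.norm_eq_abs, abs_of_nonneg (by positivity), abs_of_nonneg (by positivity),
        Real.rpow_mul (norm_nonneg _)]
      gcongr
      calc ‖p.1‖ ^ (q - 1) * |p.1 j| ≤ ‖p.1‖ ^ (q - 1) * ‖p.1‖ ^ (1 : ℝ) := by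
            gcongr
            rw [Real.rpow_one]
            simpa using PiLp.norm_apply_le p.1 j
        _ = ‖p.1‖ ^ q := by
            rw [← Real.rpow_add_of_nonneg (norm_nonneg _) (by linarith) zero_le_one]
            ring_nf
    have m3 : MemLp (fun p : EuclideanSpace ℝ (Fin d) × 𝒴 => |(p.2 : ℝ)| ^ (q - 1) * |p.1 j|)
        (ENNReal.ofReal (1 + α)) P := by
      refine memLp_of_integrable_abs_rpow hp (by fun_prop) ?_
      refine (hD.moment_XY j).congr (Filter.Eventually.of_forall fun p => ?_)
      dsimp only
      rw [abs_of_nonneg (a := _ * _) (by positivity)]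
    exact (m1.const_mul C₁).add (((m2.const_mul (|D| ^ (q - 1))).add m3).const_mul C₂)
  · intro θ p hθ
    -- Since `0 ≤ q - 1 ≤ 1`, the power is subadditive. After multiplication by `|Xʲ|` the first
    -- part is of degree `q` in `X`, and the second is the mixed moment with `Y`.
    have e1 : |(inner ℝ p.1 θ : ℝ) - (p.2 : ℝ)| ^ (q - 1) ≤
        |D| ^ (q - 1) * ‖p.1‖ ^ (q - 1) + |(p.2 : ℝ)| ^ (q - 1) := by
      calc |(inner ℝ p.1 θ : ℝ) - (p.2 : ℝ)| ^ (q - 1)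
          ≤ (|D| * ‖p.1‖ + |(p.2 : ℝ)|) ^ (q - 1) := by
            refine Real.rpow_le_rpow (abs_nonneg _) ?_ (by linarith)
            refine (abs_sub _ _).trans (add_le_add ?_ le_rfl)
            refine (abs_real_inner_le_norm _ _).trans ?_
            rw [mul_comm]
            gcongr
            exact hθ.trans (le_abs_self D)
        _ ≤ (|D| * ‖p.1‖) ^ (q - 1) + |(p.2 : ℝ)| ^ (q - 1) :=
            Real.rpow_add_le_add_rpow (by positivity) (abs_nonneg _) (by linarith) (by linarith)
        _ = _ := by rw [Real.mul_rpow (abs_nonneg _) (norm_nonneg _)]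
    rw [samplePartial, abs_mul]
    calc _ ≤ (C₁ + C₂ * |(inner ℝ p.1 θ : ℝ) - (p.2 : ℝ)| ^ (q - 1)) * |p.1 j| := by
          gcongr
          exact hg _ _
      _ ≤ (C₁ + C₂ * (|D| ^ (q - 1) * ‖p.1‖ ^ (q - 1) + |(p.2 : ℝ)| ^ (q - 1))) * |p.1 j| := by
          gcongr
      _ = _ := by ring

lemma integrable_loss (hℓ : LossAssumption ℓ γ q) (hD : DataAssumption μ P X Y O α q)
    (θ : EuclideanSpace ℝ (Fin d)) : Integrable (fun p => ℓ (inner ℝ p.1 θ) p.2) P := by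
  have hq1 := hℓ.one_le_degree
  have hq2 := hℓ.degree_le_two
  obtain ⟨C₁, C₂, h1, h2, hg⟩ := hℓ.growth
  have hm : Measurable fun p : EuclideanSpace ℝ (Fin d) × 𝒴 => ℓ (inner ℝ p.1 θ) p.2 :=
    hℓ.measurable.comp (by fun_prop : Measurable
      fun p : EuclideanSpace ℝ (Fin d) × 𝒴 => ((inner ℝ p.1 θ : ℝ), p.2))
  refine Integrable.mono' (g := fun p => C₁ + C₂ * (2 ^ q * (‖p.1‖ ^ q * ‖θ‖ ^ q +
    |(p.2 : ℝ)| ^ q))) ?_ hm.aestronglyMeasurable (Filter.Eventually.of_forall fun p => ?_)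
  · exact (integrable_const _).add (((((hD.integrable_norm_rpow (by linarith)
      (le_max_of_le_left hq2)).mul_const _).add hD.moment_Y).const_mul _).const_mul _)
  · refine (hg _ _).trans ?_
    gcongr
    rw [← Real.mul_rpow (norm_nonneg _) (norm_nonneg _)]
    refine le_trans ?_ (add_rpow_le_two_rpow_mul (by positivity) (abs_nonneg _) (by linarith))
    gcongr
    exact (abs_sub _ _).trans (add_le_add (abs_real_inner_le_norm _ _) le_rfl)

/-- Differentiation under the integral sign: `g_j(θ) = E[ℓ'(Xᵀθ, Y) Xʲ]`. -/
theorem riskPartial_eq_integral (hα : 0 < α) (hα1 : α ≤ 1) (hℓ : LossAssumption ℓ γ q)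
    (hD : DataAssumption μ P X Y O α q) (j : Fin d) (θ : EuclideanSpace ℝ (Fin d)) :
    riskPartial ℓ P j θ = ∫ p, samplePartial ℓ j θ p.1 p.2 ∂P := by
  obtain ⟨G, hGm, hGp, hG⟩ := exists_envelope hα hα1 hℓ hD j (‖θ‖ + 1)
  have hGi : Integrable G P := integrable_of_memLp (by linarith) hGp
  set e : EuclideanSpace ℝ (Fin d) := EuclideanSpace.single j (1 : ℝ) with he
  -- The partial derivative is the derivative at `t = 0` along the line `θ + t • e`. For `|t| < 1`
  -- this line stays in the ball of radius `‖θ‖ + 1`, whose envelope dominates.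
  have hmain := hasDerivAt_integral_of_dominated_loc_of_deriv_le (μ := P) (𝕜 := ℝ)
    (F := fun t p => ℓ (inner ℝ p.1 (θ + t • e)) p.2)
    (F' := fun t p => samplePartial ℓ j (θ + t • e) p.1 p.2) (x₀ := 0) (bound := G)
    (Metric.ball_mem_nhds 0 one_pos)
    (Filter.Eventually.of_forall fun t => (integrable_loss hℓ hD _).aestronglyMeasurable)
    (integrable_loss hℓ hD _) (hℓ.measurable_samplePartial j _).aestronglyMeasurable
    (Filter.Eventually.of_forall fun p t ht => hG _ p (by
      refine (norm_add_le _ _).trans (add_le_add le_rfl ?_)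
      rw [norm_smul, he, PiLp.norm_single, norm_one, mul_one]
      simpa using (Metric.mem_ball.1 ht).le)) hGi
    (Filter.Eventually.of_forall fun p t _ => hasDerivAt_loss_line hℓ j θ p.1 p.2 t)
  have := hmain.2.deriv
  simp only [zero_smul, add_zero] at this
  exact this

lemma memLp_samplePartial (hα : 0 < α) (hα1 : α ≤ 1) (hℓ : LossAssumption ℓ γ q)
    (hD : DataAssumption μ P X Y O α q) (j : Fin d) (θ : EuclideanSpace ℝ (Fin d)) :
    MemLp (fun p => samplePartial ℓ j θ p.1 p.2) (ENNReal.ofReal (1 + α)) P := by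
  obtain ⟨G, hGm, hGp, hG⟩ := exists_envelope hα hα1 hℓ hD j ‖θ‖
  exact hGp.mono' (hℓ.measurable_samplePartial j θ).aestronglyMeasurable
    (Filter.Eventually.of_forall fun p => hG θ p le_rfl)

/-- A real supremum is an upper bound only if the family is bounded above; the envelope over a ball
containing `Θ` provides the bound. -/
lemma centeredMoment_le_maxCenteredMoment (hα : 0 < α) (hα1 : α ≤ 1) (hℓ : LossAssumption ℓ γ q)
    (hD : DataAssumption μ P X Y O α q) {Θ : Set (EuclideanSpace ℝ (Fin d))}
    (hΘ : Bornology.IsBounded Θ) (j : Fin d) (θ : Θ) :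
    centeredMoment ℓ P α j θ ≤ maxCenteredMoment ℓ P Θ α j := by
  have hp : 1 < 1 + α := by linarith
  obtain ⟨D, hDb⟩ := hΘ.exists_norm_le
  obtain ⟨G, hGm, hGp, hG⟩ := exists_envelope hα hα1 hℓ hD j D
  refine le_ciSup (f := fun θ : Θ => centeredMoment ℓ P α j θ)
    ⟨∫ p, |G p + ∫ p', G p' ∂P| ^ (1 + α) ∂P, ?_⟩ θ
  rintro _ ⟨θ, rfl⟩
  refine integral_mono_of_nonneg (Filter.Eventually.of_forall fun p => by positivity)
    (integrable_abs_rpow hp (hGp.add (memLp_const _))) (Filter.Eventually.of_forall fun p => ?_)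
  dsimp only
  refine Real.rpow_le_rpow (abs_nonneg _) (le_trans ?_ (le_abs_self _)) (by linarith)
  refine (abs_sub _ _).trans (add_le_add (hG θ p (hDb θ θ.2)) ?_)
  exact norm_integral_le_of_norm_le (f := fun p => samplePartial ℓ j θ p.1 p.2)
    (integrable_of_memLp hp hGp)
    (Filter.Eventually.of_forall fun p => hG θ p (hDb θ θ.2))

end Moments

/-! ### Rademacher variables as averages over sign vectors. -/

section PiRademacher

variable {ι : Type*} [Fintype ι] [DecidableEq ι]

/-- The law of a fair coin. -/
noncomputable def fairCoin : Measure Bool :=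
  (2⁻¹ : ℝ≥0∞) • Measure.dirac false + (2⁻¹ : ℝ≥0∞) • Measure.dirac true

instance : IsProbabilityMeasure fairCoin :=
  ⟨by simp [fairCoin, ENNReal.inv_two_add_inv_two]⟩

lemma map_boolSign_fairCoin : fairCoin.map boolSign = rademacher := by
  rw [fairCoin, Measure.map_add _ _ (measurable_of_finite _), Measure.map_smul, Measure.map_smul,
    Measure.map_dirac' (measurable_of_finite _), Measure.map_dirac' (measurable_of_finite _)]
  simp [boolSign, rademacher]

lemma fairCoin_singleton (b : Bool) : fairCoin {b} = 2⁻¹ := by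
  cases b <;> simp [fairCoin]

lemma integral_pi_rademacher {h : (ι → ℝ) → ℝ} (hm : Measurable h) :
    ∫ v, h v ∂(Measure.pi fun _ : ι => rademacher) =
      signMean fun σ => h fun i => boolSign (σ i) := by
  have e : (Measure.pi fun _ : ι => fairCoin).map (fun σ i => boolSign (σ i)) =
      Measure.pi fun _ : ι => rademacher := by
    rw [Measure.pi_map_pi (fun _ => (measurable_of_finite _).aemeasurable)]
    simp only [map_boolSign_fairCoin]
  rw [← e, integral_map (measurable_of_finite _).aemeasurable hm.aestronglyMeasurable,
    integral_fintype Integrable.of_finite, signMean, Finset.sum_div]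
  refine Finset.sum_congr rfl fun σ _ => ?_
  rw [measureReal_def, Measure.pi_singleton]
  simp [fairCoin_singleton, div_eq_inv_mul]

lemma ae_abs_le_one_rademacher : ∀ᵐ t ∂rademacher, |t| ≤ 1 := by
  rw [rademacher, ae_add_measure_iff]
  constructor <;>
  · refine Measure.ae_smul_measure ?_ _
    rw [ae_dirac_iff (measurableSet_le (by fun_prop) (by fun_prop))]
    simp

lemma integrable_abs_rademacher : Integrable (fun t : ℝ => |t|) rademacher :=
  Integrable.of_bound (by fun_prop) 1 (by
    filter_upwards [ae_abs_le_one_rademacher] with t ht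
    simpa using ht)

lemma signMean_restrict (p : ι → Prop) [DecidablePred p] (h : ({i // p i} → Bool) → ℝ) :
    signMean (fun σ : ι → Bool => h fun i => σ i) = signMean h := by
  have e := Fintype.sum_equiv (Equiv.piEquivPiSubtypeProd p fun _ => Bool)
    (fun σ : ι → Bool => h fun i => σ i) (fun x => h x.1) fun σ => rfl
  rw [signMean, signMean, e, Fintype.sum_prod_type]
  simp only [Finset.sum_const, nsmul_eq_mul, ← Finset.mul_sum, Finset.card_univ]
  rw [← Fintype.card_congr (Equiv.sumCompl p), Fintype.card_sum, pow_add, Fintype.card_fun]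
  have h2 : (2 : ℝ) ^ Fintype.card {i // ¬ p i} ≠ 0 := by positivity
  have h1 : (2 : ℝ) ^ Fintype.card {i // p i} ≠ 0 := by positivity
  simp only [Fintype.card_bool]
  push_cast
  field_simp

/-- The moment of order `1 < p ≤ 2` of a Rademacher sum. -/
lemma signMean_abs_sum_rpow_le {p : ℝ} (hp : 1 < p) (hp2 : p ≤ 2) (a : ι → ℝ) :
    signMean (fun σ => |∑ i, boolSign (σ i) * a i| ^ p) ≤ 2 ^ (2 - p) * ∑ i, |a i| ^ p := by
  have hc : ∀ c : ℝ, MemLp (fun t : ℝ => t * c) (ENNReal.ofReal p) rademacher := fun c =>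
    MemLp.of_bound (by fun_prop) |c| (by
      filter_upwards [ae_abs_le_one_rademacher] with t ht
      rw [Real.norm_eq_abs, abs_mul]
      exact mul_le_of_le_one_left (abs_nonneg _) ht)
  have hmp : ∀ i, MeasurePreserving (fun v : ι → ℝ => v i)
      (Measure.pi fun _ : ι => rademacher) rademacher := fun i =>
    measurePreserving_eval (fun _ : ι => rademacher) i
  have hE : ∀ (i : ι) {g : ℝ → ℝ}, Measurable g →
      ∫ v, g (v i) ∂(Measure.pi fun _ : ι => rademacher) = (g (-1) + g 1) / 2 := fun i g hg => by
    have h1 := integral_map (μ := Measure.pi fun _ : ι => rademacher) (hmp i).measurable.aemeasurable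
      (f := g) hg.aestronglyMeasurable
    have hi : ∀ x : ℝ, Integrable g ((2⁻¹ : ℝ≥0∞) • Measure.dirac x) := fun x =>
      (integrable_dirac (by simp)).smul_measure (by simp)
    rw [← h1, (hmp i).map_eq, rademacher, integral_add_measure (hi _) (hi _),
      integral_smul_measure, integral_smul_measure, integral_dirac, integral_dirac]
    simp
    ring
  have h := integral_abs_sum_rpow_le (μ := Measure.pi fun _ : ι => rademacher)
    (X := fun i v => v i * a i)
    (iIndepFun_pi (X := fun i (t : ℝ) => t * a i) fun i => by fun_prop)
    (fun i => by fun_prop) hp hp2 (fun i => (hc (a i)).comp_measurePreserving (hmp i))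
    (fun i => by rw [hE i (g := fun t => t * a i) (by fun_prop)]; ring) Finset.univ
  rw [integral_pi_rademacher (by fun_prop)] at h
  refine h.trans (le_of_eq ?_)
  congr 1
  refine Finset.sum_congr rfl fun i _ => ?_
  rw [hE i (g := fun t => |t * a i| ^ p) (by fun_prop)]
  simp

end PiRademacher

/-! ### Suprema over separable classes. -/

section ContinuousClass

lemma abs_sum_mul_le_envelope {S T ι : Type*} [Fintype ι] {f : T → S → ℝ} {G : S → ℝ} (hG : ∀ θ s, |f θ s| ≤ G s) (c : ι → ℝ)
    (z : ι → S) (θ : T) : |∑ i, c i * f θ (z i)| ≤ ∑ i, |c i| * G (z i) := by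
  refine (Finset.abs_sum_le_sum_abs _ _).trans (Finset.sum_le_sum fun i _ => ?_)
  rw [abs_mul]
  exact mul_le_mul_of_nonneg_left (hG _ _) (abs_nonneg _)

variable {Ω : Type*} [MeasurableSpace Ω] {μ : Measure Ω}
  {S T ι : Type*} [MeasurableSpace S] [TopologicalSpace T]
  [TopologicalSpace.SeparableSpace T] [Nonempty T] {P : Measure S}

/-- By continuity the supremum is attained along a countable dense subset. -/
lemma measurable_ciSup_of_continuous {v : Ω → T → ℝ} (hm : ∀ θ, Measurable fun ω => v ω θ)
    (hc : ∀ ω, Continuous (v ω)) : Measurable fun ω => ⨆ θ, v ω θ := by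
  have h := fun ω => (TopologicalSpace.denseRange_denseSeq T).ciSup' (hc ω)
  simp only [← h]
  have : Countable (Set.range (TopologicalSpace.denseSeq T)) := (Set.countable_range _).to_subtype
  exact Measurable.iSup fun θ => hm θ

variable {f : T → S → ℝ} {G : S → ℝ} {ξ : ι → Ω → S}

lemma integrable_ciSup_signed [Fintype ι] (hm : ∀ i, Measurable (ξ i)) (hP : ∀ i, μ.map (ξ i) = P)
    (hf : ∀ θ, Measurable (f θ)) (hc : ∀ s, Continuous fun θ => f θ s)
    (hGi : Integrable G P) (hG : ∀ θ s, |f θ s| ≤ G s) (c : ι → ℝ) :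
    Integrable (fun ω => ⨆ θ, ∑ i, c i * f θ (ξ i ω)) μ := by
  refine Integrable.mono' (g := fun ω => ∑ i, |c i| * G (ξ i ω)) ?_ ?_
    (Filter.Eventually.of_forall fun ω => abs_ciSup_le fun θ =>
      abs_sum_mul_le_envelope hG c (fun i => ξ i ω) θ)
  · exact integrable_finsetSum _ fun i _ =>
      ((measurePreserving_of_map_eq hm hP i).integrable_comp_of_integrable hGi).const_mul _
  · refine (measurable_ciSup_of_continuous (fun θ => Finset.measurable_sum _ fun i _ => ?_)
      fun ω => continuous_finsetSum _ fun i _ => (hc _).const_mul _).aestronglyMeasurable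
    exact ((hf θ).comp (hm i)).const_mul _

end ContinuousClass

/-! ### The Rademacher complexity as a finite average. -/

section Complexity

variable {Ω : Type*} [MeasurableSpace Ω] {μ : Measure Ω} [IsProbabilityMeasure μ] {d n : ℕ}
  {𝒴 : Set ℝ} {ℓ : ℝ → 𝒴 → ℝ} {γ q α : ℝ} {P : Measure (EuclideanSpace ℝ (Fin d) × 𝒴)}
  [IsProbabilityMeasure P] {Θ : Set (EuclideanSpace ℝ (Fin d))}
  {X : Fin n → Ω → EuclideanSpace ℝ (Fin d)} {Y : Fin n → Ω → 𝒴} {O : Finset (Fin n)}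

/-- Fubini separates data and signs, the signs integrate to an average over sign vectors, and the
signs carried by the outliers average out. The envelope justifies Fubini. -/
lemma rademacherComplexity_eq (hα : 0 < α) (hα1 : α ≤ 1) (hℓ : LossAssumption ℓ γ q)
    (hD : DataAssumption μ P X Y O α q) (hΘ : Bornology.IsBounded Θ) [Nonempty Θ] (j : Fin d) :
    rademacherComplexity μ ℓ Θ X Y O j = ∫ ω, signMean (fun σ : {i // i ∉ O} → Bool =>
      ⨆ θ : Θ, ∑ i, boolSign (σ i) * samplePartial ℓ j θ (X i ω) (Y i ω)) ∂μ := by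
  obtain ⟨D, hDb⟩ := hΘ.exists_norm_le
  obtain ⟨G, hGm, hGp, hG⟩ := exists_envelope hα hα1 hℓ hD j D
  have hGi : Integrable G P := integrable_of_memLp (by linarith) hGp
  have hsum : ∀ (v : Fin n → ℝ) (ω : Ω) (θ : Θ),
      ∑ i ∈ Oᶜ, v i * samplePartial ℓ j θ (X i ω) (Y i ω) =
      ∑ i : {i // i ∉ O}, v i * samplePartial ℓ j θ (X i ω) (Y i ω) := fun v ω θ =>
    Finset.sum_subtype _ (by simp) _
  have hm : ∀ i : {i // i ∉ O}, Measurable fun ω => (X i ω, Y i ω) := fun i => hD.measurable i i.2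
  have hP : ∀ i : {i // i ∉ O}, μ.map (fun ω => (X i ω, Y i ω)) = P := fun i => hD.law i i.2
  simp only [rademacherComplexity, hsum]
  have hmeas : Measurable fun w : Ω × (Fin n → ℝ) =>
      ⨆ θ : Θ, ∑ i : {i // i ∉ O}, w.2 i * samplePartial ℓ j θ (X i w.1) (Y i w.1) := by
    refine measurable_ciSup_of_continuous (fun θ => Finset.measurable_sum _ fun i _ => ?_)
      fun w => continuous_finsetSum _ fun i _ =>
        ((hℓ.continuous_samplePartial j _ _).comp continuous_subtype_val).const_mul _
    have := (hℓ.measurable_samplePartial j θ).comp ((hm i).comp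
      (measurable_fst : Measurable (Prod.fst : Ω × (Fin n → ℝ) → Ω)))
    exact ((measurable_pi_apply (i : Fin n)).comp measurable_snd).mul this
  rw [integral_prod]
  · refine integral_congr_ae (Filter.Eventually.of_forall fun ω => ?_)
    dsimp only
    have h1 := integral_pi_rademacher (hmeas.comp (measurable_prodMk_left (x := ω)))
    simp only [Function.comp_apply] at h1
    rw [h1]
    exact signMean_restrict (fun i => i ∉ O) fun σ =>
      ⨆ θ : Θ, ∑ i, boolSign (σ i) * samplePartial ℓ j θ (X i ω) (Y i ω)
  · refine Integrable.mono' (g := fun w => ∑ i : {i // i ∉ O}, G (X i w.1, Y i w.1) * |w.2 i|) ?_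
      hmeas.aestronglyMeasurable (Filter.Eventually.of_forall fun w => abs_ciSup_le fun θ => ?_)
    · refine integrable_finsetSum _ fun i _ => Integrable.mul_prod
        (f := fun ω => G (X i ω, Y i ω)) (g := fun v : Fin n → ℝ => |v i|) ?_ ?_
      · exact (measurePreserving_of_map_eq hm hP i).integrable_comp_of_integrable hGi
      · exact integrable_comp_eval (μ := fun _ : Fin n => rademacher) (i := (i : Fin n))
          (f := fun t : ℝ => |t|) integrable_abs_rademacher
    · simp only [mul_comm (G _)]
      exact abs_sum_mul_le_envelope (f := fun (θ : Θ) p => samplePartial ℓ j θ p.1 p.2)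
        (fun θ s => hG θ s (hDb θ θ.2)) (fun i : {i // i ∉ O} => w.2 i)
        (fun i => (X i w.1, Y i w.1)) θ

end Complexity

/-! ### Bounds on the Rademacher complexity under feature moments. -/

section ComplexityBound

lemma signMean_rpow_le {ι : Type*} [Fintype ι] [DecidableEq ι] {p : ℝ} (hp : 1 ≤ p)
    {h : (ι → Bool) → ℝ} (h0 : ∀ σ, 0 ≤ h σ) :
    signMean h ^ p ≤ signMean fun σ => h σ ^ p := by
  have := Real.rpow_arith_mean_le_arith_mean_rpow Finset.univ
    (fun _ : ι → Bool => ((2 : ℝ) ^ Fintype.card ι)⁻¹) h (fun _ _ => by positivity)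
    (by simp) (fun σ _ => h0 σ) hp
  simpa only [signMean, ← Finset.mul_sum, div_eq_inv_mul] using this

lemma rpow_integral_le {Ω : Type*} [MeasurableSpace Ω] {μ : Measure Ω} [IsProbabilityMeasure μ]
    {p : ℝ} (hp : 1 < p) {g : Ω → ℝ} (h0 : ∀ ω, 0 ≤ g ω) (hg : MemLp g (ENNReal.ofReal p) μ) :
    (∫ ω, g ω ∂μ) ^ p ≤ ∫ ω, g ω ^ p ∂μ := by
  refine (convexOn_rpow hp.le).map_integral_le
    (continuousOn_id.rpow_const fun _ _ => Or.inr (by linarith)) isClosed_Ici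
    (Filter.Eventually.of_forall h0) (integrable_of_memLp hp hg) ?_
  refine (integrable_abs_rpow hp hg).congr (Filter.Eventually.of_forall fun ω => ?_)
  simp [abs_of_nonneg (h0 ω)]

variable {Ω : Type*} [MeasurableSpace Ω] {μ : Measure Ω} [IsProbabilityMeasure μ] {d n : ℕ}
  {𝒴 : Set ℝ} {ℓ : ℝ → 𝒴 → ℝ} {γ q α : ℝ} {P : Measure (EuclideanSpace ℝ (Fin d) × 𝒴)}
  {Θ : Set (EuclideanSpace ℝ (Fin d))}
  {X : Fin n → Ω → EuclideanSpace ℝ (Fin d)} {Y : Fin n → Ω → 𝒴} {O : Finset (Fin n)}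

lemma featureMoment_nonneg (P : Measure (EuclideanSpace ℝ (Fin d) × 𝒴)) (α : ℝ) (k : Fin d) :
    0 ≤ featureMoment P α k :=
  Real.rpow_nonneg (integral_nonneg fun _ => by positivity) _

lemma integrable_abs_mul_rpow
    (hX : ∀ k : Fin d, Integrable (fun p => |p.1 k| ^ (2 * (1 + α))) P) (j k : Fin d) :
    Integrable (fun p => |p.1 j * p.1 k| ^ (1 + α)) P := by
  refine ((hX j).add (hX k)).mono' (Measurable.aestronglyMeasurable (by fun_prop))
    (Filter.Eventually.of_forall fun p => ?_)
  have e : ∀ t : ℝ, |t| ^ (2 * (1 + α)) = (|t| ^ (1 + α)) ^ 2 := fun t => by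
    rw [mul_comm, Real.rpow_mul (abs_nonneg t), Real.rpow_two]
  rw [Real.norm_eq_abs, abs_of_nonneg (by positivity), abs_mul,
    Real.mul_rpow (abs_nonneg _) (abs_nonneg _)]
  simp only [Pi.add_apply, e]
  nlinarith [sq_nonneg (|p.1 j| ^ (1 + α) - |p.1 k| ^ (1 + α)), sq_nonneg (|p.1 j| ^ (1 + α)),
    sq_nonneg (|p.1 k| ^ (1 + α))]

/-- The Cauchy–Schwarz inequality for `|Xʲ| ^ (1+α)` and `|Xᵏ| ^ (1+α)`. -/
lemma integral_abs_mul_rpow_le (hα : 0 < α)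
    (hX : ∀ k : Fin d, Integrable (fun p => |p.1 k| ^ (2 * (1 + α))) P) (j k : Fin d) :
    ∫ p, |p.1 j * p.1 k| ^ (1 + α) ∂P ≤
      featureMoment P α j ^ (1 + α) * featureMoment P α k ^ (1 + α) := by
  have hr : (1 + α) ≠ 0 := by positivity
  have e1 : ∀ t : ℝ, (|t| ^ (1 + α)) ^ (2 : ℝ) = |t| ^ (2 * (1 + α)) := fun t => by
    rw [← Real.rpow_mul (abs_nonneg t), mul_comm]
  have hL : ∀ k : Fin d, MemLp (fun p : EuclideanSpace ℝ (Fin d) × 𝒴 => |p.1 k| ^ (1 + α))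
      (ENNReal.ofReal 2) P := fun k => by
    refine memLp_of_integrable_abs_rpow one_lt_two
      (Measurable.aestronglyMeasurable (by fun_prop)) ((hX k).congr
        (Filter.Eventually.of_forall fun p => ?_))
    dsimp only
    rw [abs_of_nonneg (a := _ ^ (1 + α)) (by positivity), e1]
  have h := integral_mul_le_Lp_mul_Lq_of_nonneg Real.HolderConjugate.two_two
    (Filter.Eventually.of_forall fun p => by positivity)
    (Filter.Eventually.of_forall fun p => by positivity) (hL j) (hL k)
  have e2 : ∀ k : Fin d, featureMoment P α k ^ (1 + α) =
      (∫ p, (|p.1 k| ^ (1 + α)) ^ (2 : ℝ) ∂P) ^ (1 / 2 : ℝ) := fun k => by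
    simp only [e1]
    rw [featureMoment, ← Real.rpow_mul (integral_nonneg fun p => by positivity)]
    congr 1
    field_simp
  rw [e2, e2]
  refine le_trans (le_of_eq ?_) h
  simp only [abs_mul, Real.mul_rpow (abs_nonneg _) (abs_nonneg _)]

variable [IsProbabilityMeasure P]

/-- The Rademacher complexity of the partial derivatives is controlled by the expected norm of a
vector-valued Rademacher sum. -/
lemma rademacherComplexity_le_integral_norm (hα : 0 < α) (hα1 : α ≤ 1)
    (hℓ : LossAssumption ℓ γ q) (hD : DataAssumption μ P X Y O α q) (hΘ : IsCompact Θ)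
    (h0 : (0 : EuclideanSpace ℝ (Fin d)) ∈ Θ) (j : Fin d)
    (hi : ∀ σ : {i // i ∉ O} → Bool,
      Integrable (fun ω => ‖∑ i, (boolSign (σ i) * X i ω j) • X i ω‖) μ) :
    rademacherComplexity μ ℓ Θ X Y O j ≤ γ * Metric.diam Θ *
      ∫ ω, signMean (fun σ : {i // i ∉ O} → Bool =>
        ‖∑ i, (boolSign (σ i) * X i ω j) • X i ω‖) ∂μ := by
  have : Nonempty Θ := ⟨⟨0, h0⟩⟩
  obtain ⟨p₀⟩ := nonempty_of_isProbabilityMeasure P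
  have hγ : 0 ≤ γ := hℓ.smoothness_nonneg p₀.2
  have hm : ∀ i : {i // i ∉ O}, Measurable fun ω => (X i ω, Y i ω) := fun i => hD.measurable i i.2
  have hP : ∀ i : {i // i ∉ O}, μ.map (fun ω => (X i ω, Y i ω)) = P := fun i => hD.law i i.2
  obtain ⟨D, hDb⟩ := hΘ.isBounded.exists_norm_le
  obtain ⟨G, hGm, hGp, hG⟩ := exists_envelope hα hα1 hℓ hD j D
  have hnorm : ∀ θ : Θ, ‖(θ : EuclideanSpace ℝ (Fin d))‖ ≤ Metric.diam Θ := fun θ => by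
    simpa using Metric.dist_le_diam_of_mem hΘ.isBounded θ.2 h0
  rw [rademacherComplexity_eq hα hα1 hℓ hD hΘ.isBounded j, ← integral_const_mul]
  refine integral_mono ?_ ?_ fun ω => ?_
  · exact (integrable_finsetSum _ fun σ _ => integrable_ciSup_signed
      (f := fun (θ : Θ) p => samplePartial ℓ j θ p.1 p.2) hm hP
      (fun θ => hℓ.measurable_samplePartial j θ)
      (fun s => (hℓ.continuous_samplePartial j s.1 s.2).comp continuous_subtype_val)
      (integrable_of_memLp (by linarith) hGp) (fun θ s => hG θ s (hDb θ θ.2)) _).div_const _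
  · exact ((integrable_finsetSum _ fun σ _ => hi σ).div_const _).const_mul _
  · dsimp only
    rw [← signMean_mul]
    -- Smoothness of the loss makes the partial derivative vary no more than `γ Xʲ ⟨X, θ⟩`. The
    -- signed sum of the latter is an inner product with `θ`, and `‖θ‖ ≤ diam Θ` because `0 ∈ Θ`.
    refine (signMean_contraction
      (u := fun (i : {i // i ∉ O}) (θ : Θ) => samplePartial ℓ j θ (X i ω) (Y i ω))
      (t := fun (i : {i // i ∉ O}) (θ : Θ) => γ * (X i ω j * inner ℝ (X i ω) θ))
      (fun i => ⟨γ * (|X i ω j| * (‖X i ω‖ * Metric.diam Θ)), fun θ => ?_⟩)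
      fun i θ θ' => ?_).trans (signMean_mono fun σ => ciSup_le fun θ => ?_)
    · rw [abs_mul, abs_mul, abs_of_nonneg hγ]
      gcongr
      exact (abs_real_inner_le_norm _ _).trans (by gcongr; exact hnorm θ)
    · rw [samplePartial, samplePartial, ← sub_mul, abs_mul, ← mul_sub, ← mul_sub, abs_mul, abs_mul,
        abs_of_nonneg hγ]
      have := mul_le_mul_of_nonneg_right
        (hℓ.smooth (inner ℝ (X i ω) θ) (inner ℝ (X i ω) θ') (Y i ω)) (abs_nonneg (X i ω j))
      linarith
    · have e : ∑ i : {i // i ∉ O}, boolSign (σ i) * (γ * (X i ω j * inner ℝ (X i ω) θ)) =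
          γ * inner ℝ (∑ i : {i // i ∉ O}, (boolSign (σ i) * X i ω j) • X i ω) θ := by
        rw [sum_inner, Finset.mul_sum]
        refine Finset.sum_congr rfl fun i _ => ?_
        rw [real_inner_smul_left]
        ring
      rw [e, mul_assoc]
      gcongr
      refine (real_inner_le_norm _ _).trans ?_
      rw [mul_comm]
      gcongr
      exact hnorm θ

/-- The bound on the Rademacher complexity under moments of order `2 (1 + α)` of the features. -/
theorem rademacherComplexity_le (hα : 0 < α) (hα1 : α ≤ 1)
    (hℓ : LossAssumption ℓ γ q) (hD : DataAssumption μ P X Y O α q) (hΘ : IsCompact Θ)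
    (h0 : (0 : EuclideanSpace ℝ (Fin d)) ∈ Θ)
    (hX : ∀ k : Fin d, Integrable (fun p => |p.1 k| ^ (2 * (1 + α))) P) (j : Fin d) :
    rademacherComplexity μ ℓ Θ X Y O j ≤ γ * Metric.diam Θ * 2 *
      ((n : ℝ) * featureMoment P α j ^ (1 + α) *
        ∑ k, featureMoment P α k ^ (1 + α)) ^ (1 / (1 + α)) := by
  obtain ⟨p₀⟩ := nonempty_of_isProbabilityMeasure P
  have hγ : 0 ≤ γ := hℓ.smoothness_nonneg p₀.2
  set p := 1 + α with hpdef
  have hp : 1 < p := by linarith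
  have hp2 : p ≤ 2 := by linarith
  have hm : ∀ i : {i // i ∉ O}, Measurable fun ω => (X i ω, Y i ω) := fun i => hD.measurable i i.2
  have hP : ∀ i : {i // i ∉ O}, μ.map (fun ω => (X i ω, Y i ω)) = P := fun i => hD.law i i.2
  have hXm : ∀ i : {i // i ∉ O}, Measurable (X i) := fun i => measurable_fst.comp (hm i)
  set V : ({i // i ∉ O} → Bool) → Ω → EuclideanSpace ℝ (Fin d) := fun σ ω =>
    ∑ i, (boolSign (σ i) * X i ω j) • X i ω with hV
  have hVk : ∀ σ ω k, V σ ω k = ∑ i, boolSign (σ i) * (X i ω j * X i ω k) := fun σ ω k => by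
    simp [hV, mul_assoc]
  have hVm : ∀ σ, Measurable (V σ) := fun σ => Finset.measurable_sum _ fun i _ => by
    have := hXm i
    fun_prop
  have hA : ∀ (i : {i // i ∉ O}) k, MemLp (fun ω => X i ω j * X i ω k) (ENNReal.ofReal p) μ :=
    fun i k => (memLp_of_integrable_abs_rpow (X := fun s : EuclideanSpace ℝ (Fin d) × 𝒴 =>
      s.1 j * s.1 k) hp (by fun_prop) (integrable_abs_mul_rpow hX j k)).comp_measurePreserving
        (measurePreserving_of_map_eq hm hP i)
  have hVkp : ∀ σ k, MemLp (fun ω => V σ ω k) (ENNReal.ofReal p) μ := fun σ k => by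
    simp only [hVk]
    exact memLp_finsetSum _ fun i _ => (hA i k).const_mul _
  have hVp : ∀ σ, MemLp (fun ω => ‖V σ ω‖) (ENNReal.ofReal p) μ := fun σ =>
    (memLp_finsetSum Finset.univ fun k _ => (hVkp σ k).abs).mono' (hVm σ).norm.aestronglyMeasurable
      (Filter.Eventually.of_forall fun ω => by
        rw [norm_norm]
        exact norm_le_sum_abs _)
  have hVpi : ∀ σ, Integrable (fun ω => ‖V σ ω‖ ^ p) μ := fun σ => by
    simpa using integrable_abs_rpow hp (hVp σ)
  have hVkpi : ∀ k (σ : {i // i ∉ O} → Bool),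
      Integrable (fun ω => |∑ i, boolSign (σ i) * (X i ω j * X i ω k)| ^ p) μ := fun k σ => by
    simpa only [hVk] using integrable_abs_rpow hp (hVkp σ k)
  refine (rademacherComplexity_le_integral_norm hα hα1 hℓ hD hΘ h0 j fun σ =>
    integrable_of_memLp hp (hVp σ)).trans ?_
  rw [mul_assoc (γ * _)]
  refine mul_le_mul_of_nonneg_left ?_ (mul_nonneg hγ Metric.diam_nonneg)
  set E := ∫ ω, signMean (fun σ => ‖V σ ω‖) ∂μ with hE
  have hsm0 : ∀ ω, 0 ≤ signMean (fun σ => ‖V σ ω‖) := fun ω =>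
    div_nonneg (Finset.sum_nonneg fun σ _ => norm_nonneg _) (by positivity)
  have hsmp : MemLp (fun ω => signMean (fun σ => ‖V σ ω‖)) (ENNReal.ofReal p) μ := by
    have := (memLp_finsetSum Finset.univ fun σ (_ : σ ∈ Finset.univ) => hVp σ).mul_const
      ((2 : ℝ) ^ Fintype.card {i // i ∉ O})⁻¹
    simpa only [signMean, div_eq_mul_inv] using this
  set B := (n : ℝ) * featureMoment P α j ^ p * ∑ k, featureMoment P α k ^ p with hB
  have hB0 : 0 ≤ B := mul_nonneg (mul_nonneg (Nat.cast_nonneg _)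
    (Real.rpow_nonneg (featureMoment_nonneg _ _ _) _))
    (Finset.sum_nonneg fun k _ => Real.rpow_nonneg (featureMoment_nonneg _ _ _) _)
  -- Jensen's inequality twice, over the data and over the signs, then the von Bahr–Esseen
  -- inequality in each coordinate with its constant bounded by `2`.
  have hEp : E ^ p ≤ 2 * B := by
    calc E ^ p ≤ ∫ ω, signMean (fun σ => ‖V σ ω‖) ^ p ∂μ := rpow_integral_le hp hsm0 hsmp
      _ ≤ ∫ ω, signMean (fun σ => ‖V σ ω‖ ^ p) ∂μ := by
          refine integral_mono ?_ ((integrable_finsetSum _ fun σ _ => hVpi σ).div_const _)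
            fun ω => signMean_rpow_le hp.le fun σ => norm_nonneg _
          refine (integrable_abs_rpow hp hsmp).congr (Filter.Eventually.of_forall fun ω => ?_)
          simp only [abs_of_nonneg (hsm0 ω)]
      _ ≤ ∫ ω, ∑ k, 2 * ∑ i : {i // i ∉ O}, |X i ω j * X i ω k| ^ p ∂μ := by
          refine integral_mono ((integrable_finsetSum _ fun σ _ => hVpi σ).div_const _)
            (integrable_finsetSum _ fun k _ => (integrable_finsetSum _ fun i _ =>
              integrable_abs_rpow hp (hA i k)).const_mul 2) fun ω => ?_
          calc signMean (fun σ => ‖V σ ω‖ ^ p)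
              ≤ signMean (fun σ => ∑ k, |V σ ω k| ^ p) :=
                signMean_mono fun σ => norm_rpow_le_sum _ (by linarith) hp2
            _ = ∑ k, signMean (fun σ => |V σ ω k| ^ p) := by
                simp only [signMean, Finset.sum_div]
                exact Finset.sum_comm
            _ ≤ ∑ k, 2 * ∑ i : {i // i ∉ O}, |X i ω j * X i ω k| ^ p := by
                refine Finset.sum_le_sum fun k _ => ?_
                simp only [hVk]
                refine (signMean_abs_sum_rpow_le hp hp2 _).trans ?_
                refine mul_le_mul_of_nonneg_right ?_
                  (Finset.sum_nonneg fun i _ => by positivity)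
                calc (2 : ℝ) ^ (2 - p) ≤ 2 ^ (1 : ℝ) :=
                      Real.rpow_le_rpow_of_exponent_le one_le_two (by linarith)
                  _ = 2 := Real.rpow_one _
      _ = ∑ k, 2 * ∑ i : {i // i ∉ O}, ∫ ω, |X i ω j * X i ω k| ^ p ∂μ := by
          rw [integral_finsetSum _ fun k _ => (integrable_finsetSum _ fun i _ =>
            integrable_abs_rpow hp (hA i k)).const_mul 2]
          refine Finset.sum_congr rfl fun k _ => ?_
          rw [integral_const_mul, integral_finsetSum _ fun i _ => integrable_abs_rpow hp (hA i k)]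
      _ ≤ ∑ k, 2 * ((n : ℝ) * (featureMoment P α j ^ p * featureMoment P α k ^ p)) := by
          refine Finset.sum_le_sum fun k _ => mul_le_mul_of_nonneg_left ?_ two_pos.le
          have h1 : ∀ i : {i // i ∉ O}, ∫ ω, |X i ω j * X i ω k| ^ p ∂μ ≤
              featureMoment P α j ^ p * featureMoment P α k ^ p := fun i => by
            rw [integral_comp_of_map_eq hm hP i
              (g := fun s : EuclideanSpace ℝ (Fin d) × 𝒴 => |s.1 j * s.1 k| ^ p) (by fun_prop)]
            exact integral_abs_mul_rpow_le hα hX j k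
          refine (Finset.sum_le_sum fun i _ => h1 i).trans ?_
          rw [Finset.sum_const, nsmul_eq_mul]
          refine mul_le_mul_of_nonneg_right ?_ (mul_nonneg
            (Real.rpow_nonneg (featureMoment_nonneg _ _ _) _)
            (Real.rpow_nonneg (featureMoment_nonneg _ _ _) _))
          rw [Finset.card_univ]
          exact_mod_cast (Fintype.card_subtype_le _).trans (Fintype.card_fin n).le
      _ = 2 * B := by
          rw [hB, ← Finset.mul_sum, ← Finset.mul_sum, ← Finset.mul_sum, mul_assoc]
  have hE0 : 0 ≤ E := integral_nonneg hsm0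
  have hp0 : p ≠ 0 := by linarith
  calc E = (E ^ p) ^ (1 / p) := by
        rw [← Real.rpow_mul hE0, mul_one_div_cancel hp0, Real.rpow_one]
    _ ≤ (2 * B) ^ (1 / p) := by gcongr
    _ = 2 ^ (1 / p) * B ^ (1 / p) := Real.mul_rpow two_pos.le hB0
    _ ≤ 2 ^ (1 : ℝ) * B ^ (1 / p) := by
        gcongr
        · exact one_le_two
        · rw [div_le_one (by linarith)]
          exact hp.le
    _ = _ := by rw [Real.rpow_one]

lemma rademacherComplexity_le_of_featureMoment_le (hα : 0 < α) (hα1 : α ≤ 1)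
    (hℓ : LossAssumption ℓ γ q) (hD : DataAssumption μ P X Y O α q) (hΘ : IsCompact Θ)
    (h0 : (0 : EuclideanSpace ℝ (Fin d)) ∈ Θ)
    (hX : ∀ k : Fin d, Integrable (fun p => |p.1 k| ^ (2 * (1 + α))) P) (j : Fin d) {m : ℝ}
    (hm : ∀ k : Fin d, featureMoment P α k ≤ m) :
    rademacherComplexity μ ℓ Θ X Y O j ≤
      γ * Metric.diam Θ * 2 * m ^ 2 * ((n : ℝ) * d) ^ (1 / (1 + α)) := by
  obtain ⟨p₀⟩ := nonempty_of_isProbabilityMeasure P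
  have hγ : 0 ≤ γ := hℓ.smoothness_nonneg p₀.2
  have hm0 : 0 ≤ m := (featureMoment_nonneg P α j).trans (hm j)
  refine (rademacherComplexity_le hα hα1 hℓ hD hΘ h0 hX j).trans ?_
  rw [mul_assoc _ (m ^ 2)]
  refine mul_le_mul_of_nonneg_left ?_
    (mul_nonneg (mul_nonneg hγ Metric.diam_nonneg) two_pos.le)
  have hp : 0 < 1 + α := by linarith
  have h1 : ∀ k, featureMoment P α k ^ (1 + α) ≤ m ^ (1 + α) := fun k =>
    Real.rpow_le_rpow (featureMoment_nonneg P α k) (hm k) hp.le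
  have h2 : ∀ k, 0 ≤ featureMoment P α k ^ (1 + α) := fun k =>
    Real.rpow_nonneg (featureMoment_nonneg P α k) _
  have hs : ∑ k, featureMoment P α k ^ (1 + α) ≤ d * m ^ (1 + α) :=
    (Finset.sum_le_sum fun k _ => h1 k).trans (by simp)
  calc _ ≤ ((n : ℝ) * m ^ (1 + α) * (d * m ^ (1 + α))) ^ (1 / (1 + α)) := by
        refine Real.rpow_le_rpow ?_ ?_ (by positivity)
        · exact mul_nonneg (mul_nonneg (Nat.cast_nonneg _) (h2 j))
            (Finset.sum_nonneg fun k _ => h2 k)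
        · exact mul_le_mul (mul_le_mul_of_nonneg_left (h1 j) (Nat.cast_nonneg _)) hs
            (Finset.sum_nonneg fun k _ => h2 k) (by positivity)
    _ = ((m ^ 2) ^ (1 + α) * ((n : ℝ) * d)) ^ (1 / (1 + α)) := by
        congr 1
        rw [sq, Real.mul_rpow hm0 hm0]
        ring
    _ = _ := by
        rw [Real.mul_rpow (by positivity) (by positivity), ← Real.rpow_mul (by positivity),
          mul_one_div_cancel hp.ne', Real.rpow_one]

end ComplexityBound

/-! ### Robustness of the median. -/

section Median

/-- If the median is far from `c`, then so are at least half of the values. -/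
lemma le_two_mul_card_of_lt_abs_median_sub {K : ℕ} [NeZero K] {v : Fin K → ℝ} {c η : ℝ}
    (h : η < |median v - c|) :
    K ≤ 2 * (Finset.univ.filter fun k => η < |v k - c|).card := by
  have hK := NeZero.pos K
  have hmono := Tuple.monotone_sort v
  set i₁ : Fin K := ⟨(K - 1) / 2, by omega⟩ with hi₁
  set i₂ : Fin K := ⟨K / 2, by omega⟩ with hi₂
  have hab : v (Tuple.sort v i₁) ≤ v (Tuple.sort v i₂) :=
    hmono (by rw [hi₁, hi₂, Fin.mk_le_mk]; omega)
  have hmed : median v = (v (Tuple.sort v i₁) + v (Tuple.sort v i₂)) / 2 := rfl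
  -- If the median is too large, so is the upper middle entry and every entry sorted above it, which
  -- makes `K - ⌊K/2⌋` values. If it is too small, the lower middle entry yields `⌊(K-1)/2⌋ + 1`
  -- values. Both are at least `K/2`, for either parity.
  rcases lt_abs.1 h with h | h
  · have hc : (Finset.Ici i₂).card ≤ (Finset.univ.filter fun k => η < |v k - c|).card := by
      refine Finset.card_le_card_of_injOn (Tuple.sort v) (fun i hi => ?_)
        (Tuple.sort v).injective.injOn
      have h1 : v (Tuple.sort v i₂) ≤ v (Tuple.sort v i) := hmono (by simpa using hi)
      simp only [Finset.coe_filter, Finset.mem_univ, true_and, Set.mem_ofPred_eq]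
      exact lt_of_lt_of_le (by linarith) (le_abs_self _)
    rw [Fin.card_Ici] at hc
    simp only [hi₂] at hc
    omega
  · have hc : (Finset.Iic i₁).card ≤ (Finset.univ.filter fun k => η < |v k - c|).card := by
      refine Finset.card_le_card_of_injOn (Tuple.sort v) (fun i hi => ?_)
        (Tuple.sort v).injective.injOn
      have h1 : v (Tuple.sort v i) ≤ v (Tuple.sort v i₁) := hmono (by simpa using hi)
      simp only [Finset.coe_filter, Finset.mem_univ, true_and, Set.mem_ofPred_eq]
      exact lt_of_lt_of_le (by linarith) (neg_le_abs _)
    rw [Fin.card_Iic] at hc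
    simp only [hi₁] at hc
    omega

end Median

/-! ### Block sizes and blocks without outliers. -/

section Partition

variable {n K : ℕ} {b : Fin n → Fin K} {O : Finset (Fin n)}

/-- The blocks of a balanced partition have at least half of the average size. -/
lemma le_two_mul_mul_card_block (hKn : K ≤ n)
    (hb : ∀ k k', (Finset.univ.filter (fun i => b i = k)).card ≤
      (Finset.univ.filter (fun i => b i = k')).card + 1) (k : Fin K) :
    n ≤ 2 * K * (Finset.univ.filter (fun i => b i = k)).card := by
  have hsum : n = ∑ l, (Finset.univ.filter (fun i => b i = l)).card := by
    have := Finset.card_eq_sum_card_fiberwise (f := b) (s := Finset.univ) (t := Finset.univ)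
      (by simp)
    simpa using this
  set N := (Finset.univ.filter (fun i => b i = k)).card with hN
  have hle : n ≤ N + (K - 1) * (N + 1) := by
    calc n = ∑ l, (Finset.univ.filter (fun i => b i = l)).card := hsum
      _ = N + ∑ l ∈ Finset.univ.erase k, (Finset.univ.filter (fun i => b i = l)).card :=
          (Finset.add_sum_erase _ _ (Finset.mem_univ k)).symm
      _ ≤ N + ∑ l ∈ Finset.univ.erase k, (N + 1) := by
          gcongr with l hl
          exact hb l k
      _ = _ := by simp [Finset.card_erase_of_mem]
  have hK : 0 < K := k.pos
  obtain ⟨M, rfl⟩ : ∃ M, K = M + 1 := ⟨K - 1, by omega⟩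
  rw [Nat.add_sub_cancel] at hle
  -- The bound reads `n ≤ K N + K - 1`. An empty block would give `n < K`; otherwise `K ≤ K N`.
  rcases Nat.eq_zero_or_pos N with h0 | h0
  · rw [h0] at hle
    omega
  · nlinarith

/-- The blocks without outliers. -/
abbrev CleanBlock (b : Fin n → Fin K) (O : Finset (Fin n)) : Type :=
  {k : Fin K // ∀ i, b i = k → i ∉ O}

/-- A block without outliers, as a set of inliers. -/
def cleanBlock (b : Fin n → Fin K) (O : Finset (Fin n)) (k : CleanBlock b O) :
    Finset {i : Fin n // i ∉ O} :=
  Finset.univ.filter fun i => b i = k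

lemma disjoint_cleanBlock (k l : CleanBlock b O) (h : k ≠ l) :
    Disjoint (cleanBlock b O k) (cleanBlock b O l) := by
  rw [Finset.disjoint_left]
  intro i hi hi'
  simp only [cleanBlock, Finset.mem_filter, Finset.mem_univ, true_and] at hi hi'
  exact h (Subtype.ext (hi.symm.trans hi'))

lemma sum_cleanBlock {M : Type*} [AddCommMonoid M] (k : CleanBlock b O) (v : Fin n → M) :
    ∑ i ∈ cleanBlock b O k, v i = ∑ i with b i = k, v i := by
  refine Finset.sum_bij (fun i _ => i.1) (fun i hi => ?_) (fun i _ i' _ h => Subtype.ext h)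
    (fun i hi => ⟨⟨i, k.2 i (by simpa using hi)⟩, ?_, rfl⟩) fun _ _ => rfl
  · simpa [cleanBlock] using hi
  · simpa [cleanBlock] using hi

lemma card_cleanBlock (k : CleanBlock b O) :
    (cleanBlock b O k).card = (Finset.univ.filter (fun i => b i = k)).card := by
  simpa using sum_cleanBlock k fun _ => (1 : ℕ)

lemma blockMean_eq_cleanBlock (k : CleanBlock b O) (v : Fin n → ℝ) :
    blockMean b v k = (∑ i ∈ cleanBlock b O k, v i) / (cleanBlock b O k).card := by
  rw [blockMean, sum_cleanBlock, card_cleanBlock]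

/-- Every block that is not clean contains an outlier, so there are at most `O.card` of them. -/
lemma card_filter_le_clean_add (p : Fin K → Prop) [DecidablePred p] :
    (Finset.univ.filter p).card ≤
      (Finset.univ.filter fun k : CleanBlock b O => p k).card + O.card := by
  have h : Finset.univ.filter p ⊆
      (Finset.univ.filter fun k : CleanBlock b O => p k).map (Function.Embedding.subtype _) ∪
        O.image b := by
    intro k hk
    rw [Finset.mem_union]
    by_cases hc : ∀ i, b i = k → i ∉ O
    · left
      rw [Finset.mem_map]
      exact ⟨⟨k, hc⟩, by simpa using hk, rfl⟩
    · right
      push Not at hc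
      obtain ⟨i, hi, hiO⟩ := hc
      exact Finset.mem_image.2 ⟨i, hiO, hi⟩
  refine (Finset.card_le_card h).trans ((Finset.card_union_le _ _).trans ?_)
  rw [Finset.card_map]
  exact Nat.add_le_add_left Finset.card_image_le _

end Partition

/-! ### From finite classes to sequences. -/

section Sequence

variable {Ω : Type*} [MeasurableSpace Ω] {μ : Measure Ω} [IsProbabilityMeasure μ]
  {S : Type*} [MeasurableSpace S] {P : Measure S} [IsProbabilityMeasure P]
  {ι κ : Type*} [Fintype ι] [DecidableEq ι] [Fintype κ] [DecidableEq κ]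
  {ξ : ι → Ω → S} {blk : κ → Finset ι}

/-- Concentration of the number of bad blocks, uniformly over a sequence of functions. -/
theorem measure_exists_sum_ramp_blockDev_gt_le {f : ℕ → S → ℝ} (h : iIndepFun ξ μ)
    (hm : ∀ i, Measurable (ξ i)) (hP : ∀ i, μ.map (ξ i) = P) (hf : ∀ m, Measurable (f m))
    {p : ℝ} (hp : 1 < p) (hp2 : p ≤ 2) (hfp : ∀ m, MemLp (f m) (ENNReal.ofReal p) P)
    (hd : ∀ k l, k ≠ l → Disjoint (blk k) (blk l)) {w : ℝ} (hw : ∀ k, 1 ≤ w * (blk k).card)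
    (hw0 : 0 ≤ w) {M : ℝ} (hM : ∀ m, ∫ s, |f m s - ∫ s', f m s' ∂P| ^ p ∂P ≤ M)
    {R : ℝ} (hR : ∀ N : ℕ, ∫ ω, signMean (fun τ =>
      ⨆ m : Fin (N + 1), ∑ i, boolSign (τ i) * f m (ξ i ω)) ∂μ ≤ R)
    {ε L A : ℝ} (hε : 0 < ε) (hL : (Fintype.card κ : ℝ) ≤ L)
    (hA : 16 / 3 * w * R / ε + L * (4 / 3 * (2 ^ (2 - p) * w ^ (p - 1) * M) / ε ^ p) + L / 6 ≤ A) :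
    μ {ω | ∃ m : ℕ, A < ∑ k, ramp (blockDev P f blk (fun i => ξ i ω) k m / ε)} ≤
      ENNReal.ofReal (Real.exp (-L / 18)) := by
  set s : ℕ → Set Ω := fun N => {ω | ∃ m : Fin (N + 1),
    A < ∑ k, ramp (blockDev P (fun m : Fin (N + 1) => f m) blk (fun i => ξ i ω) k m / ε)} with hs
  have hmono : Monotone s := fun N N' hN ω ⟨m, hmω⟩ => ⟨⟨m, by omega⟩, hmω⟩
  have hU : {ω | ∃ m : ℕ, A < ∑ k, ramp (blockDev P f blk (fun i => ξ i ω) k m / ε)} ⊆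
      ⋃ N, s N := fun ω ⟨m, hmω⟩ => Set.mem_iUnion.2 ⟨m, ⟨m, by omega⟩, hmω⟩
  refine (measure_mono hU).trans ?_
  rw [hmono.measure_iUnion]
  refine iSup_le fun N => ?_
  rw [← ofReal_measureReal]
  exact ENNReal.ofReal_le_ofReal (measure_sum_ramp_blockDev_gt_le
    (f := fun m : Fin (N + 1) => f m) h hm hP (fun m => hf m) hp hp2 (fun m => hfp m) hd hw hw0
    (fun m => hM m) (hR N) hε hL hA)

end Sequence

/-! ### The deviation of the median-of-means estimator. -/

section Deviation

variable {Ω : Type*} [MeasurableSpace Ω] {μ : Measure Ω} {d n K : ℕ}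
  {𝒴 : Set ℝ} {ℓ : ℝ → 𝒴 → ℝ} {γ q α : ℝ} {P : Measure (EuclideanSpace ℝ (Fin d) × 𝒴)}
  {Θ : Set (EuclideanSpace ℝ (Fin d))}
  {X : Fin n → Ω → EuclideanSpace ℝ (Fin d)} {Y : Fin n → Ω → 𝒴} {O : Finset (Fin n)}

/-- The partial derivatives at the points of a dense sequence of `Θ`. -/
noncomputable def denseSamplePartial (ℓ : ℝ → 𝒴 → ℝ) (Θ : Set (EuclideanSpace ℝ (Fin d)))
    [Nonempty Θ] (j : Fin d) (m : ℕ) (p : EuclideanSpace ℝ (Fin d) × 𝒴) : ℝ :=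
  samplePartial ℓ j (TopologicalSpace.denseSeq Θ m) p.1 p.2

variable [IsProbabilityMeasure P]

lemma continuous_integral_samplePartial (hα : 0 < α) (hα1 : α ≤ 1) (hℓ : LossAssumption ℓ γ q)
    (hD : DataAssumption μ P X Y O α q) (hΘ : Bornology.IsBounded Θ) (j : Fin d) :
    Continuous fun θ : Θ => ∫ p, samplePartial ℓ j θ p.1 p.2 ∂P := by
  obtain ⟨D, hDb⟩ := hΘ.exists_norm_le
  obtain ⟨G, hGm, hGp, hG⟩ := exists_envelope hα hα1 hℓ hD j D
  exact continuous_of_dominated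
    (fun θ => (hℓ.measurable_samplePartial j θ).aestronglyMeasurable)
    (fun θ => Filter.Eventually.of_forall fun p => hG θ p (hDb θ θ.2))
    (integrable_of_memLp (by linarith) hGp) (Filter.Eventually.of_forall fun p =>
      (hℓ.continuous_samplePartial j p.1 p.2).comp continuous_subtype_val)

/-- A large deviation of the median-of-means estimator yields many bad blocks without outliers,
for some point of the dense sequence. -/
lemma exists_lt_sum_ramp_of_le_momDeviation [NeZero K] (hα : 0 < α) (hα1 : α ≤ 1)
    (hℓ : LossAssumption ℓ γ q) (hD : DataAssumption μ P X Y O α q)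
    (hΘ : Bornology.IsBounded Θ) [Nonempty Θ] (j : Fin d) {b : Fin n → Fin K} {ε A : ℝ}
    (hε : 0 < ε) (hA0 : 0 ≤ A) (hA : A < (K : ℝ) / 2 - O.card)
    (x : Fin n → EuclideanSpace ℝ (Fin d)) (y : Fin n → 𝒴)
    (h : ε ≤ momDeviation ℓ P Θ b x y j) :
    ∃ m : ℕ, A < ∑ k, ramp (blockDev P (denseSamplePartial ℓ Θ j) (cleanBlock b O)
      (fun i => (x i, y i)) k m / ε) := by
  set C := (K : ℝ) / 2 - O.card with hC
  have hC0 : 0 < C := hA0.trans_lt hA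
  -- The supremum need not be attained, so some `θ` is only known to deviate by more than `ε (1 -
  -- s)`. Each bad ramp is then at least `1 - 4s/3`, and this `s` costs only `(C - A) / 3` of the
  -- slack between `A` and `C`.
  set s := (C - A) / (4 * C) with hs
  have hs0 : 0 < s := div_pos (by linarith) (by linarith)
  have hs1 : s ≤ 1 / 4 := by
    rw [hs, div_le_div_iff₀ (by linarith) (by norm_num)]
    linarith
  have hη : ε * (1 - s) < momDeviation ℓ P Θ b x y j := lt_of_lt_of_le (by nlinarith) h
  obtain ⟨θ, hθ⟩ := exists_lt_of_lt_ciSup hη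
  set F : Θ → ℝ := fun θ => ∑ k, ramp (blockDev P (fun (θ : Θ) p => samplePartial ℓ j θ p.1 p.2)
    (cleanBlock b O) (fun i => (x i, y i)) k θ / ε) with hF
  have hFc : Continuous F := by
    refine continuous_finsetSum _ fun k _ => ramp_continuous.comp (Continuous.div_const ?_ _)
    exact ((continuous_finsetSum _ fun i _ => (hℓ.continuous_samplePartial j _ _).comp
      continuous_subtype_val).div_const _).sub
        (continuous_integral_samplePartial hα hα1 hℓ hD hΘ j)
  have hFθ : A < F θ := by
    rw [riskPartial_eq_integral hα hα1 hℓ hD, momEstimator] at hθ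
    have h1 := le_two_mul_card_of_lt_abs_median_sub hθ
    have h2 := card_filter_le_clean_add (b := b) (O := O) fun k => ε * (1 - s) <
      |blockMean b (fun i => samplePartial ℓ j θ (x i) (y i)) k -
        ∫ p, samplePartial ℓ j θ p.1 p.2 ∂P|
    set Q := (Finset.univ.filter fun k : CleanBlock b O => ε * (1 - s) <
      |blockMean b (fun i => samplePartial ℓ j θ (x i) (y i)) k -
        ∫ p, samplePartial ℓ j θ p.1 p.2 ∂P|) with hQ
    have h3 : C ≤ Q.card := by
      have h4 : (K : ℝ) ≤ 2 * (Q.card + O.card) := by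
        exact_mod_cast h1.trans (Nat.mul_le_mul_left 2 h2)
      rw [hC]
      linarith
    have h5 : ∀ k ∈ Q, 1 - 4 / 3 * s ≤
        ramp (blockDev P (fun (θ : Θ) p => samplePartial ℓ j θ p.1 p.2)
          (cleanBlock b O) (fun i => (x i, y i)) k θ / ε) := fun k hk => by
      have h6 : ε * (1 - s) < _ := (Finset.mem_filter.1 hk).2
      rw [blockMean_eq_cleanBlock] at h6
      have h7 := le_ramp (η := 1 - s) (by linarith)
        (u := blockDev P (fun (θ : Θ) p => samplePartial ℓ j θ p.1 p.2)
          (cleanBlock b O) (fun i => (x i, y i)) k θ / ε) (by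
          rw [abs_div, abs_of_pos hε, le_div_iff₀ hε, mul_comm]
          exact h6.le)
      linarith
    have hCs : C * (4 / 3 * s) = (C - A) / 3 := by
      rw [hs]
      field_simp
    calc A < C * (1 - 4 / 3 * s) := by
          rw [mul_sub, hCs]
          linarith
      _ ≤ Q.card * (1 - 4 / 3 * s) := by
          refine mul_le_mul_of_nonneg_right h3 (by linarith)
      _ = ∑ k ∈ Q, (1 - 4 / 3 * s) := by rw [Finset.sum_const, nsmul_eq_mul]
      _ ≤ ∑ k ∈ Q, _ := Finset.sum_le_sum h5
      _ ≤ F θ := Finset.sum_le_sum_of_subset_of_nonneg (Finset.subset_univ _)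
          fun k _ _ => ramp_nonneg _
  -- Replacing indicators by ramps makes the count continuous in `θ`, so the strict inequality
  -- persists at a point of the dense sequence.
  obtain ⟨m, hm⟩ := (TopologicalSpace.denseRange_denseSeq Θ).exists_mem_open
    (isOpen_lt continuous_const hFc) ⟨θ, hFθ⟩
  exact ⟨m, hm⟩

variable [IsProbabilityMeasure μ]

lemma integral_signMean_denseSamplePartial_le (hα : 0 < α) (hα1 : α ≤ 1)
    (hℓ : LossAssumption ℓ γ q) (hD : DataAssumption μ P X Y O α q)
    (hΘ : Bornology.IsBounded Θ) [Nonempty Θ] (j : Fin d) (N : ℕ) :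
    ∫ ω, signMean (fun τ : {i // i ∉ O} → Bool => ⨆ m : Fin (N + 1),
      ∑ i, boolSign (τ i) * denseSamplePartial ℓ Θ j m (X i ω, Y i ω)) ∂μ ≤
      rademacherComplexity μ ℓ Θ X Y O j := by
  have hm : ∀ i : {i // i ∉ O}, Measurable fun ω => (X i ω, Y i ω) := fun i => hD.measurable i i.2
  have hP : ∀ i : {i // i ∉ O}, μ.map (fun ω => (X i ω, Y i ω)) = P := fun i => hD.law i i.2
  obtain ⟨D, hDb⟩ := hΘ.exists_norm_le
  obtain ⟨G, hGm, hGp, hG⟩ := exists_envelope hα hα1 hℓ hD j D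
  have hGi : Integrable G P := integrable_of_memLp (by linarith) hGp
  rw [rademacherComplexity_eq hα hα1 hℓ hD hΘ j]
  refine integral_mono ?_ ?_ fun ω => signMean_mono fun τ => ciSup_le fun m => ?_
  · refine (integrable_finsetSum _ fun σ _ => integrable_ciSup (fun m =>
      Finset.measurable_sum _ fun i _ => ?_) fun m => integrable_finsetSum _ fun i _ => ?_).div_const _
    · exact ((hℓ.measurable_samplePartial j _).comp (hm i)).const_mul _
    · exact ((measurePreserving_of_map_eq hm hP i).integrable_comp_of_integrable
        (integrable_of_memLp (by linarith) (memLp_samplePartial hα hα1 hℓ hD j _))).const_mul _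
  · exact (integrable_finsetSum _ fun σ _ => integrable_ciSup_signed
      (f := fun (θ : Θ) p => samplePartial ℓ j θ p.1 p.2) hm hP
      (fun θ => hℓ.measurable_samplePartial j θ)
      (fun s => (hℓ.continuous_samplePartial j s.1 s.2).comp continuous_subtype_val)
      hGi (fun θ s => hG θ s (hDb θ θ.2)) _).div_const _
  · have hb : BddAbove (Set.range fun θ : Θ =>
        ∑ i : {i // i ∉ O}, boolSign (τ i) * samplePartial ℓ j θ (X i ω) (Y i ω)) :=
      bddAbove_of_abs ⟨_, fun θ => abs_sum_mul_le_envelope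
        (f := fun (θ : Θ) p => samplePartial ℓ j θ p.1 p.2) (fun θ s => hG θ s (hDb θ θ.2))
        (fun i => boolSign (τ i)) (fun i : {i // i ∉ O} => (X i ω, Y i ω)) θ⟩
    exact le_ciSup hb (TopologicalSpace.denseSeq Θ m)

/-- The deviation bound at a level `ε`, with a free constant `C` in front of the moments. -/
theorem measure_le_momDeviation_le [NeZero K] (hα : 0 < α) (hα1 : α ≤ 1)
    (hℓ : LossAssumption ℓ γ q) (hD : DataAssumption μ P X Y O α q)
    (hΘ : Bornology.IsBounded Θ) [Nonempty Θ] {B : Ω → Fin n → Fin K}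
    (hB : RandomBlocks μ X Y O B) (j : Fin d) {ε C : ℝ} (hε : 0 < ε) (hC : 0 < C)
    (hOC : (O.card : ℝ) / K + 1 / 3 + 8 / (3 * C) < 1 / 2)
    (hM : C * maxCenteredMoment ℓ P Θ α j * ((K : ℝ) / n) ^ α ≤ ε ^ (1 + α))
    (hR : 64 * rademacherComplexity μ ℓ Θ X Y O j / n ≤ ε) :
    μ {ω | ε ≤ momDeviation ℓ P Θ (B ω) (fun i => X i ω) (fun i => Y i ω) j} ≤
      ENNReal.ofReal (Real.exp (-(K : ℝ) / 18)) := by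
  have hK : (0 : ℝ) < K := Nat.cast_pos.2 (NeZero.pos K)
  have hn : (0 : ℝ) < n := hK.trans_le (Nat.cast_le.2 hB.le)
  have hm : ∀ i : {i // i ∉ O}, Measurable fun ω => (X i ω, Y i ω) := fun i => hD.measurable i i.2
  have hP : ∀ i : {i // i ∉ O}, μ.map (fun ω => (X i ω, Y i ω)) = P := fun i => hD.law i i.2
  set M := maxCenteredMoment ℓ P Θ α j with hMdef
  set R := rademacherComplexity μ ℓ Θ X Y O j with hRdef
  -- In order: the Rademacher term, the mean of the ramps, and the fluctuation.
  set A : ℝ := K / 6 + K * (8 / (3 * C)) + K / 6 with hAdef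
  have hA0 : 0 ≤ A := by positivity
  have hA : A < (K : ℝ) / 2 - O.card := by
    have h1 := mul_lt_mul_of_pos_left hOC hK
    have h2 : (K : ℝ) * (O.card / K) = O.card := by field_simp
    rw [mul_add, mul_add, h2] at h1
    rw [hAdef]
    linarith
  set E : (Fin n → Fin K) → Set ({i // i ∉ O} → EuclideanSpace ℝ (Fin d) × 𝒴) := fun b =>
    {z | ∃ m : ℕ, A < ∑ k, ramp (blockDev P (denseSamplePartial ℓ Θ j) (cleanBlock b O) z k m / ε)}
    with hE
  have hEm : ∀ b, MeasurableSet (E b) := fun b => by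
    have : E b = ⋃ m : ℕ, {z | A < ∑ k, ramp (blockDev P (denseSamplePartial ℓ Θ j)
        (cleanBlock b O) z k m / ε)} := by
      ext z
      simp [hE]
    rw [this]
    refine MeasurableSet.iUnion fun m => measurableSet_lt measurable_const
      (Finset.measurable_sum _ fun k _ => ramp_continuous.measurable.comp
        ((measurable_blockDev (fun m => ?_) k m).div_const _))
    exact hℓ.measurable_samplePartial j _
  have hEb : ∀ ω₀, μ ((fun ω (i : {i // i ∉ O}) => (X i ω, Y i ω)) ⁻¹' E (B ω₀)) ≤
      ENNReal.ofReal (Real.exp (-(K : ℝ) / 18)) := fun ω₀ => by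
    set b := B ω₀
    refine measure_exists_sum_ramp_blockDev_gt_le (P := P) (p := 1 + α) (w := 2 * K / n) (M := M)
      (R := R) (f := denseSamplePartial ℓ Θ j) hD.indep hm hP
      (fun m => hℓ.measurable_samplePartial j _) (by linarith) (by linarith)
      (fun m => memLp_samplePartial hα hα1 hℓ hD j _) disjoint_cleanBlock (fun k => ?_)
      (by positivity)
      (fun m => centeredMoment_le_maxCenteredMoment hα hα1 hℓ hD hΘ j _)
      (integral_signMean_denseSamplePartial_le hα hα1 hℓ hD hΘ j) hε ?_ ?_
    · rw [card_cleanBlock, div_mul_eq_mul_div, le_div_iff₀ hn, one_mul]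
      exact_mod_cast le_two_mul_mul_card_block hB.le (hB.balanced ω₀) k.1
    · exact_mod_cast (Fintype.card_subtype_le _).trans (Fintype.card_fin K).le
    · rw [hAdef]
      gcongr ?_ + ?_ * ?_ + _
      · rw [div_le_iff₀ hn] at hR
        rw [div_le_iff₀ hε]
        have : 16 / 3 * (2 * K / n) * R = K / (6 * n) * (64 * R) := by
          field_simp
          ring
        rw [this]
        calc K / (6 * n) * (64 * R) ≤ K / (6 * n) * (ε * n) := by gcongr
          _ = K / 6 * ε := by field_simp
      · rw [div_le_iff₀ (by positivity)]
        -- The von Bahr–Esseen constant `2^(1-α)` and the loss `2^α` from the block sizes multiply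
        -- to `2`.
        have h1 : (2 : ℝ) ^ (2 - (1 + α)) * (2 * K / n) ^ (1 + α - 1) = 2 * ((K : ℝ) / n) ^ α := by
          rw [mul_div_assoc, add_sub_cancel_left, Real.mul_rpow two_pos.le (by positivity),
            ← mul_assoc, ← Real.rpow_add two_pos]
          congr 1
          rw [show 2 - (1 + α) + α = 1 by ring, Real.rpow_one]
        rw [h1]
        calc 4 / 3 * (2 * ((K : ℝ) / n) ^ α * M) = 8 / (3 * C) * (C * M * ((K : ℝ) / n) ^ α) := by
              field_simp
              ring
          _ ≤ _ := by gcongr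
  -- Only the larger event on the right, which involves the partition and the inliers, is
  -- measurable; the outliers need not be.
  have hsub : {ω | ε ≤ momDeviation ℓ P Θ (B ω) (fun i => X i ω) (fun i => Y i ω) j} ⊆
      ⋃ b, (B ⁻¹' {b} ∩ (fun ω (i : {i // i ∉ O}) => (X i ω, Y i ω)) ⁻¹' E b) := fun ω hω =>
    Set.mem_iUnion.2 ⟨B ω, rfl, exists_lt_sum_ramp_of_le_momDeviation hα hα1 hℓ hD hΘ j hε hA0 hA
      (fun i => X i ω) (fun i => Y i ω) hω⟩
  calc _ ≤ μ (⋃ b, (B ⁻¹' {b} ∩ (fun ω (i : {i // i ∉ O}) => (X i ω, Y i ω)) ⁻¹' E b)) :=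
        measure_mono hsub
    _ ≤ ∑ b, μ (B ⁻¹' {b} ∩ (fun ω (i : {i // i ∉ O}) => (X i ω, Y i ω)) ⁻¹' E b) :=
        measure_iUnion_fintype_le _ _
    _ ≤ ∑ b, μ (B ⁻¹' {b}) * ENNReal.ofReal (Real.exp (-(K : ℝ) / 18)) := by
        refine Finset.sum_le_sum fun b _ => ?_
        rw [hB.indep.measure_inter_preimage_eq_mul _ _ (measurableSet_singleton b) (hEm b)]
        -- Balance is known only for partitions that `B` takes as values; the others have an empty
        -- preimage.
        by_cases hb : ∃ ω₀, B ω₀ = b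
        · obtain ⟨ω₀, rfl⟩ := hb
          gcongr
          exact hEb ω₀
        · have : B ⁻¹' {b} = ∅ := by
            ext ω
            simpa using fun h => hb ⟨ω, h⟩
          simp [this]
    _ = ENNReal.ofReal (Real.exp (-(K : ℝ) / 18)) := by
        rw [← Finset.sum_mul, sum_measure_preimage_singleton _ fun b _ =>
          hB.measurable (measurableSet_singleton b)]
        simp

/-- The deviation bound at a nonnegative level, which may vanish. -/
theorem measureReal_lt_momDeviation_le [NeZero K] (hα : 0 < α) (hα1 : α ≤ 1)
    (hℓ : LossAssumption ℓ γ q) (hD : DataAssumption μ P X Y O α q)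
    (hΘ : Bornology.IsBounded Θ) [Nonempty Θ] {B : Ω → Fin n → Fin K}
    (hB : RandomBlocks μ X Y O B) (j : Fin d) {ε C : ℝ} (hε : 0 ≤ ε) (hC : 0 < C)
    (hOC : (O.card : ℝ) / K + 1 / 3 + 8 / (3 * C) < 1 / 2)
    (hM : C * maxCenteredMoment ℓ P Θ α j * ((K : ℝ) / n) ^ α ≤ ε ^ (1 + α))
    (hR : 64 * rademacherComplexity μ ℓ Θ X Y O j / n ≤ ε) :
    μ.real {ω | ε < momDeviation ℓ P Θ (B ω) (fun i => X i ω) (fun i => Y i ω) j} ≤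
      Real.exp (-(K : ℝ) / 18) := by
  refine ENNReal.toReal_le_of_le_ofReal (Real.exp_nonneg _) ?_
  -- The level may be zero, where the ramp cannot be rescaled, so the bound is applied at `ε + 1 /
  -- (m + 1)`. These events increase to the strict event.
  have hle : ∀ m : ℕ, μ {ω | ε + 1 / ((m : ℝ) + 1) ≤
      momDeviation ℓ P Θ (B ω) (fun i => X i ω) (fun i => Y i ω) j} ≤
      ENNReal.ofReal (Real.exp (-(K : ℝ) / 18)) := fun m => by
    have h1 : (0 : ℝ) < 1 / ((m : ℝ) + 1) := by positivity
    refine measure_le_momDeviation_le hα hα1 hℓ hD hΘ hB j (by linarith) hC hOC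
      (hM.trans ?_) (hR.trans (by linarith))
    exact Real.rpow_le_rpow hε (by linarith) (by linarith)
  have hmono : Monotone fun m : ℕ => {ω | ε + 1 / ((m : ℝ) + 1) ≤
      momDeviation ℓ P Θ (B ω) (fun i => X i ω) (fun i => Y i ω) j} := fun m m' hmm ω hω => by
    have h1 : ε + 1 / ((m : ℝ) + 1) ≤
      momDeviation ℓ P Θ (B ω) (fun i => X i ω) (fun i => Y i ω) j := hω
    have h2 := Nat.one_div_le_one_div (α := ℝ) hmm
    exact (add_le_add_right h2 ε).trans h1
  have hsub : {ω | ε < momDeviation ℓ P Θ (B ω) (fun i => X i ω) (fun i => Y i ω) j} ⊆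
      ⋃ m : ℕ, {ω | ε + 1 / ((m : ℝ) + 1) ≤
        momDeviation ℓ P Θ (B ω) (fun i => X i ω) (fun i => Y i ω) j} := fun ω hω => by
    have hω' : ε < momDeviation ℓ P Θ (B ω) (fun i => X i ω) (fun i => Y i ω) j := hω
    obtain ⟨m, hmω⟩ := exists_nat_one_div_lt (sub_pos.2 hω')
    refine Set.mem_iUnion.2 ⟨m, ?_⟩
    change ε + 1 / ((m : ℝ) + 1) ≤
      momDeviation ℓ P Θ (B ω) (fun i => X i ω) (fun i => Y i ω) j
    linarith
  refine (measure_mono hsub).trans ?_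
  rw [hmono.measure_iUnion]
  exact iSup_le hle

end Deviation

/-! ### Arithmetic of the levels. -/

section Constants

variable {α : ℝ}

lemma mul_rpow_le_rpow_max (hα : 0 < α) {M c r n K : ℝ} (hM : 0 ≤ M) (hn : 0 < n) (hK : 0 < K)
    (hc : 0 ≤ c) : c * M * (K / n) ^ α ≤ (max ((c * M / (n / K) ^ α) ^ (1 / (1 + α))) r) ^ (1 + α) := by
  have h0 : 0 ≤ c * M / (n / K) ^ α := by positivity
  have e : c * M * (K / n) ^ α = ((c * M / (n / K) ^ α) ^ (1 / (1 + α))) ^ (1 + α) := by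
    have e0 : ((n / K) ^ α)⁻¹ = (K / n) ^ α := by
      rw [← Real.inv_rpow (by positivity), inv_div]
    rw [← Real.rpow_mul h0, one_div_mul_cancel (by positivity), Real.rpow_one, ← e0,
      ← div_eq_mul_inv]
  rw [e]
  exact Real.rpow_le_rpow (by positivity) (le_max_left _ _) (by positivity)

lemma two_rpow_mul_nine_rpow (hα : 0 < α) :
    ((2 : ℝ) ^ ((2 + α) / (1 + α)) * 3 ^ 2) ^ (1 + α) = 36 * 18 ^ α := by
  have h1 : (1 + α) ≠ 0 := by positivity
  rw [Real.mul_rpow (by positivity) (by positivity), ← Real.rpow_mul two_pos.le,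
    div_mul_cancel₀ _ h1, show (2 + α) = 1 + (1 + α) by ring, Real.rpow_add two_pos, Real.rpow_one,
    mul_assoc, ← Real.mul_rpow two_pos.le (by positivity), show (2 : ℝ) * 3 ^ 2 = 18 by norm_num,
    Real.rpow_add (by norm_num), Real.rpow_one]
  ring

/-- The level of the bounds at confidence `δ` dominates the level of the bound for `K` blocks. -/
lemma mul_rpow_le_rpow_max_log (hα : 0 < α) (hα1 : α ≤ 1) {M C r n K τ Λ : ℝ} (hM : 0 ≤ M)
    (hn : 0 < n) (hK : 0 < K) (hΛ : 0 < Λ) (hτ1 : 1 ≤ τ) (hC : 0 ≤ C) (hCτ : C * τ ≤ 36)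
    (hKτ : K ≤ τ * (18 * Λ)) :
    C * M * (K / n) ^ α ≤ (max ((2 : ℝ) ^ ((2 + α) / (1 + α)) * 3 ^ 2 *
      M ^ (1 / (1 + α)) * (Λ / n) ^ (α / (1 + α))) r) ^ (1 + α) := by
  have h1 : (1 + α) ≠ 0 := by positivity
  have e : 36 * M * (18 * Λ / n) ^ α = ((2 : ℝ) ^ ((2 + α) / (1 + α)) * 3 ^ 2 *
      M ^ (1 / (1 + α)) * (Λ / n) ^ (α / (1 + α))) ^ (1 + α) := by
    rw [Real.mul_rpow (by positivity) (by positivity), Real.mul_rpow (by positivity) (by positivity),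
      two_rpow_mul_nine_rpow hα, ← Real.rpow_mul hM, ← Real.rpow_mul (by positivity),
      div_mul_cancel₀ _ h1, div_mul_cancel₀ _ h1, Real.rpow_one, mul_div_assoc,
      Real.mul_rpow (by norm_num) (by positivity)]
    ring
  calc C * M * (K / n) ^ α ≤ C * M * (τ * (18 * Λ / n)) ^ α := by
        have : K / n ≤ τ * (18 * Λ / n) := by
          rw [← mul_div_assoc]
          gcongr
        gcongr
    _ = C * M * (τ ^ α * (18 * Λ / n) ^ α) := by
        rw [Real.mul_rpow (by linarith) (by positivity)]
    _ ≤ C * M * (τ * (18 * Λ / n) ^ α) := by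
        -- As `τ ≥ 1` and `α ≤ 1`, rounding `K` up costs at most a factor `τ`, which is paid for by
        -- a smaller `C`.
        have : τ ^ α ≤ τ := by
          simpa using Real.rpow_le_rpow_of_exponent_le hτ1 hα1
        gcongr
    _ = (C * τ) * (M * (18 * Λ / n) ^ α) := by ring
    _ ≤ 36 * (M * (18 * Λ / n) ^ α) := by gcongr
    _ = 36 * M * (18 * Λ / n) ^ α := by ring
    _ = _ := e
    _ ≤ _ := Real.rpow_le_rpow (by positivity) (le_max_left _ _) (by positivity)

end Constants

/-! ### Deviation bounds at a prescribed confidence. -/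

section Confidence

variable {Ω : Type*} [MeasurableSpace Ω] {μ : Measure Ω} [IsProbabilityMeasure μ] {d n K : ℕ}
  {𝒴 : Set ℝ} {ℓ : ℝ → 𝒴 → ℝ} {γ q α : ℝ} {P : Measure (EuclideanSpace ℝ (Fin d) × 𝒴)}
  [IsProbabilityMeasure P] {Θ : Set (EuclideanSpace ℝ (Fin d))}
  {X : Fin n → Ω → EuclideanSpace ℝ (Fin d)} {Y : Fin n → Ω → 𝒴} {O : Finset (Fin n)}

/-- The deviation bound for `K < 18 Λ + 1` blocks, at the level given by `Λ`. -/
theorem measureReal_log_lt_momDeviation_le [NeZero K] (hα : 0 < α) (hα1 : α ≤ 1)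
    (hℓ : LossAssumption ℓ γ q) (hD : DataAssumption μ P X Y O α q)
    (hΘ : Bornology.IsBounded Θ) [Nonempty Θ] {B : Ω → Fin n → Fin K}
    (hB : RandomBlocks μ X Y O B) (hO : (O.card : ℝ) ≤ (K : ℝ) / 12) (j : Fin d) {Λ : ℝ}
    (hΛ : 1 ≤ 18 * Λ) (hKΛ : (K : ℝ) < 18 * Λ + 1) :
    μ.real {ω | max ((2 : ℝ) ^ ((2 + α) / (1 + α)) * 3 ^ 2 *
        maxCenteredMoment ℓ P Θ α j ^ (1 / (1 + α)) * (Λ / n) ^ (α / (1 + α)))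
        (64 * rademacherComplexity μ ℓ Θ X Y O j / n) <
      momDeviation ℓ P Θ (B ω) (fun i => X i ω) (fun i => Y i ω) j} ≤
      Real.exp (-(K : ℝ) / 18) := by
  have hK : (0 : ℝ) < K := Nat.cast_pos.2 (NeZero.pos K)
  have hn : (0 : ℝ) < n := hK.trans_le (Nat.cast_le.2 hB.le)
  have hM0 := maxCenteredMoment_nonneg (ℓ := ℓ) (P := P) (Θ := Θ) (α := α) j
  have hε : 0 ≤ max ((2 : ℝ) ^ ((2 + α) / (1 + α)) * 3 ^ 2 *
      maxCenteredMoment ℓ P Θ α j ^ (1 / (1 + α)) * (Λ / n) ^ (α / (1 + α)))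
      (64 * rademacherComplexity μ ℓ Θ X Y O j / n) := by
    have : 0 < Λ := by linarith
    exact le_max_of_le_left (by positivity)
  -- Rounding up makes `K` exceed `18 Λ`, and the constant `36` must absorb it. For `K < 12` there
  -- are no outliers, so `C = 18` is allowed as `1/3 + 4/27 < 1/2`, and `K ≤ 2 (18 Λ)`. For `K ≥
  -- 12`, `K - 1 ≥ 11 K / 12` gives `τ = 12 / 11`, and `C = 33` still fits: `1/12 + 1/3 + 8/99 <
  -- 1/2`.
  rcases lt_or_ge K 12 with hK12 | hK12
  · have hO0 : O.card = 0 := by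
      have h1 : (K : ℝ) < 12 := by exact_mod_cast hK12
      have h2 : (O.card : ℝ) < 1 := by linarith
      have : O.card < 1 := by exact_mod_cast h2
      omega
    refine measureReal_lt_momDeviation_le hα hα1 hℓ hD hΘ hB j hε (C := 18) (by norm_num)
      (by rw [hO0]; norm_num) ?_ (le_max_right _ _)
    refine mul_rpow_le_rpow_max_log (τ := 2) hα hα1 hM0 hn hK (by linarith) (by norm_num)
      (by norm_num) (by norm_num) (by linarith)
  · have h1 : (12 : ℝ) ≤ K := by exact_mod_cast hK12
    refine measureReal_lt_momDeviation_le hα hα1 hℓ hD hΘ hB j hε (C := 33) (by norm_num)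
      ?_ ?_ (le_max_right _ _)
    · have : (O.card : ℝ) / K ≤ 1 / 12 := by
        rw [div_le_iff₀ hK]
        linarith
      norm_num at this ⊢
      linarith
    · refine mul_rpow_le_rpow_max_log (τ := 12 / 11) hα hα1 hM0 hn hK (by linarith) (by norm_num)
        (by norm_num) (by norm_num) (by linarith)

end Confidence

lemma exp_neg_ceil_log_le {K : ℕ} {t : ℝ} (ht : 0 < t) (hK : K = ⌈18 * Real.log t⌉₊) :
    Real.exp (-(K : ℝ) / 18) ≤ t⁻¹ := by
  have h1 : 18 * Real.log t ≤ K := hK ▸ Nat.le_ceil _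
  rw [← Real.exp_log (inv_pos.2 ht), Real.log_inv]
  exact Real.exp_le_exp.2 (by linarith)

end RobustMOM

theorem proposition2 (α : ℝ) (hα₀ : 0 < α) (hα₁ : α ≤ 1) :
    ∃ Cα : ℝ, ∀ {Ω : Type*} [MeasurableSpace Ω] (μ : Measure Ω) [IsProbabilityMeasure μ]
      (d n : ℕ) (𝒴 : Set ℝ) (ℓ : ℝ → 𝒴 → ℝ) (γ q : ℝ) (Θ : Set (EuclideanSpace ℝ (Fin d)))
      (P : Measure (EuclideanSpace ℝ (Fin d) × 𝒴)) [IsProbabilityMeasure P]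
      (X : Fin n → Ω → EuclideanSpace ℝ (Fin d)) (Y : Fin n → Ω → 𝒴) (O : Finset (Fin n)),
      Convex ℝ Θ → IsCompact Θ → (0 : EuclideanSpace ℝ (Fin d)) ∈ Θ →
      LossAssumption ℓ γ q → DataAssumption μ P X Y O α q →
      (∀ (K : ℕ) [NeZero K] (B : Ω → Fin n → Fin K), RandomBlocks μ X Y O B →
        (O.card : ℝ) ≤ (K : ℝ) / 12 →
        -- the deviation bound for the number `K` of blocks
        (∀ j : Fin d,
          (0 < max ((36 * maxCenteredMoment ℓ P Θ α j / ((n : ℝ) / K) ^ α) ^ (1 / (1 + α)))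
              (64 * rademacherComplexity μ ℓ Θ X Y O j / n) →
            μ.real {ω |
              max ((36 * maxCenteredMoment ℓ P Θ α j / ((n : ℝ) / K) ^ α) ^ (1 / (1 + α)))
                (64 * rademacherComplexity μ ℓ Θ X Y O j / n) ≤
              momDeviation ℓ P Θ (B ω) (fun i => X i ω) (fun i => Y i ω) j} ≤
              Real.exp (-(K : ℝ) / 18)) ∧
          μ.real {ω |
            max ((36 * maxCenteredMoment ℓ P Θ α j / ((n : ℝ) / K) ^ α) ^ (1 / (1 + α)))
              (64 * rademacherComplexity μ ℓ Θ X Y O j / n) <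
            momDeviation ℓ P Θ (B ω) (fun i => X i ω) (fun i => Y i ω) j} ≤
            Real.exp (-(K : ℝ) / 18)) ∧
        -- the deviation bounds at confidence level `δ`
        (∀ δ : ℝ, 0 < δ → δ < 1 → 1 ≤ 18 * Real.log ((d : ℝ) / δ) →
          (K = ⌈18 * Real.log (1 / δ)⌉₊ → ∀ j : Fin d,
            μ.real {ω |
              max ((2 : ℝ) ^ ((2 + α) / (1 + α)) * 3 ^ 2 *
                  maxCenteredMoment ℓ P Θ α j ^ (1 / (1 + α)) *
                  (Real.log ((d : ℝ) / δ) / n) ^ (α / (1 + α)))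
                (64 * rademacherComplexity μ ℓ Θ X Y O j / n) <
              momDeviation ℓ P Θ (B ω) (fun i => X i ω) (fun i => Y i ω) j} ≤ δ) ∧
          (K = ⌈18 * Real.log ((d : ℝ) / δ)⌉₊ →
            μ.real {ω | ∃ j : Fin d,
              max ((2 : ℝ) ^ ((2 + α) / (1 + α)) * 3 ^ 2 *
                  maxCenteredMoment ℓ P Θ α j ^ (1 / (1 + α)) *
                  (Real.log ((d : ℝ) / δ) / n) ^ (α / (1 + α)))
                (64 * rademacherComplexity μ ℓ Θ X Y O j / n) <
              momDeviation ℓ P Θ (B ω) (fun i => X i ω) (fun i => Y i ω) j} ≤ δ))) ∧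
      -- the bound on the Rademacher complexity
      ((∀ k : Fin d, Integrable (fun p => |p.1 k| ^ (2 * (1 + α))) P) → ∀ j : Fin d,
        rademacherComplexity μ ℓ Θ X Y O j ≤
          γ * Metric.diam Θ * Cα *
            ((n : ℝ) * featureMoment P α j ^ (1 + α) *
              ∑ k, featureMoment P α k ^ (1 + α)) ^ (1 / (1 + α)) ∧
        ∀ m : ℝ, (∀ k : Fin d, featureMoment P α k ≤ m) →
          rademacherComplexity μ ℓ Θ X Y O j ≤
            γ * Metric.diam Θ * Cα * m ^ 2 * ((n : ℝ) * d) ^ (1 / (1 + α))) := by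
  refine ⟨2, ?_⟩
  intro Ω _ μ _ d n 𝒴 ℓ γ q Θ P _ X Y O _ hΘ h0 hℓ hD
  have : Nonempty Θ := ⟨⟨0, h0⟩⟩
  refine ⟨fun K _ B hB hO => ⟨fun j => ?_, fun δ hδ hδ1 hdδ => ⟨fun hK j => ?_, fun hK => ?_⟩⟩,
    fun hX j => ⟨rademacherComplexity_le hα₀ hα₁ hℓ hD hΘ h0 hX j, fun m hm =>
      rademacherComplexity_le_of_featureMoment_le hα₀ hα₁ hℓ hD hΘ h0 hX j hm⟩⟩
  · have hK : (0 : ℝ) < K := Nat.cast_pos.2 (NeZero.pos K)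
    have hn : (0 : ℝ) < n := hK.trans_le (Nat.cast_le.2 hB.le)
    have hM0 := maxCenteredMoment_nonneg (ℓ := ℓ) (P := P) (Θ := Θ) (α := α) j
    -- With `C = 36` the left side is at most `1/12 + 1/3 + 2/27 = 53/108`.
    have hOC : (O.card : ℝ) / K + 1 / 3 + 8 / (3 * 36) < 1 / 2 := by
      have : (O.card : ℝ) / K ≤ 1 / 12 := by
        rw [div_le_iff₀ hK]
        linarith
      norm_num at this ⊢
      linarith
    have hM := mul_rpow_le_rpow_max (r := 64 * rademacherComplexity μ ℓ Θ X Y O j / n)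
      hα₀ hM0 hn hK (c := 36) (by norm_num)
    exact ⟨fun hb => ENNReal.toReal_le_of_le_ofReal (Real.exp_nonneg _)
        (measure_le_momDeviation_le hα₀ hα₁ hℓ hD hΘ.isBounded hB j hb (by norm_num) hOC hM
          (le_max_right _ _)),
      measureReal_lt_momDeviation_le hα₀ hα₁ hℓ hD hΘ.isBounded hB j
        (le_max_of_le_left (by positivity)) (by norm_num) hOC hM (le_max_right _ _)⟩
  · have hd : (1 : ℝ) ≤ d := by exact_mod_cast (Fin.pos j)
    have hle : Real.log (1 / δ) ≤ Real.log (d / δ) :=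
      Real.log_le_log (by positivity) (by gcongr)
    have hlog : 0 ≤ Real.log (1 / δ) := Real.log_nonneg (by rw [le_div_iff₀ hδ]; linarith)
    refine (measureReal_log_lt_momDeviation_le hα₀ hα₁ hℓ hD hΘ.isBounded hB hO j hdδ ?_).trans
      ((exp_neg_ceil_log_le (by positivity) hK).trans_eq (by simp))
    have := Nat.ceil_lt_add_one (mul_nonneg (by norm_num : (0 : ℝ) ≤ 18) hlog)
    rw [hK]
    linarith
  -- The case `d = 0` is excluded because `Real.log 0 = 0` contradicts the lower bound on the
  -- logarithm. The simultaneous statement is a union bound, each coordinate failing with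
  -- probability at most `δ / d`.
  · have hd : (0 : ℝ) < d := by
      rcases Nat.eq_zero_or_pos d with rfl | h
      · norm_num at hdδ
      · exact_mod_cast h
    rw [Set.ofPred_exists]
    calc _ ≤ ∑ j : Fin d, μ.real _ := measureReal_iUnion_fintype_le _
      _ ≤ ∑ j : Fin d, δ / d := Finset.sum_le_sum fun j _ =>
          (measureReal_log_lt_momDeviation_le hα₀ hα₁ hℓ hD hΘ.isBounded hB hO j hdδ
            (by rw [hK]; exact Nat.ceil_lt_add_one (by linarith))).trans
          ((exp_neg_ceil_log_le (by positivity) hK).trans_eq (inv_div _ _))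
      _ = δ := by
          rw [Finset.sum_const, Finset.card_univ, Fintype.card_fin, nsmul_eq_mul]
          field_simp
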